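/- Let $\ell>0$ and $\alpha>0$. Let $\Lambda_\ell=(\mathbb R/\ell\mathbb Z)^3$ be the cube of side length $\ell$ with periodic boundary conditions, let $\mathcal F=\bigoplus_{n\ge 0}\bigotimes^n_{\rm sym}L^2(\mathbb R^3)$ be the bosonic Fock space over $L^2(\mathbb R^3)$, and let $\mathscr H_\ell=L^2(\Lambda_\ell)\otimes\mathcal F$, whose elements are the sequences $\Psi=(\Psi^{(n)})_{n\ge0}$ of functions $\Psi^{(n)}(x,y_1,\dots,y_n)$ in $L^2(\Lambda_\ell\times\mathbb R^{3n})$, symmetric in $y_1,\dots,y_n$, with $\sum_n\|\Psi^{(n)}\|^2<\infty$. Consider on $\mathscr H_\ell$ $$h_\ell=(-\mathrm i\nabla_x-P_f)^2+N+\sqrt\alpha\,\phi(v),$$ where $P_f=\mathrm d\Gamma(-\mathrm i\nabla)$, that is, $(P_f\Psi)^{(n)}=\sum_{i=1}^n-\mathrm i\nabla_{y_i}\Psi^{(n)}$, where $(N\Psi)^{(n)}=n\Psi^{(n)}$, and where $\phi(v)=a(v)+a^*(v)$ with $v(y)=|y|^{-2}$ and $$(a(v)\Psi)^{(n)}(x,y_1,\dots,y_n)=\sqrt{n+1}\int_{\mathbb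 R^3}v(y)\,\Psi^{(n+1)}(x,y,y_1,\dots,y_n)\,dy .$$ Since $v\notin L^2(\mathbb R^3)$, $h_\ell$ is understood as the self-adjoint operator associated with the quadratic form $$\Psi\mapsto\|(-\mathrm i\nabla_x-P_f)\Psi\|^2+\|N^{1/2}\Psi\|^2+2\sqrt\alpha\,\operatorname{Re}\langle\Psi,a(v)\Psi\rangle$$ on the form domain of $(-\mathrm i\nabla_x-P_f)^2+N$, i.e. on the set of all $\Psi\in\mathscr H_\ell$ for which $(-\mathrm i\nabla_x-P_f)\Psi$ (in the weak sense) and $N^{1/2}\Psi$ are square integrable. Here $\langle\Psi,a(v)\Psi\rangle$ means $\sum_n\langle\Psi^{(n)},(a(v)\Psi)^{(n)}\rangle$. If $\inf\sigma(h_\ell)$ is an eigenvalue of $h_\ell$, then this eigenvalue has multiplicity one, i.e. its eigenspace is one-dimensional over $\mathbb C$. -/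

import Mathlib

open MeasureTheory
open scoped ContDiff ComplexConjugate

noncomputable section

namespace Polaron

/-! ### Unbounded operators, given by their graphs -/

section Operators

variable {H : Type*} [NormedAddCommGroup H] [InnerProductSpace ℂ H]

/-- The graph of the operator associated with a sesquilinear form `q` (antilinear in the first
argument) with form domain `D`: a pair `(Ψ, Φ)` belongs to it iff `Ψ ∈ D` and
`q(Θ, Ψ) = ⟨Θ, Φ⟩` for all `Θ ∈ D`. -/
def formOperator (D : Set H) (q : H → H → ℂ) : Set (H × H) :=
  {p | p.1 ∈ D ∧ ∀ Θ ∈ D, q Θ p.1 = inner ℂ Θ p.2}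

/-- `z` lies in the resolvent set of the operator with graph `A` iff `A - z` has an everywhere
defined bounded two-sided inverse `R`, that is, `(A - z) Ψ = Φ ↔ Ψ = R Φ`. -/
def opResolventSet (A : Set (H × H)) : Set ℂ :=
  {z | ∃ R : H →L[ℂ] H, ∀ Φ Ψ : H, (Ψ, Φ + z • Ψ) ∈ A ↔ Ψ = R Φ}

/-- The spectrum: the complement of the resolvent set. -/
def opSpectrum (A : Set (H × H)) : Set ℂ := (opResolventSet A)ᶜ

/-- The set of all `Ψ` in the domain of `A` with `A Ψ = z Ψ`. -/
def opEigenspace (A : Set (H × H)) (z : ℂ) : Set H := {Ψ | (Ψ, z • Ψ) ∈ A}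

/-- `z` is an eigenvalue of `A`. -/
def IsOpEigenvalue (A : Set (H × H)) (z : ℂ) : Prop := ∃ Ψ ∈ opEigenspace A z, Ψ ≠ 0

/-- The eigenspace of `A` for `z` is a one-dimensional complex subspace. -/
def HasOpMultiplicityOne (A : Set (H × H)) (z : ℂ) : Prop :=
  ∃ Ψ₀ : H, Ψ₀ ≠ 0 ∧ opEigenspace A z = (Submodule.span ℂ {Ψ₀} : Set H)

end Operators

/-! ### The Hilbert space `L²(Λ_ℓ) ⊗ 𝓕` -/

/-- Three-dimensional Euclidean space. -/
abbrev E3 : Type := EuclideanSpace ℝ (Fin 3)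

/-- The cube of side length `ℓ` with periodic boundary conditions, `(ℝ / ℓℤ)³`; its volume
is `ℓ³`. -/
abbrev Torus (ℓ : ℝ) : Type := Fin 3 → AddCircle ℓ

/-- Configurations `(x, y₁, …, yₙ)` of the electron on the torus and of `n` phonons. -/
abbrev Config (ℓ : ℝ) (n : ℕ) : Type := Torus ℓ × (Fin n → E3)

/-- Permutation of the phonon coordinates. -/
def permute (ℓ : ℝ) {n : ℕ} (σ : Equiv.Perm (Fin n)) (z : Config ℓ n) : Config ℓ n :=
  (z.1, fun i => z.2 (σ i))

variable (ℓ : ℝ) [Fact (0 < ℓ)]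

/-- `L²(Λ_ℓ × ℝ³ⁿ)` with Lebesgue measure. -/
abbrev L2 (n : ℕ) : Type := Lp ℂ 2 (volume : Measure (Config ℓ n))

theorem measurePreserving_permute {n : ℕ} (σ : Equiv.Perm (Fin n)) :
    MeasurePreserving (permute ℓ σ) (volume : Measure (Config ℓ n)) volume := by
  have h : MeasurePreserving (fun (y : Fin n → E3) (i : Fin n) => y (σ i)) volume volume := by
    have h' := volume_measurePreserving_piCongrLeft (fun _ : Fin n => E3) σ.symm
    have e : (fun (y : Fin n → E3) (i : Fin n) => y (σ i)) =
        MeasurableEquiv.piCongrLeft (fun _ : Fin n => E3) σ.symm := by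
      funext y i
      have h2 := Equiv.piCongrLeft_apply_apply (fun _ : Fin n => E3) σ.symm y (σ i)
      rw [Equiv.symm_apply_apply] at h2
      exact h2.symm
    rw [e]
    exact h'
  exact (MeasurePreserving.id (volume : Measure (Torus ℓ))).prod h

/-- The `n`-phonon sector `L²(Λ_ℓ) ⊗ (⊗ⁿ_sym L²(ℝ³))`: the square-integrable functions
`Ψ⁽ⁿ⁾(x, y₁, …, yₙ)` that are symmetric in `y₁, …, yₙ`. -/
def sector (n : ℕ) : Submodule ℂ (L2 ℓ n) where
  carrier := {f | ∀ σ : Equiv.Perm (Fin n),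
    Lp.compMeasurePreserving (permute ℓ σ) (measurePreserving_permute ℓ σ) f = f}
  zero_mem' := fun σ => map_zero _
  add_mem' := fun {f g} hf hg σ => by rw [map_add, hf σ, hg σ]
  smul_mem' := fun c f hf σ => by
    have h := (Lp.compMeasurePreservingₗ (E := ℂ) (p := 2) ℂ (permute ℓ σ)
      (measurePreserving_permute ℓ σ)).map_smul c f
    exact h.trans (congrArg (c • ·) (hf σ))

/-- The Hilbert space `L²(Λ_ℓ) ⊗ 𝓕 = ⨁ₙ L²(Λ_ℓ) ⊗ (⊗ⁿ_sym L²(ℝ³))` (Hilbert sum). -/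
abbrev Space : Type := lp (fun n : ℕ => sector ℓ n) 2

variable {ℓ}

/-- The `n`-phonon component of a state. -/
def comp (Ψ : Space ℓ) (n : ℕ) : L2 ℓ n := (Ψ n : L2 ℓ n)

/-! ### The components of `-i∇_x - P_f` -/

/-- The motion `(x, y₁, …, yₙ) ↦ (x + t, y₁ - t, …, yₙ - t)`. -/
def shift {n : ℕ} (t : E3) (z : Config ℓ n) : Config ℓ n :=
  (fun j => z.1 j + ((t j : ℝ) : AddCircle ℓ), fun i => z.2 i - t)

/-- The classical derivative `(∂_{x_j} - ∑ᵢ ∂_{y_{i,j}}) η`. -/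
def relDeriv {n : ℕ} (j : Fin 3) (η : Config ℓ n → ℂ) (z : Config ℓ n) : ℂ :=
  deriv (fun s : ℝ => η (shift (s • EuclideanSpace.single j (1 : ℝ)) z)) 0

/-- Test functions on `Λ_ℓ × ℝ³ⁿ`: smooth, `ℓ`-periodic in `x`, compactly supported. -/
def IsTestFunction {n : ℕ} (η : Config ℓ n → ℂ) : Prop :=
  ContDiff ℝ ∞ (fun p : E3 × (Fin n → E3) =>
    η (fun j => ((p.1 j : ℝ) : AddCircle ℓ), p.2)) ∧
  HasCompactSupport η

/-- `g = (∂_{x_j} - ∑ᵢ ∂_{y_{i,j}}) f` in the weak sense. -/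
def IsWeakRelDeriv {n : ℕ} (j : Fin 3) (f g : L2 ℓ n) : Prop :=
  ∀ η : Config ℓ n → ℂ, IsTestFunction η →
    ∫ z, relDeriv j η z * f z = - ∫ z, η z * g z

open Classical in
/-- The weak derivative `(∂_{x_j} - ∑ᵢ ∂_{y_{i,j}}) f` (set to `0` if it does not exist
in `L²`). Since `P_f = ∑ᵢ -i∇_{y_i}` on `n` phonons, `-i` times it is the `j`-th component of
`(-i∇_x - P_f) f`. -/
def weakRelDeriv {n : ℕ} (j : Fin 3) (f : L2 ℓ n) : L2 ℓ n :=
  if h : ∃ g, IsWeakRelDeriv j f g then h.choose else 0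

/-- The `j`-th component of `(-i∇_x - P_f) f`. -/
def relMomentum {n : ℕ} (j : Fin 3) (f : L2 ℓ n) : L2 ℓ n :=
  (-Complex.I) • weakRelDeriv j f

/-! ### The annihilation operator -/

/-- The form factor `v(y) = |y|⁻²`. -/
def formFactor (y : E3) : ℝ := 1 / ‖y‖ ^ 2

/-- `(a(v) f)(x, y₁, …, yₙ) = √(n+1) ∫ v(y) f(x, y, y₁, …, yₙ) dy`. -/
def annihilate {n : ℕ} (f : L2 ℓ (n + 1)) (z : Config ℓ n) : ℂ :=
  (Real.sqrt (n + 1) : ℂ) *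
    ∫ y : E3, (formFactor y : ℂ) * f (z.1, (Fin.cons y z.2 : Fin (n + 1) → E3))

/-! ### The Hamiltonian `h_ℓ = (-i∇_x - P_f)² + N + √α φ(v)` -/

variable (ℓ)

/-- The form domain of `(-i∇_x - P_f)² + N`: all `Ψ` such that `(-i∇_x - P_f) Ψ` and
`N^{1/2} Ψ` are square integrable. -/
def formDomain : Set (Space ℓ) :=
  {Ψ | (∀ (n : ℕ) (j : Fin 3), ∃ g, IsWeakRelDeriv j (comp Ψ n) g) ∧
    Summable (fun n : ℕ => ∑ j : Fin 3, ‖relMomentum j (comp Ψ n)‖ ^ 2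
      + (n : ℝ) * ‖comp Ψ n‖ ^ 2)}

/-- `⟨(-i∇_x - P_f) Θ, (-i∇_x - P_f) Ψ⟩ + ⟨N^{1/2} Θ, N^{1/2} Ψ⟩`. -/
def freeForm (Θ Ψ : Space ℓ) : ℂ :=
  ∑' n : ℕ, (∑ j : Fin 3, inner ℂ (relMomentum j (comp Θ n)) (relMomentum j (comp Ψ n))
    + (n : ℂ) * inner ℂ (comp Θ n) (comp Ψ n))

/-- `⟨Θ, φ(v) Ψ⟩ = ⟨Θ, a(v) Ψ⟩ + ⟨a(v) Θ, Ψ⟩`. -/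
def interactionForm (Θ Ψ : Space ℓ) : ℂ :=
  ∑' n : ℕ, ((∫ z, conj (comp Θ n z) * annihilate (comp Ψ (n + 1)) z)
    + ∫ z, conj (annihilate (comp Θ (n + 1)) z) * comp Ψ n z)

/-- The sesquilinear form of `h_ℓ`. -/
def hamiltonianForm (α : ℝ) (Θ Ψ : Space ℓ) : ℂ :=
  freeForm ℓ Θ Ψ + (Real.sqrt α : ℂ) * interactionForm ℓ Θ Ψ

/-- The graph of `h_ℓ = (-i∇_x - P_f)² + N + √α φ(v)`, the operator associated with its
quadratic form on the form domain of the non-interacting operator. -/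
def hamiltonian (α : ℝ) : Set (Space ℓ × Space ℓ) :=
  formOperator (formDomain ℓ) (hamiltonianForm ℓ α)

end Polaron

end

/-!
Conjugation by the parity `(-1) ^ N` turns `√α φ(v)` into `-√α φ(v)`, which is nonpositive on
nonnegative functions, while the kinetic form is nonpositive on pairs of nonnegative functions
with disjoint supports. Hence the positive and negative parts of a real ground state are again
ground states. Let `Ψ` be a nonnegative ground state. If `Ψ⁽ᵏ⁾ = 0` for all `k ≤ n`, the
eigenvalue equation gives `a(v) Ψ⁽ⁿ⁺¹⁾ = 0` and thus `Ψ⁽ⁿ⁺¹⁾ = 0`, so `Ψ⁽⁰⁾ ≠ 0` unless `Ψ = 0`.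
As `k → ∞`, the truncations `min 1 (k Ψ⁽⁰⁾)` keep a bounded kinetic energy, so the indicator
function of `{Ψ⁽⁰⁾ ≠ 0}` is weakly differentiable, hence invariant under all translations of the
torus, and `Ψ⁽⁰⁾ > 0` almost everywhere. So no two nonzero nonnegative ground states are
orthogonal, and a ground state orthogonal to one of them has to vanish.
-/

noncomputable section

namespace Polaron

open Filter Topology
open scoped ENNReal NNReal

/-! ### One-parameter groups of isometries -/

section UnitaryGroups

variable {H : Type*} [NormedAddCommGroup H] [InnerProductSpace ℂ H]

/-- A strongly continuous one-parameter unitary group. Its generator is encoded by the relation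
`HasDerivAt (fun s => U s f) g 0`, so that `f` lies in its domain and is mapped to `g`. -/
structure IsUnitaryGroup (U : ℝ → H →ₗᵢ[ℂ] H) : Prop where
  zero_apply : ∀ f, U 0 f = f
  apply_apply : ∀ s t f, U s (U t f) = U (s + t) f
  continuous_apply : ∀ f, Continuous fun s => U s f

namespace IsUnitaryGroup

variable {U : ℝ → H →ₗᵢ[ℂ] H}

theorem inner_apply_left (hU : IsUnitaryGroup U) (s : ℝ) (f g : H) :
    inner ℂ (U s f) g = inner ℂ f (U (-s) g) := by
  rw [← (U (-s)).inner_map_map, hU.apply_apply, neg_add_cancel, hU.zero_apply]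

theorem hasDerivAt_apply (hU : IsUnitaryGroup U) {f g : H}
    (h : HasDerivAt (fun s => U s f) g 0) (r : ℝ) : HasDerivAt (fun s => U s f) (U r g) r := by
  have hcomp : HasDerivAt (fun s => U (s - r) f) g r :=
    HasDerivAt.comp_sub_const r r (by simpa using h)
  refine ((U r).toContinuousLinearMap.restrictScalars ℝ).hasFDerivAt.comp_hasDerivAt r hcomp
    |>.congr_of_eventuallyEq (Eventually.of_forall fun s => ?_)
  simp [hU.apply_apply]

theorem hasDerivAt_apply_apply (hU : IsUnitaryGroup U) {f g : H}
    (h : HasDerivAt (fun s => U s f) g 0) (r : ℝ) :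
    HasDerivAt (fun s => U s (U r f)) (U r g) 0 := by
  simp only [hU.apply_apply]
  exact HasDerivAt.comp_add_const 0 r (by simpa using hU.hasDerivAt_apply h r)

theorem norm_apply_sub_le (hU : IsUnitaryGroup U) {f g : H}
    (h : HasDerivAt (fun s => U s f) g 0) (s : ℝ) : ‖U s f - f‖ ≤ ‖g‖ * |s| := by
  have hbound := convex_univ.norm_image_sub_le_of_norm_hasDerivWithin_le (C := ‖g‖)
    (fun r _ => (hU.hasDerivAt_apply h r).hasDerivWithinAt)
    (fun r _ => ((U r).norm_map g).le) (Set.mem_univ 0) (Set.mem_univ s)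
  simpa [hU.zero_apply] using hbound

theorem inner_generator_left (hU : IsUnitaryGroup U) {f f' g g' : H}
    (hf : HasDerivAt (fun s => U s f) f' 0) (hg : HasDerivAt (fun s => U s g) g' 0) :
    inner ℂ f' g = -inner ℂ f g' := by
  have hderiv := hf.inner ℂ hg
  simp only [(U _).inner_map_map, hU.zero_apply] at hderiv
  exact eq_neg_of_add_eq_zero_right ((hasDerivAt_const 0 _).unique hderiv).symm

variable [CompleteSpace H]

theorem dense_generator_domain (hU : IsUnitaryGroup U) :
    Dense {f | ∃ g, HasDerivAt (fun s => U s f) g 0} := by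
  intro f
  let A : ℝ → H := fun t => ∫ r in (0 : ℝ)..t, U r f
  have hA : ∀ t, HasDerivAt A (U t f) t := fun t =>
    intervalIntegral.integral_hasDerivAt_right ((hU.continuous_apply f).intervalIntegrable _ _)
      (hU.continuous_apply f).aestronglyMeasurable.stronglyMeasurableAtFilter
      (hU.continuous_apply f).continuousAt
  have hshift : ∀ s t, U s (A t) = A (s + t) - A s := by
    intro s t
    calc U s (A t) = ∫ r in (0 : ℝ)..t, U s (U r f) :=
          ((U s).toContinuousLinearMap.intervalIntegral_comp_comm
            ((hU.continuous_apply f).intervalIntegrable _ _)).symm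
      _ = ∫ r in s..s + t, U r f := by
          simp only [hU.apply_apply]
          rw [intervalIntegral.integral_comp_add_left (fun r => U r f), add_zero]
      _ = A (s + t) - A s := (intervalIntegral.integral_interval_sub_left
          ((hU.continuous_apply f).intervalIntegrable _ _)
          ((hU.continuous_apply f).intervalIntegrable _ _)).symm
  have hmem : ∀ t, t⁻¹ • A t ∈ {f | ∃ g, HasDerivAt (fun s => U s f) g 0} := by
    intro t
    have hderiv : HasDerivAt (fun s => U s (A t)) (U t f - U 0 f) 0 := by
      simp only [hshift]
      exact (HasDerivAt.comp_add_const 0 t (by simpa using hA t)).sub (hA 0)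
    refine ⟨t⁻¹ • (U t f - U 0 f), (hderiv.const_smul t⁻¹).congr_of_eventuallyEq
      (Eventually.of_forall fun s => ?_)⟩
    exact ((U s).toLinearMap.restrictScalars ℝ).map_smul t⁻¹ (A t)
  have hlim : Tendsto (fun t => t⁻¹ • A t) (𝓝[≠] 0) (𝓝 f) := by
    simpa [A, hU.zero_apply] using (hA 0).tendsto_slope_zero
  exact mem_closure_of_tendsto hlim (Eventually.of_forall hmem)

/-- A weak generator is a strong one: tested against a core, `U s f - f` and `∫₀ˢ U r g dr` have
the same derivative, and the latter is strongly differentiable. -/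
theorem hasDerivAt_of_inner_eq_neg (hU : IsUnitaryGroup U) {f g : H} {S : Set H} (hS : Dense S)
    (h : ∀ u ∈ S, ∃ u', HasDerivAt (fun s => U s u) u' 0 ∧
      ∀ s, inner ℂ (U s u') f = -inner ℂ (U s u) g) :
    HasDerivAt (fun s => U s f) g 0 := by
  have hint : ∀ s, U s f - f = ∫ r in (0 : ℝ)..s, U r g := by
    intro s
    refine hS.eq_of_inner_right (𝕜 := ℂ) fun u hu => ?_
    obtain ⟨u', hu', hweak⟩ := h u hu
    have hderiv : ∀ r, HasDerivAt (fun r => inner ℂ u (U r f)) (inner ℂ u (U r g)) r := by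
      intro r
      have hneg : HasDerivAt (fun r => U (-r) u) (-U (-r) u') r := by
        simpa [Function.comp_def] using (hU.hasDerivAt_apply hu' (-r)).scomp r (hasDerivAt_neg r)
      have hinner := hneg.inner ℂ (hasDerivAt_const r f)
      simp only [inner_zero_right, zero_add, inner_neg_left, hweak, neg_neg] at hinner
      simp only [hU.inner_apply_left, neg_neg] at hinner
      exact hinner
    calc inner ℂ u (U s f - f) = inner ℂ u (U s f) - inner ℂ u (U 0 f) := by
          rw [inner_sub_right, hU.zero_apply]
      _ = ∫ r in (0 : ℝ)..s, inner ℂ u (U r g) :=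
          (intervalIntegral.integral_eq_sub_of_hasDerivAt (fun r _ => hderiv r)
            ((continuous_const.inner (hU.continuous_apply g)).intervalIntegrable _ _)).symm
      _ = inner ℂ u (∫ r in (0 : ℝ)..s, U r g) :=
          (innerSL ℂ u).intervalIntegral_comp_comm
            ((hU.continuous_apply g).intervalIntegrable _ _)
  have hderiv := intervalIntegral.integral_hasDerivAt_right (a := (0 : ℝ)) (b := 0)
    ((hU.continuous_apply g).intervalIntegrable _ _)
    (hU.continuous_apply g).aestronglyMeasurable.stronglyMeasurableAtFilter
    (hU.continuous_apply g).continuousAt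
  rw [hU.zero_apply] at hderiv
  exact (hderiv.add_const f).congr_of_eventuallyEq
    (Eventually.of_forall fun s => eq_add_of_sub_eq (hint s))

end IsUnitaryGroup

theorem exists_tendsto_inner_of_norm_le [CompleteSpace H] {ι : Type*} (F : Ultrafilter ι)
    {Q : ι → H} {C : ℝ} (hQ : ∀ᶠ i in (F : Filter ι), ‖Q i‖ ≤ C) :
    ∃ g, ∀ u, Tendsto (fun i => inner ℂ u (Q i)) F (𝓝 (inner ℂ u g)) := by
  let D : ι → WeakDual ℂ H := fun i => StrongDual.toWeakDual (InnerProductSpace.toDual ℂ H (Q i))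
  have hmem : ∀ᶠ i in (F : Filter ι),
      D i ∈ WeakDual.toStrongDual ⁻¹' Metric.closedBall (0 : StrongDual ℂ H) C := by
    filter_upwards [hQ] with i hi
    simpa [D] using hi
  obtain ⟨φ, -, hφ⟩ := (WeakDual.isCompact_closedBall (𝕜 := ℂ)
    (0 : StrongDual ℂ H) C).ultrafilter_le_nhds (F.map D) (le_principal_iff.mpr hmem)
  obtain ⟨g, hg⟩ := (InnerProductSpace.toDual ℂ H).surjective (WeakDual.toStrongDual φ)
  refine ⟨g, fun u => ?_⟩
  have hφu : φ u = inner ℂ g u := by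
    rw [← InnerProductSpace.toDual_apply_apply, hg, WeakDual.toStrongDual_apply]
  have hlim : Tendsto (fun i => inner ℂ (Q i) u) F (𝓝 (inner ℂ g u)) := by
    rw [← hφu]
    exact ((WeakDual.eval_continuous u).tendsto φ).comp hφ
  simpa only [Function.comp_def, inner_conj_symm] using
    (Complex.continuous_conj.tendsto _).comp hlim

theorem IsUnitaryGroup.exists_hasDerivAt_of_norm_apply_sub_le [CompleteSpace H]
    {U : ℝ → H →ₗᵢ[ℂ] H} (hU : IsUnitaryGroup U) {f : H} {C : ℝ}
    (h : ∀ s, ‖U s f - f‖ ≤ C * |s|) :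
    ∃ g, ‖g‖ ≤ C ∧ HasDerivAt (fun s => U s f) g 0 := by
  let Q : ℝ → H := fun s => s⁻¹ • (U s f - f)
  have hQ : ∀ᶠ s in 𝓝[≠] (0 : ℝ), ‖Q s‖ ≤ C := by
    filter_upwards [self_mem_nhdsWithin] with s hs
    rw [norm_smul, norm_inv, Real.norm_eq_abs, inv_mul_le_iff₀ (abs_pos.mpr hs), mul_comm]
    exact h s
  let F : Ultrafilter ℝ := Ultrafilter.of (𝓝[≠] (0 : ℝ))
  have hF : (F : Filter ℝ) ≤ 𝓝[≠] (0 : ℝ) := Ultrafilter.of_le _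
  obtain ⟨g, hg⟩ := exists_tendsto_inner_of_norm_le F (hF hQ)
  have hweak : ∀ u u', HasDerivAt (fun s => U s u) u' 0 → inner ℂ u' f = -inner ℂ u g := by
    intro u u' hu
    have hneg : HasDerivAt (fun s => U (-s) u) (-u') 0 := by
      have := HasDerivAt.scomp (𝕜 := ℝ) (0 : ℝ) (by simpa using hu) (hasDerivAt_neg (0 : ℝ))
      simpa [Function.comp_def] using this
    have hlim := (hneg.inner ℂ (hasDerivAt_const (0 : ℝ) f)).tendsto_slope_zero.mono_left hF
    have hslope : (fun s => inner ℂ u (Q s)) = fun s : ℝ => s⁻¹ •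
        (inner ℂ (U (-(0 + s)) u) f - inner ℂ (U (-0) u) f : ℂ) := by
      funext s
      simp only [Q, zero_add, hU.inner_apply_left, neg_neg, neg_zero, hU.zero_apply,
        inner_smul_right_eq_smul, inner_sub_right]
    rw [← hslope] at hlim
    have := tendsto_nhds_unique hlim (hg u)
    simpa [neg_eq_iff_eq_neg] using this
  have hderiv : HasDerivAt (fun s => U s f) g 0 :=
    hU.hasDerivAt_of_inner_eq_neg hU.dense_generator_domain fun u ⟨u', hu'⟩ =>
      ⟨u', hu', fun s => hweak _ _ (hU.hasDerivAt_apply_apply hu' s)⟩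
  refine ⟨g, le_of_tendsto ?_ hQ, hderiv⟩
  simpa [Q, hU.zero_apply] using hderiv.tendsto_slope_zero.norm

end UnitaryGroups

/-! ### Semibounded hermitian forms -/

section HermitianForms

variable {H : Type*} [NormedAddCommGroup H] [InnerProductSpace ℂ H]

/-- `q` is a hermitian sesquilinear form on `D`, antilinear in its first argument; its values off
`D` are arbitrary. -/
structure IsHermitianFormOn (D : Submodule ℂ H) (q : H → H → ℂ) : Prop where
  add_right : ∀ {Θ Ψ Ψ' : H}, Θ ∈ D → Ψ ∈ D → Ψ' ∈ D → q Θ (Ψ + Ψ') = q Θ Ψ + q Θ Ψ'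
  smul_right : ∀ {Θ Ψ : H} (c : ℂ), Θ ∈ D → Ψ ∈ D → q Θ (c • Ψ) = c * q Θ Ψ
  conj_symm : ∀ {Θ Ψ : H}, Θ ∈ D → Ψ ∈ D → conj (q Ψ Θ) = q Θ Ψ

namespace IsHermitianFormOn

variable {D : Submodule ℂ H} {q : H → H → ℂ}

theorem add_left (h : IsHermitianFormOn D q) {Θ Θ' Ψ : H} (hΘ : Θ ∈ D) (hΘ' : Θ' ∈ D)
    (hΨ : Ψ ∈ D) : q (Θ + Θ') Ψ = q Θ Ψ + q Θ' Ψ := by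
  rw [← h.conj_symm (D.add_mem hΘ hΘ') hΨ, h.add_right hΨ hΘ hΘ', map_add, h.conj_symm hΘ hΨ,
    h.conj_symm hΘ' hΨ]

theorem smul_left (h : IsHermitianFormOn D q) (c : ℂ) {Θ Ψ : H} (hΘ : Θ ∈ D) (hΨ : Ψ ∈ D) :
    q (c • Θ) Ψ = conj c * q Θ Ψ := by
  rw [← h.conj_symm (D.smul_mem c hΘ) hΨ, h.smul_right c hΨ hΘ, map_mul, h.conj_symm hΘ hΨ]

theorem sub_inner (h : IsHermitianFormOn D q) (E : ℝ) :
    IsHermitianFormOn D (fun Θ Ψ => q Θ Ψ - E * inner ℂ Θ Ψ) where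
  add_right hΘ hΨ hΨ' := by rw [h.add_right hΘ hΨ hΨ', inner_add_right]; ring
  smul_right c hΘ hΨ := by rw [h.smul_right c hΘ hΨ, inner_smul_right]; ring
  conj_symm hΘ hΨ := by
    rw [map_sub, map_mul, Complex.conj_ofReal, inner_conj_symm, h.conj_symm hΘ hΨ]

theorem norm_sq_le (h : IsHermitianFormOn D q) (hpos : ∀ Ψ ∈ D, 0 ≤ (q Ψ Ψ).re) {Θ Ψ : H}
    (hΘ : Θ ∈ D) (hΨ : Ψ ∈ D) : ‖q Θ Ψ‖ ^ 2 ≤ (q Θ Θ).re * (q Ψ Ψ).re := by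
  let core : PreInnerProductSpace.Core ℂ D :=
    { inner := fun Θ Ψ => q Θ Ψ
      conj_inner_symm := fun Θ Ψ => h.conj_symm Θ.2 Ψ.2
      re_inner_nonneg := fun Ψ => hpos Ψ Ψ.2
      add_left := fun Θ Θ' Ψ => h.add_left Θ.2 Θ'.2 Ψ.2
      smul_left := fun Θ Ψ c => h.smul_left c Θ.2 Ψ.2 }
  have hsymm : ‖q Ψ Θ‖ = ‖q Θ Ψ‖ := by rw [← h.conj_symm hΘ hΨ, RCLike.norm_conj]
  have hCS : ‖q Θ Ψ‖ * ‖q Ψ Θ‖ ≤ (q Θ Θ).re * (q Ψ Ψ).re :=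
    InnerProductSpace.Core.inner_mul_inner_self_le (c := core) ⟨Θ, hΘ⟩ ⟨Ψ, hΨ⟩
  rwa [hsymm, ← sq] at hCS

theorem eq_zero_of_re_nonpos (h : IsHermitianFormOn D q) (hpos : ∀ Ψ ∈ D, 0 ≤ (q Ψ Ψ).re)
    {Θ Ψ : H} (hΘ : Θ ∈ D) (hΨ : Ψ ∈ D) (hnonpos : (q Ψ Ψ).re ≤ 0) : q Θ Ψ = 0 := by
  have hsq : ‖q Θ Ψ‖ ^ 2 ≤ 0 :=
    (h.norm_sq_le hpos hΘ hΨ).trans (mul_nonpos_of_nonneg_of_nonpos (hpos _ hΘ) hnonpos)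
  simpa using le_antisymm hsq (sq_nonneg _)

theorem re_sub_self (h : IsHermitianFormOn D q) {Θ Ψ : H} (hΘ : Θ ∈ D) (hΨ : Ψ ∈ D) :
    (q (Θ - Ψ) (Θ - Ψ)).re = (q Θ Θ).re - 2 * (q Θ Ψ).re + (q Ψ Ψ).re := by
  have hΨ' := D.smul_mem (-1) hΨ
  rw [sub_eq_add_neg, ← neg_one_smul ℂ Ψ, h.add_left hΘ hΨ' (D.add_mem hΘ hΨ'),
    h.add_right hΘ hΘ hΨ', h.add_right hΨ' hΘ hΨ', h.smul_left _ hΨ hΘ, h.smul_left _ hΨ hΨ',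
    h.smul_right _ hΘ hΨ, h.smul_right _ hΨ hΨ, ← h.conj_symm hΨ hΘ]
  simp only [map_neg, map_one, Complex.add_re, neg_mul, one_mul, neg_neg, Complex.neg_re,
    Complex.conj_re]
  ring

theorem re_self_nonpos_of_re_sub_self_nonpos (h : IsHermitianFormOn D q)
    (hpos : ∀ Ψ ∈ D, 0 ≤ (q Ψ Ψ).re) {Θ Ψ : H} (hΘ : Θ ∈ D) (hΨ : Ψ ∈ D)
    (hcross : (q Θ Ψ).re ≤ 0) (hsub : (q (Θ - Ψ) (Θ - Ψ)).re ≤ 0) : (q Θ Θ).re ≤ 0 := by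
  rw [h.re_sub_self hΘ hΨ] at hsub
  linarith [hpos Ψ hΨ]

theorem re_sub_inner_self (q : H → H → ℂ) (E : ℝ) (Ψ : H) :
    (q Ψ Ψ - E * inner ℂ Ψ Ψ).re = (q Ψ Ψ).re - E * ‖Ψ‖ ^ 2 := by
  rw [inner_self_eq_norm_sq_to_K, Complex.sub_re, Complex.re_ofReal_mul]
  norm_cast

/-- With `p = q - m` and `R` the resolvent at `m`, one has `p Θ (R Φ) = ⟨Θ, Φ⟩`; Cauchy–Schwarz for
`p` gives `‖Φ‖⁴ = ‖p Φ (R Φ)‖² ≤ p Φ Φ * ⟨R Φ, Φ⟩ ≤ p Φ Φ * ‖R‖ ‖Φ‖²`. -/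
theorem exists_add_mul_norm_sq_le_of_mem_opResolventSet (h : IsHermitianFormOn D q) {m : ℝ}
    (hm : ∀ Φ ∈ D, m * ‖Φ‖ ^ 2 ≤ (q Φ Φ).re)
    (hres : (m : ℂ) ∈ opResolventSet (formOperator (D : Set H) q)) :
    ∃ δ > 0, ∀ Φ ∈ D, (m + δ) * ‖Φ‖ ^ 2 ≤ (q Φ Φ).re := by
  obtain ⟨R, hR⟩ := hres
  have hpos : ∀ Φ ∈ D, 0 ≤ (q Φ Φ - m * inner ℂ Φ Φ).re := fun Φ hΦ => by
    rw [re_sub_inner_self]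
    exact sub_nonneg.mpr (hm Φ hΦ)
  refine ⟨(‖R‖ + 1)⁻¹, by positivity, fun Φ hΦ => ?_⟩
  obtain ⟨hRD : R Φ ∈ D, hRq⟩ := (hR Φ (R Φ)).mpr rfl
  have hRΦ : ∀ Θ ∈ D, q Θ (R Φ) - m * inner ℂ Θ (R Φ) = inner ℂ Θ Φ := fun Θ hΘ => by
    simp [hRq Θ hΘ]
  have hCS := (h.sub_inner m).norm_sq_le hpos hΦ hRD
  rw [hRΦ Φ hΦ, hRΦ (R Φ) hRD, re_sub_inner_self, norm_inner_symm,
    ← inner_self_re_eq_norm, inner_self_eq_norm_sq] at hCS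
  have hinner : (inner ℂ (R Φ) Φ).re ≤ (‖R‖ + 1) * ‖Φ‖ ^ 2 :=
    calc (inner ℂ (R Φ) Φ).re ≤ ‖R Φ‖ * ‖Φ‖ := re_inner_le_norm (𝕜 := ℂ) (R Φ) Φ
      _ ≤ (‖R‖ * ‖Φ‖) * ‖Φ‖ := by gcongr; exact R.le_opNorm Φ
      _ ≤ (‖R‖ + 1) * ‖Φ‖ ^ 2 := by nlinarith [sq_nonneg ‖Φ‖]
  have hp : 0 ≤ (q Φ Φ).re - m * ‖Φ‖ ^ 2 := sub_nonneg.mpr (hm Φ hΦ)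
  rcases eq_or_ne Φ 0 with rfl | hΦ0
  · simpa using hp
  have hΦ2 : 0 < ‖Φ‖ ^ 2 := by positivity
  have hcoercive : ‖Φ‖ ^ 2 ≤ (‖R‖ + 1) * ((q Φ Φ).re - m * ‖Φ‖ ^ 2) := by
    refine le_of_mul_le_mul_right ?_ hΦ2
    calc ‖Φ‖ ^ 2 * ‖Φ‖ ^ 2 ≤ ((q Φ Φ).re - m * ‖Φ‖ ^ 2) * (inner ℂ (R Φ) Φ).re := by
          rwa [← sq]
      _ ≤ ((q Φ Φ).re - m * ‖Φ‖ ^ 2) * ((‖R‖ + 1) * ‖Φ‖ ^ 2) := by gcongr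
      _ = _ := by ring
  rw [← inv_mul_le_iff₀ (by positivity)] at hcoercive
  linarith

/-- The best lower bound `m` of `q` is in the spectrum, since at a resolvent point it could be
improved. -/
theorem mul_norm_sq_le_of_mem_lowerBounds_opSpectrum (h : IsHermitianFormOn D q) {C E : ℝ}
    (hC : ∀ Ψ ∈ D, -C * ‖Ψ‖ ^ 2 ≤ (q Ψ Ψ).re)
    (hE : E ∈ lowerBounds {t : ℝ | (t : ℂ) ∈ opSpectrum (formOperator (D : Set H) q)})
    {Ψ : H} (hΨ : Ψ ∈ D) : E * ‖Ψ‖ ^ 2 ≤ (q Ψ Ψ).re := by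
  rcases eq_or_ne Ψ 0 with rfl | hΨ0
  · simpa using hC 0 hΨ
  have hΨ2 : 0 < ‖Ψ‖ ^ 2 := by positivity
  by_contra! hlt
  let T : Set ℝ := {m | ∀ Φ ∈ D, m * ‖Φ‖ ^ 2 ≤ (q Φ Φ).re}
  have hTΨ : ∀ m ∈ T, m ≤ (q Ψ Ψ).re / ‖Ψ‖ ^ 2 := fun m hm => (le_div_iff₀ hΨ2).mpr (hm Ψ hΨ)
  have hbdd : BddAbove T := ⟨_, hTΨ⟩
  have hsup : sSup T ∈ T := by
    have hclosed : IsClosed T := by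
      simp only [T, Set.ofPred_forall]
      exact isClosed_iInter fun Φ => isClosed_iInter fun _ =>
        isClosed_le (by fun_prop) continuous_const
    exact hclosed.csSup_mem ⟨-C, hC⟩ hbdd
  have hsupE : sSup T < E := (hTΨ _ hsup).trans_lt ((div_lt_iff₀ hΨ2).mpr hlt)
  have hres : ((sSup T : ℝ) : ℂ) ∈ opResolventSet (formOperator (D : Set H) q) := by
    by_contra hspec
    exact (hE hspec).not_gt hsupE
  obtain ⟨δ, hδ, hδT⟩ := h.exists_add_mul_norm_sq_le_of_mem_opResolventSet hsup hres
  linarith [le_csSup hbdd hδT]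

end IsHermitianFormOn

end HermitianForms

/-! ### Translations along the relative motion -/

section Translations

variable {ℓ : ℝ} {n : ℕ}

theorem continuous_coe_torus : Continuous (fun (t : E3) (j : Fin 3) => ((t j : ℝ) : AddCircle ℓ)) :=
  continuous_pi fun j => (AddCircle.continuous_mk' ℓ).comp (by fun_prop)

theorem continuous_shift_uncurry :
    Continuous (fun p : E3 × Config ℓ n => shift p.1 p.2) := by
  refine Continuous.prodMk ?_ ?_
  · have h := (continuous_coe_torus (ℓ := ℓ)).comp (continuous_fst (X := E3) (Y := Config ℓ n))
    exact (continuous_fst.comp continuous_snd).add h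
  · exact continuous_pi fun i => ((continuous_apply i).comp
      (continuous_snd.comp continuous_snd)).sub continuous_fst

theorem continuous_shift (t : E3) : Continuous (shift t : Config ℓ n → Config ℓ n) :=
  continuous_shift_uncurry.comp (Continuous.prodMk_right t)

theorem shift_shift (s t : E3) (z : Config ℓ n) : shift s (shift t z) = shift (s + t) z := by
  refine Prod.ext (funext fun j => ?_) (funext fun i => ?_)
  · simp only [shift, PiLp.add_apply]
    rw [AddCircle.coe_add, add_comm ((s j : ℝ) : AddCircle ℓ), add_assoc]
  · simp only [shift]
    abel

theorem shift_zero (z : Config ℓ n) : shift 0 z = z := by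
  refine Prod.ext (funext fun j => ?_) (funext fun i => ?_) <;> simp [shift]

theorem norm_snd_le_norm_snd_shift_add (t : E3) (z : Config ℓ n) :
    ‖z.2‖ ≤ ‖(shift t z).2‖ + ‖t‖ :=
  calc ‖z.2‖ = ‖(shift t z).2 + fun _ => t‖ := by congr; funext i; simp [shift]
    _ ≤ ‖(shift t z).2‖ + ‖fun _ : Fin n => t‖ := norm_add_le _ _
    _ ≤ ‖(shift t z).2‖ + ‖t‖ := by gcongr; exact pi_norm_const_le t

variable [Fact (0 < ℓ)]

instance : IsLocallyFiniteMeasure (volume : Measure (Config ℓ n)) :=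
  inferInstanceAs (IsLocallyFiniteMeasure
    ((volume : Measure (Torus ℓ)).prod (volume : Measure (Fin n → E3))))

instance : (volume : Measure (Config ℓ n)).Regular :=
  Measure.Regular.of_sigmaCompactSpace_of_isLocallyFiniteMeasure _

theorem measurePreserving_shift (t : E3) :
    MeasurePreserving (shift t : Config ℓ n → Config ℓ n) volume volume := by
  have htorus : MeasurePreserving (fun x : Torus ℓ => fun j => x j + ((t j : ℝ) : AddCircle ℓ))
      volume volume :=
    measurePreserving_add_right volume (fun j => ((t j : ℝ) : AddCircle ℓ))
  have hphonons : MeasurePreserving (fun (y : Fin n → E3) i => y i - t) volume volume :=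
    volume_preserving_pi fun _ => measurePreserving_sub_right volume t
  exact htorus.prod hphonons

/-- The translation `f ↦ f ∘ shift t` as an isometry. -/
def translate (t : E3) : L2 ℓ n →ₗᵢ[ℂ] L2 ℓ n :=
  Lp.compMeasurePreservingₗᵢ ℂ (shift t) (measurePreserving_shift t)

theorem coeFn_translate (t : E3) (f : L2 ℓ n) : translate t f =ᵐ[volume] f ∘ shift t :=
  Lp.coeFn_compMeasurePreserving f (measurePreserving_shift t)

theorem translate_translate (s t : E3) (f : L2 ℓ n) :
    translate s (translate t f) = translate (s + t) f := by
  apply Lp.ext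
  filter_upwards [coeFn_translate s (translate t f),
    (measurePreserving_shift (ℓ := ℓ) (n := n) s).quasiMeasurePreserving.ae_eq
      (coeFn_translate t f), coeFn_translate (s + t) f] with z hs ht hst
  rw [hs, hst, ht]
  simp only [Function.comp_apply, shift_shift, add_comm]

theorem translate_zero (f : L2 ℓ n) : translate 0 f = f := by
  apply Lp.ext
  filter_upwards [coeFn_translate 0 f] with z hz
  rw [hz, Function.comp_apply, shift_zero]

theorem continuous_translate (f : L2 ℓ n) : Continuous (fun t : E3 => translate t f) := by
  let g : E3 → C(Config ℓ n, Config ℓ n) := fun t => ⟨shift t, continuous_shift t⟩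
  have hg : Continuous g :=
    ContinuousMap.continuous_of_continuous_uncurry _ continuous_shift_uncurry
  exact Continuous.compMeasurePreservingLp (f := fun _ : E3 => f) continuous_const hg
    (fun t => measurePreserving_shift t) (by simp)

/-- The one-parameter group generated by `∂_{x_j} - ∑ᵢ ∂_{y_{i,j}}`. -/
def flow (j : Fin 3) (s : ℝ) : L2 ℓ n →ₗᵢ[ℂ] L2 ℓ n :=
  translate (s • EuclideanSpace.single j (1 : ℝ))

theorem coeFn_flow (j : Fin 3) (s : ℝ) (f : L2 ℓ n) :
    flow j s f =ᵐ[volume] fun z => f (shift (s • EuclideanSpace.single j (1 : ℝ)) z) :=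
  coeFn_translate _ f

theorem isUnitaryGroup_flow (j : Fin 3) : IsUnitaryGroup (flow j : ℝ → L2 ℓ n →ₗᵢ[ℂ] L2 ℓ n) where
  zero_apply f := by rw [flow, zero_smul, translate_zero]
  apply_apply s t f := by rw [flow, flow, flow, translate_translate, add_smul]
  continuous_apply f := (continuous_translate f).comp (by fun_prop)

end Translations

/-! ### Test functions -/

section TestFunctions

variable {ℓ : ℝ} {n : ℕ}

/-- The covering map `ℝ³ × ℝ³ⁿ → Λ_ℓ × ℝ³ⁿ`. -/
def cover (ℓ : ℝ) (n : ℕ) (p : E3 × (Fin n → E3)) : Config ℓ n :=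
  (fun j => ((p.1 j : ℝ) : AddCircle ℓ), p.2)

theorem isOpenQuotientMap_cover : IsOpenQuotientMap (cover ℓ n) := by
  have hcircles : IsOpenQuotientMap (Pi.map (fun (_ : Fin 3) (s : ℝ) => (s : AddCircle ℓ))) :=
    IsOpenQuotientMap.piMap fun _ => QuotientAddGroup.isOpenQuotientMap_mk
  have htorus := hcircles.comp (EuclideanSpace.equiv (Fin 3) ℝ).toHomeomorph.isOpenQuotientMap
  exact htorus.prodMap (IsOpenQuotientMap.id (X := Fin n → E3))

/-- The direction of the relative motion in the covering space. -/
def coverDir (n : ℕ) (t : E3) : E3 × (Fin n → E3) := (t, fun _ => -t)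

theorem shift_cover (t : E3) (p : E3 × (Fin n → E3)) :
    shift t (cover ℓ n p) = cover ℓ n (p + coverDir n t) := by
  refine Prod.ext (funext fun j => ?_) (funext fun i => ?_)
  · simp [shift, cover, coverDir]
  · simp [shift, cover, coverDir, sub_eq_add_neg]

theorem shift_smul_cover (s : ℝ) (t : E3) (p : E3 × (Fin n → E3)) :
    shift (s • t) (cover ℓ n p) = cover ℓ n (p + s • coverDir n t) := by
  rw [shift_cover]
  congr 2
  exact Prod.ext rfl (funext fun _ => (smul_neg s t).symm)

theorem exists_norm_snd_le_of_hasCompactSupport {η : Config ℓ n → ℂ} (h : HasCompactSupport η) :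
    ∃ R, 0 ≤ R ∧ ∀ z, R < ‖z.2‖ → η z = 0 := by
  obtain ⟨R, hR⟩ := (h.isCompact.image continuous_snd).isBounded.exists_norm_le
  refine ⟨max R 0, le_max_right _ _, fun z hz => ?_⟩
  by_contra hne
  have := hR z.2 ⟨z, subset_tsupport _ hne, rfl⟩
  exact absurd (this.trans (le_max_left _ _)) (not_le.mpr hz)

theorem IsTestFunction.continuous {η : Config ℓ n → ℂ} (h : IsTestFunction η) : Continuous η :=
  isOpenQuotientMap_cover.continuous_comp_iff.mp h.1.continuous

theorem IsTestFunction.conj {η : Config ℓ n → ℂ} (h : IsTestFunction η) :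
    IsTestFunction (fun z => conj (η z)) :=
  ⟨Complex.conjCLE.contDiff.comp h.1, h.2.comp_left (map_zero _)⟩

theorem IsTestFunction.hasDerivAt_cover {η : Config ℓ n → ℂ} (h : IsTestFunction η) (j : Fin 3)
    (p : E3 × (Fin n → E3)) :
    HasDerivAt (fun s : ℝ => η (shift (s • EuclideanSpace.single j (1 : ℝ)) (cover ℓ n p)))
      (fderiv ℝ (fun p => η (cover ℓ n p)) p (coverDir n (EuclideanSpace.single j (1 : ℝ)))) 0 := by
  simp only [shift_smul_cover]
  have hline := ((hasDerivAt_id (0 : ℝ)).smul_const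
    (coverDir n (EuclideanSpace.single j (1 : ℝ)))).const_add p
  rw [one_smul] at hline
  refine HasFDerivAt.comp_hasDerivAt (0 : ℝ) (l := fun p => η (cover ℓ n p)) ?_ hline
  rw [zero_smul, add_zero]
  exact ((h.1.differentiable (by simp)) p).hasFDerivAt

theorem IsTestFunction.relDeriv_cover {η : Config ℓ n → ℂ} (h : IsTestFunction η) (j : Fin 3)
    (p : E3 × (Fin n → E3)) : Polaron.relDeriv j η (cover ℓ n p) =
      fderiv ℝ (fun p => η (cover ℓ n p)) p (coverDir n (EuclideanSpace.single j (1 : ℝ))) :=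
  (h.hasDerivAt_cover j p).deriv

theorem IsTestFunction.hasDerivAt_shift {η : Config ℓ n → ℂ} (h : IsTestFunction η) (j : Fin 3)
    (z : Config ℓ n) (r : ℝ) :
    HasDerivAt (fun s : ℝ => η (shift (s • EuclideanSpace.single j (1 : ℝ)) z))
      (Polaron.relDeriv j η (shift (r • EuclideanSpace.single j (1 : ℝ)) z)) r := by
  obtain ⟨p, hp⟩ := isOpenQuotientMap_cover.surjective
    (shift (r • EuclideanSpace.single j (1 : ℝ)) z)
  have hderiv := h.hasDerivAt_cover j p
  rw [← h.relDeriv_cover, hp, ← sub_self r] at hderiv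
  simpa [shift_shift, ← add_smul] using hderiv.comp_sub_const r r

theorem IsTestFunction.relDeriv {η : Config ℓ n → ℂ} (h : IsTestFunction η) (j : Fin 3) :
    IsTestFunction (relDeriv j η) := by
  refine ⟨?_, HasCompactSupport.intro h.2 fun z hz => ?_⟩
  · exact (funext fun p => h.relDeriv_cover j p).symm ▸
      (h.1.fderiv_right (m := ∞) (by simp)).clm_apply contDiff_const
  · have hη : η =ᶠ[𝓝 z] 0 := notMem_tsupport_iff_eventuallyEq.mp hz
    have hshift : Tendsto (fun s : ℝ => shift (s • EuclideanSpace.single j (1 : ℝ)) z) (𝓝 0)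
        (𝓝 z) := by
      have hcont : Continuous (fun s : ℝ => shift (s • EuclideanSpace.single j (1 : ℝ)) z) :=
        continuous_shift_uncurry.comp (Continuous.prodMk (by fun_prop) continuous_const)
      simpa [shift_zero] using hcont.tendsto 0
    exact (hη.comp_tendsto hshift).deriv_eq.trans (deriv_const 0 0)

theorem relDeriv_comp_shift (j : Fin 3) (η : Config ℓ n → ℂ) (t : E3) (z : Config ℓ n) :
    relDeriv j (fun w => η (shift t w)) z = relDeriv j η (shift t z) := by
  simp only [relDeriv, shift_shift, add_comm]

theorem relDeriv_conj (j : Fin 3) (η : Config ℓ n → ℂ) (z : Config ℓ n) :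
    relDeriv j (fun w => conj (η w)) z = conj (relDeriv j η z) :=
  deriv.star

variable [Fact (0 < ℓ)]

theorem hasCompactSupport_of_norm_snd_le {η : Config ℓ n → ℂ} (R : ℝ)
    (h : ∀ z, R < ‖z.2‖ → η z = 0) : HasCompactSupport η := by
  refine HasCompactSupport.intro
    (isCompact_univ.prod (isCompact_closedBall (0 : Fin n → E3) R)) fun z hz => h z ?_
  by_contra hR
  exact hz ⟨Set.mem_univ _, by simpa using not_lt.mp hR⟩

theorem IsTestFunction.memLp {η : Config ℓ n → ℂ} (h : IsTestFunction η) :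
    MemLp η 2 (volume : Measure (Config ℓ n)) :=
  h.continuous.memLp_of_hasCompactSupport h.2

theorem IsTestFunction.comp_shift {η : Config ℓ n → ℂ} (h : IsTestFunction η) (t : E3) :
    IsTestFunction (fun z => η (shift t z)) := by
  refine ⟨?_, ?_⟩
  · exact (funext fun p => congrArg η (shift_cover (ℓ := ℓ) t p)).symm ▸
      h.1.comp (contDiff_id.add contDiff_const)
  · obtain ⟨R, -, hR⟩ := exists_norm_snd_le_of_hasCompactSupport h.2
    exact hasCompactSupport_of_norm_snd_le (R + ‖t‖) fun z hz =>
      hR _ (by linarith [norm_snd_le_norm_snd_shift_add t z])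

end TestFunctions

/-! ### Density of test functions -/

section Density

variable {ℓ : ℝ} {n : ℕ}

instance : (volume : Measure (E3 × (Fin n → E3))).IsAddHaarMeasure :=
  Measure.prod.instIsAddHaarMeasure (volume : Measure E3) (volume : Measure (Fin n → E3))

instance : (volume : Measure (E3 × (Fin n → E3))).Regular :=
  Measure.Regular.of_sigmaCompactSpace_of_isLocallyFiniteMeasure _

theorem uniformContinuous_cover : UniformContinuous (cover ℓ n) := by
  refine UniformContinuous.prodMk (uniformContinuous_pi.mpr fun j => ?_) uniformContinuous_snd
  let φ : (E3 × (Fin n → E3)) →+ AddCircle ℓ :=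
    { toFun := fun p => ((p.1 j : ℝ) : AddCircle ℓ)
      map_zero' := by simp
      map_add' := fun p q => by simp }
  have hφ : Continuous φ := (AddCircle.continuous_mk' ℓ).comp (by fun_prop)
  exact uniformContinuous_addMonoidHom_of_continuous hφ

/-- The convolution of a function on `Λ_ℓ × ℝ³ⁿ` with a normalized bump function on the covering
space. -/
def mollify (φ : ContDiffBump (0 : E3 × (Fin n → E3))) (g : Config ℓ n → ℂ) (z : Config ℓ n) : ℂ :=
  ∫ t : E3 × (Fin n → E3),
    φ.normed volume t • g (fun j => z.1 j - ((t.1 j : ℝ) : AddCircle ℓ), z.2 - t.2)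

theorem mollify_cover (φ : ContDiffBump (0 : E3 × (Fin n → E3))) (g : Config ℓ n → ℂ)
    (p : E3 × (Fin n → E3)) :
    mollify φ g (cover ℓ n p) = convolution (φ.normed volume) (fun p => g (cover ℓ n p))
      (ContinuousLinearMap.lsmul ℝ ℝ) volume p := by
  simp [convolution, mollify, cover]

theorem mollify_eq_zero (φ : ContDiffBump (0 : E3 × (Fin n → E3))) {g : Config ℓ n → ℂ} {R : ℝ}
    (hR : ∀ z, R < ‖z.2‖ → g z = 0) (z : Config ℓ n) (hz : R + φ.rOut < ‖z.2‖) :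
    mollify φ g z = 0 := by
  refine integral_eq_zero_of_ae (Eventually.of_forall fun t => ?_)
  by_cases ht : ‖t‖ < φ.rOut
  · have hg : g (fun j => z.1 j - ((t.1 j : ℝ) : AddCircle ℓ), z.2 - t.2) = 0 :=
      hR _ (by dsimp only; linarith [norm_sub_norm_le z.2 t.2, norm_snd_le t])
    simp [hg]
  · have hφ : φ.normed volume t = 0 := by
      rw [← Function.notMem_support, φ.support_normed_eq]
      simpa using ht
    simp [hφ]

variable [Fact (0 < ℓ)]

theorem isTestFunction_mollify (φ : ContDiffBump (0 : E3 × (Fin n → E3))) {g : Config ℓ n → ℂ}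
    (hg : Continuous g) {R : ℝ} (hR : ∀ z, R < ‖z.2‖ → g z = 0) :
    IsTestFunction (mollify φ g) := by
  refine ⟨?_, hasCompactSupport_of_norm_snd_le _ (mollify_eq_zero φ hR)⟩
  exact (funext (mollify_cover φ g)).symm ▸ φ.hasCompactSupport_normed.contDiff_convolution_left _
    φ.contDiff_normed (hg.comp isOpenQuotientMap_cover.continuous).locallyIntegrable

theorem exists_isTestFunction_dist_le {g : Config ℓ n → ℂ} (hg : Continuous g) {R : ℝ}
    (hR : ∀ z, R < ‖z.2‖ → g z = 0) {δ : ℝ} (hδ : 0 < δ) :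
    ∃ η, IsTestFunction η ∧ (∀ z, dist (η z) (g z) ≤ δ) ∧ ∀ z, R + 1 < ‖z.2‖ → η z = 0 := by
  have hcover : Continuous (fun p => g (cover ℓ n p)) :=
    hg.comp isOpenQuotientMap_cover.continuous
  have hunif : UniformContinuous (fun p => g (cover ℓ n p)) :=
    ((hasCompactSupport_of_norm_snd_le R hR).uniformContinuous_of_continuous hg).comp
      uniformContinuous_cover
  obtain ⟨ρ, hρ, hgρ⟩ := Metric.uniformContinuous_iff.mp hunif δ hδ
  let φ : ContDiffBump (0 : E3 × (Fin n → E3)) :=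
    ⟨min ρ 1 / 2, min ρ 1, by positivity, half_lt_self (by positivity)⟩
  refine ⟨mollify φ g, isTestFunction_mollify φ hg hR, fun z => ?_, fun z hz =>
    mollify_eq_zero φ hR z (by linarith [show φ.rOut ≤ 1 from min_le_right ρ 1])⟩
  obtain ⟨p, rfl⟩ := isOpenQuotientMap_cover.surjective z
  rw [mollify_cover]
  exact ContDiffBump.dist_normed_convolution_le hcover.aestronglyMeasurable fun x hx =>
    (hgρ (hx.trans_le (min_le_left _ _))).le

theorem exists_norm_toLp_le (R : ℝ) : ∃ M > 0, ∀ (h : Config ℓ n → ℂ) (hL : MemLp h 2 volume)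
    (C : ℝ), (∀ z, R < ‖z.2‖ → h z = 0) → (∀ z, ‖h z‖ ≤ C) → ‖hL.toLp h‖ ≤ C * M := by
  let K : Set (Config ℓ n) := Set.univ ×ˢ Metric.closedBall (0 : Fin n → E3) R
  have hK : IsCompact K := isCompact_univ.prod (isCompact_closedBall _ _)
  have hKtop : volume K ^ (1 / (2 : ℝ≥0∞).toReal) ≠ ⊤ :=
    ENNReal.rpow_ne_top_of_nonneg (by simp) hK.measure_ne_top
  refine ⟨(volume K ^ (1 / (2 : ℝ≥0∞).toReal)).toReal + 1, by positivity,
    fun h hL C hR hC => ?_⟩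
  have hC0 : 0 ≤ C := (norm_nonneg _).trans (hC (cover ℓ n 0))
  have hsupp : Function.support h ⊆ K := fun z hz =>
    ⟨Set.mem_univ _, by simpa using not_lt.mp fun hzR => hz (hR z hzR)⟩
  have hnorm : eLpNorm h 2 volume ≤
      ENNReal.ofReal (C * (volume K ^ (1 / (2 : ℝ≥0∞).toReal)).toReal) := by
    rw [ENNReal.ofReal_mul hC0, ENNReal.ofReal_toReal hKtop]
    simpa using eLpNorm_sub_le_of_dist_bdd volume (p := 2) (f := h) (g := 0) (by simp)
      hK.measurableSet hC0 (by simpa using hC) hsupp (by simp)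
  rw [Lp.norm_toLp]
  refine (ENNReal.toReal_le_of_le_ofReal (by positivity) hnorm).trans ?_
  gcongr
  exact le_add_of_nonneg_right zero_le_one

theorem dense_setOf_toLp_isTestFunction :
    Dense {u : L2 ℓ n | ∃ (η : Config ℓ n → ℂ) (hη : IsTestFunction η), hη.memLp.toLp η = u} := by
  refine Metric.dense_iff.mpr fun f ε hε => ?_
  obtain ⟨g, hgs, hfg, hgc, hgL⟩ := (Lp.memLp f).exists_hasCompactSupport_eLpNorm_sub_le
    (by simp) (ε := ENNReal.ofReal (ε / 3)) (by simpa using hε)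
  obtain ⟨R, -, hR⟩ := exists_norm_snd_le_of_hasCompactSupport hgs
  obtain ⟨M, hM, hbound⟩ := exists_norm_toLp_le (ℓ := ℓ) (n := n) (R + 1)
  obtain ⟨η, hη, hηg, hηR⟩ := exists_isTestFunction_dist_le hgc hR (δ := ε / 3 / M) (by positivity)
  refine ⟨hη.memLp.toLp η, ?_, η, hη, rfl⟩
  have hgf : ‖hgL.toLp g - f‖ ≤ ε / 3 := by
    nth_rw 1 [norm_sub_rev, ← Lp.toLp_coeFn f (Lp.memLp f)]
    rw [← MemLp.toLp_sub, Lp.norm_toLp]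
    exact ENNReal.toReal_le_of_le_ofReal (by positivity) hfg
  have hηg' : ‖hη.memLp.toLp η - hgL.toLp g‖ ≤ ε / 3 / M * M := by
    rw [← MemLp.toLp_sub]
    refine hbound _ (hη.memLp.sub hgL) _ (fun z hz => ?_) fun z => ?_
    · rw [Pi.sub_apply, hηR z hz, hR z (by linarith), sub_zero]
    · exact (dist_eq_norm _ _).symm.trans_le (hηg z)
  rw [div_mul_cancel₀ _ hM.ne'] at hηg'
  rw [Metric.mem_ball, dist_eq_norm]
  calc ‖hη.memLp.toLp η - f‖ ≤ ‖hη.memLp.toLp η - hgL.toLp g‖ + ‖hgL.toLp g - f‖ :=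
        norm_sub_le_norm_sub_add_norm_sub _ _ _
    _ < ε := by linarith

end Density

/-! ### Weak derivatives as generators of translations -/

section WeakDerivatives

theorem norm_sub_sub_smul_le {E : Type*} [NormedAddCommGroup E] [NormedSpace ℝ E]
    {u u' u'' : ℝ → E} {C : ℝ} (hu : ∀ r, HasDerivAt u (u' r) r)
    (hu' : ∀ r, HasDerivAt u' (u'' r) r) (hC : ∀ r, ‖u'' r‖ ≤ C) (s : ℝ) :
    ‖u s - u 0 - s • u' 0‖ ≤ C * s ^ 2 := by
  have hfirst : ∀ r, ‖u' r - u' 0‖ ≤ C * |r| := fun r => by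
    simpa using convex_univ.norm_image_sub_le_of_norm_hasDerivWithin_le
      (fun r _ => (hu' r).hasDerivWithinAt) (fun r _ => hC r) (Set.mem_univ 0) (Set.mem_univ r)
  have hderiv : ∀ r, HasDerivAt (fun r => u r - r • u' 0) (u' r - u' 0) r := fun r => by
    simpa using (hu r).fun_sub ((hasDerivAt_id r).smul_const (u' 0))
  have hC0 : 0 ≤ C := (norm_nonneg _).trans (hC 0)
  have hsecond := (convex_closedBall (0 : ℝ) |s|).norm_image_sub_le_of_norm_hasDerivWithin_le
    (C := C * |s|) (fun r _ => (hderiv r).hasDerivWithinAt)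
    (fun r hr => (hfirst r).trans (mul_le_mul_of_nonneg_left (by simpa using hr) hC0))
    (Metric.mem_closedBall_self (abs_nonneg s)) (show s ∈ Metric.closedBall 0 |s| by simp)
  calc ‖u s - u 0 - s • u' 0‖ = ‖u s - s • u' 0 - (u 0 - (0 : ℝ) • u' 0)‖ := by
        rw [zero_smul, sub_zero, sub_right_comm]
    _ ≤ C * |s| * ‖s - 0‖ := hsecond
    _ = C * s ^ 2 := by rw [sub_zero, Real.norm_eq_abs, mul_assoc, ← sq, sq_abs]

variable {ℓ : ℝ} [Fact (0 < ℓ)] {n : ℕ}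

theorem flow_toLp {η : Config ℓ n → ℂ} (hη : IsTestFunction η) (j : Fin 3) (s : ℝ) :
    flow j s (hη.memLp.toLp η) =
      (hη.comp_shift (s • EuclideanSpace.single j (1 : ℝ))).memLp.toLp _ :=
  Lp.toLp_compMeasurePreserving hη.memLp (measurePreserving_shift _)

/-- By Taylor's formula the error of the first-order expansion is `O(s²)` uniformly, on a fixed
compact set. -/
theorem IsTestFunction.hasDerivAt_flow_toLp {η : Config ℓ n → ℂ} (hη : IsTestFunction η)
    (j : Fin 3) :
    HasDerivAt (fun s => flow j s (hη.memLp.toLp η)) ((hη.relDeriv j).memLp.toLp _) 0 := by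
  obtain ⟨R, -, hR⟩ := exists_norm_snd_le_of_hasCompactSupport hη.2
  obtain ⟨R', -, hR'⟩ := exists_norm_snd_le_of_hasCompactSupport (hη.relDeriv j).2
  obtain ⟨C, hC⟩ := ((hη.relDeriv j).relDeriv j).2.exists_bound_of_continuous
    ((hη.relDeriv j).relDeriv j).continuous
  obtain ⟨M, -, hM⟩ := exists_norm_toLp_le (ℓ := ℓ) (n := n) (max (R + 1) R')
  have htaylor : ∀ s : ℝ, |s| ≤ 1 → ‖flow j s (hη.memLp.toLp η) - hη.memLp.toLp η -
      s • (hη.relDeriv j).memLp.toLp _‖ ≤ C * s ^ 2 * M := by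
    intro s hs
    rw [flow_toLp hη, ← MemLp.toLp_sub, ← MemLp.toLp_const_smul, ← MemLp.toLp_sub]
    refine hM _ _ _ (fun z hz => ?_) fun z => ?_
    · obtain ⟨hzR, hzR'⟩ := max_lt_iff.mp hz
      have hnorm : ‖s • EuclideanSpace.single j (1 : ℝ)‖ ≤ 1 := by simpa [norm_smul] using hs
      have hshift := norm_snd_le_norm_snd_shift_add (s • EuclideanSpace.single j (1 : ℝ)) z
      simp [hR z (by linarith), hR' z hzR', hR _ (show R < ‖(shift _ z).2‖ by linarith)]
    · simpa [shift_zero] using norm_sub_sub_smul_le (hη.hasDerivAt_shift j z)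
        ((hη.relDeriv j).hasDerivAt_shift j z) (fun r => hC _) s
  rw [hasDerivAt_iff_isLittleO]
  have hbigO : (fun s => flow j s (hη.memLp.toLp η) - flow j 0 (hη.memLp.toLp η) -
      (s - 0) • (hη.relDeriv j).memLp.toLp _) =O[𝓝 0] fun s => s ^ 2 := by
    refine Asymptotics.IsBigO.of_bound (C * M) ?_
    filter_upwards [Metric.closedBall_mem_nhds (0 : ℝ) one_pos] with s hs
    rw [(isUnitaryGroup_flow j).zero_apply, sub_zero, norm_pow, Real.norm_eq_abs, sq_abs]
    exact (htaylor s (by simpa using hs)).trans_eq (mul_right_comm _ _ _)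
  simpa only [sub_zero] using hbigO.trans_isLittleO (Asymptotics.isLittleO_pow_id one_lt_two)

theorem inner_toLp {η : Config ℓ n → ℂ} (hη : MemLp η 2 volume) (f : L2 ℓ n) :
    inner ℂ (hη.toLp η) f = ∫ z, conj (η z) * f z := by
  rw [L2.inner_def]
  refine integral_congr_ae ?_
  filter_upwards [hη.coeFn_toLp] with z hz
  rw [hz, RCLike.inner_apply']

theorem isWeakRelDeriv_iff_inner {j : Fin 3} {f g : L2 ℓ n} : IsWeakRelDeriv j f g ↔
    ∀ (η : Config ℓ n → ℂ) (hη : IsTestFunction η),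
      inner ℂ ((hη.relDeriv j).memLp.toLp _) f = -inner ℂ (hη.memLp.toLp η) g := by
  simp only [inner_toLp, ← relDeriv_conj]
  exact ⟨fun h η hη => h _ hη.conj, fun h η hη => by simpa using h _ hη.conj⟩

theorem isWeakRelDeriv_iff_hasDerivAt {j : Fin 3} {f g : L2 ℓ n} :
    IsWeakRelDeriv j f g ↔ HasDerivAt (fun s : ℝ => flow j s f) g 0 := by
  rw [isWeakRelDeriv_iff_inner]
  refine ⟨fun h => ?_, fun h η hη => ?_⟩
  · refine (isUnitaryGroup_flow j).hasDerivAt_of_inner_eq_neg dense_setOf_toLp_isTestFunction ?_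
    rintro _ ⟨η, hη, rfl⟩
    refine ⟨_, hη.hasDerivAt_flow_toLp j, fun s => ?_⟩
    have hshift := h _ (hη.comp_shift (s • EuclideanSpace.single j (1 : ℝ)))
    simp only [funext (relDeriv_comp_shift j η _)] at hshift
    rwa [flow_toLp (hη.relDeriv j), flow_toLp hη]
  · exact (isUnitaryGroup_flow j).inner_generator_left (hη.hasDerivAt_flow_toLp j) h

theorem IsWeakRelDeriv.unique {j : Fin 3} {f g g' : L2 ℓ n} (h : IsWeakRelDeriv j f g)
    (h' : IsWeakRelDeriv j f g') : g = g' :=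
  (isWeakRelDeriv_iff_hasDerivAt.mp h).unique (isWeakRelDeriv_iff_hasDerivAt.mp h')

theorem IsWeakRelDeriv.weakRelDeriv_eq {j : Fin 3} {f g : L2 ℓ n} (h : IsWeakRelDeriv j f g) :
    weakRelDeriv j f = g := by
  have hex : ∃ g, IsWeakRelDeriv j f g := ⟨g, h⟩
  rw [weakRelDeriv, dif_pos hex]
  exact hex.choose_spec.unique h

end WeakDerivatives

/-! ### The domain of `-i∇_x - P_f` -/

section CompLp

variable {X Y E F : Type*} [MeasurableSpace X] [MeasurableSpace Y] {μ : Measure X} {ν : Measure Y}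
  [NormedAddCommGroup E] [NormedAddCommGroup F] {p : ℝ≥0∞}

theorem compMeasurePreserving_compLp {T : X → Y} (hT : MeasurePreserving T μ ν) {G : E → F}
    {c : ℝ≥0} (hG : LipschitzWith c G) (hG0 : G 0 = 0) (f : Lp E p ν) :
    Lp.compMeasurePreserving T hT (hG.compLp hG0 f) =
      hG.compLp hG0 (Lp.compMeasurePreserving T hT f) := by
  apply Lp.ext
  filter_upwards [Lp.coeFn_compMeasurePreserving (hG.compLp hG0 f) hT,
    hT.quasiMeasurePreserving.ae_eq (hG.coeFn_compLp hG0 f),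
    hG.coeFn_compLp hG0 (Lp.compMeasurePreserving T hT f),
    Lp.coeFn_compMeasurePreserving f hT] with x hleft hG_T hright hf_T
  rw [hleft, hG_T, hright]
  simp only [Function.comp_apply, hf_T]

end CompLp

section MomentumDomain

variable {ℓ : ℝ} [Fact (0 < ℓ)] {n : ℕ}

theorem IsWeakRelDeriv.add {j : Fin 3} {f f' g g' : L2 ℓ n} (h : IsWeakRelDeriv j f g)
    (h' : IsWeakRelDeriv j f' g') : IsWeakRelDeriv j (f + f') (g + g') := by
  rw [isWeakRelDeriv_iff_hasDerivAt] at h h' ⊢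
  simpa only [map_add] using HasDerivAt.fun_add h h'

theorem IsWeakRelDeriv.smul {j : Fin 3} {f g : L2 ℓ n} (h : IsWeakRelDeriv j f g) (c : ℂ) :
    IsWeakRelDeriv j (c • f) (c • g) := by
  rw [isWeakRelDeriv_iff_hasDerivAt] at h ⊢
  simpa only [map_smul] using HasDerivAt.fun_const_smul c h

theorem isWeakRelDeriv_zero (j : Fin 3) : IsWeakRelDeriv j (0 : L2 ℓ n) 0 := by
  rw [isWeakRelDeriv_iff_hasDerivAt]
  simpa using hasDerivAt_const (0 : ℝ) (0 : L2 ℓ n)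

theorem IsWeakRelDeriv.norm_flow_sub_le {j : Fin 3} {f g : L2 ℓ n} (h : IsWeakRelDeriv j f g)
    (s : ℝ) : ‖flow j s f - f‖ ≤ ‖g‖ * |s| :=
  (isUnitaryGroup_flow j).norm_apply_sub_le (isWeakRelDeriv_iff_hasDerivAt.mp h) s

theorem exists_isWeakRelDeriv_norm_le {j : Fin 3} {f : L2 ℓ n} {C : ℝ}
    (h : ∀ s, ‖flow j s f - f‖ ≤ C * |s|) : ∃ g, ‖g‖ ≤ C ∧ IsWeakRelDeriv j f g := by
  obtain ⟨g, hgC, hg⟩ := (isUnitaryGroup_flow j).exists_hasDerivAt_of_norm_apply_sub_le h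
  exact ⟨g, hgC, isWeakRelDeriv_iff_hasDerivAt.mpr hg⟩

variable (ℓ n) in
/-- The domain of `-i∇_x - P_f` in the `n`-phonon sector. -/
def momentumDomain : Submodule ℂ (L2 ℓ n) where
  carrier := {f | ∀ j, ∃ g, IsWeakRelDeriv j f g}
  zero_mem' := fun j => ⟨0, isWeakRelDeriv_zero j⟩
  add_mem' := fun hf hf' j => (hf j).elim fun g hg => (hf' j).elim fun g' hg' =>
    ⟨g + g', hg.add hg'⟩
  smul_mem' := fun c _ hf j => (hf j).elim fun g hg => ⟨c • g, hg.smul c⟩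

theorem isWeakRelDeriv_weakRelDeriv {f : L2 ℓ n} (hf : f ∈ momentumDomain ℓ n) (j : Fin 3) :
    IsWeakRelDeriv j f (weakRelDeriv j f) := by
  obtain ⟨g, hg⟩ := hf j
  rwa [hg.weakRelDeriv_eq]

theorem weakRelDeriv_add {f f' : L2 ℓ n} (hf : f ∈ momentumDomain ℓ n)
    (hf' : f' ∈ momentumDomain ℓ n) (j : Fin 3) :
    weakRelDeriv j (f + f') = weakRelDeriv j f + weakRelDeriv j f' :=
  ((isWeakRelDeriv_weakRelDeriv hf j).add (isWeakRelDeriv_weakRelDeriv hf' j)).weakRelDeriv_eq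

theorem weakRelDeriv_smul {f : L2 ℓ n} (hf : f ∈ momentumDomain ℓ n) (c : ℂ) (j : Fin 3) :
    weakRelDeriv j (c • f) = c • weakRelDeriv j f :=
  ((isWeakRelDeriv_weakRelDeriv hf j).smul c).weakRelDeriv_eq

theorem weakRelDeriv_sub {f f' : L2 ℓ n} (hf : f ∈ momentumDomain ℓ n)
    (hf' : f' ∈ momentumDomain ℓ n) (j : Fin 3) :
    weakRelDeriv j (f - f') = weakRelDeriv j f - weakRelDeriv j f' := by
  rw [sub_eq_add_neg, ← neg_one_smul ℂ, weakRelDeriv_add hf (Submodule.smul_mem _ _ hf'),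
    weakRelDeriv_smul hf', neg_one_smul, sub_eq_add_neg]

theorem weakRelDeriv_zero (j : Fin 3) : weakRelDeriv j (0 : L2 ℓ n) = 0 :=
  (isWeakRelDeriv_zero j).weakRelDeriv_eq

theorem norm_relMomentum (j : Fin 3) (f : L2 ℓ n) : ‖relMomentum j f‖ = ‖weakRelDeriv j f‖ := by
  rw [relMomentum, norm_smul, norm_neg, Complex.norm_I, one_mul]

theorem inner_relMomentum (j : Fin 3) (f g : L2 ℓ n) :
    inner ℂ (relMomentum j f) (relMomentum j g) =
      inner ℂ (weakRelDeriv j f) (weakRelDeriv j g) := by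
  rw [relMomentum, relMomentum, inner_smul_left, inner_smul_right]
  simp [← mul_assoc]

/-- The form of `(-i∇_x - P_f)²` in the `n`-phonon sector. -/
def kinetic (f g : L2 ℓ n) : ℂ := ∑ j : Fin 3, inner ℂ (weakRelDeriv j f) (weakRelDeriv j g)

/-- The kinetic energy `‖(-i∇_x - P_f) f‖²`. -/
def kineticEnergy (f : L2 ℓ n) : ℝ := ∑ j : Fin 3, ‖weakRelDeriv j f‖ ^ 2

theorem kineticEnergy_nonneg (f : L2 ℓ n) : 0 ≤ kineticEnergy f :=
  Finset.sum_nonneg fun _ _ => by positivity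

theorem kinetic_self (f : L2 ℓ n) : kinetic f f = kineticEnergy f := by
  simp [kinetic, kineticEnergy, inner_self_eq_norm_sq_to_K]

theorem flow_compLp {F : ℂ → ℂ} {c : ℝ≥0} (hF : LipschitzWith c F) (hF0 : F 0 = 0) (j : Fin 3)
    (s : ℝ) (f : L2 ℓ n) : flow j s (hF.compLp hF0 f) = hF.compLp hF0 (flow j s f) :=
  compMeasurePreserving_compLp (measurePreserving_shift _) hF hF0 f

theorem exists_isWeakRelDeriv_compLp {F : ℂ → ℂ} {c : ℝ≥0} (hF : LipschitzWith c F)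
    (hF0 : F 0 = 0) {f : L2 ℓ n} (hf : f ∈ momentumDomain ℓ n) (j : Fin 3) :
    ∃ g, ‖g‖ ≤ c * ‖weakRelDeriv j f‖ ∧ IsWeakRelDeriv j (hF.compLp hF0 f) g := by
  refine exists_isWeakRelDeriv_norm_le fun s => ?_
  rw [flow_compLp, mul_assoc]
  exact (hF.norm_compLp_sub_le hF0 _ _).trans (mul_le_mul_of_nonneg_left
    ((isWeakRelDeriv_weakRelDeriv hf j).norm_flow_sub_le s) c.2)

theorem compLp_mem_momentumDomain {F : ℂ → ℂ} {c : ℝ≥0} (hF : LipschitzWith c F) (hF0 : F 0 = 0)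
    {f : L2 ℓ n} (hf : f ∈ momentumDomain ℓ n) : hF.compLp hF0 f ∈ momentumDomain ℓ n :=
  fun j => (exists_isWeakRelDeriv_compLp hF hF0 hf j).imp fun _ hg => hg.2

theorem norm_weakRelDeriv_compLp_le {F : ℂ → ℂ} {c : ℝ≥0} (hF : LipschitzWith c F)
    (hF0 : F 0 = 0) {f : L2 ℓ n} (hf : f ∈ momentumDomain ℓ n) (j : Fin 3) :
    ‖weakRelDeriv j (hF.compLp hF0 f)‖ ≤ c * ‖weakRelDeriv j f‖ := by
  obtain ⟨g, hgc, hg⟩ := exists_isWeakRelDeriv_compLp hF hF0 hf j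
  rwa [hg.weakRelDeriv_eq]

end MomentumDomain

/-! ### Hardy's inequality along the relative motion -/

section MeasureSpace

variable {X : Type*} [MeasurableSpace X] {μ : Measure X}

theorem integrable_norm_sq (f : Lp ℂ 2 μ) : Integrable (fun x => ‖f x‖ ^ 2) μ :=
  (Lp.memLp f).integrable_norm_pow (by simp)

theorem integral_norm_sq (f : Lp ℂ 2 μ) : ∫ x, ‖f x‖ ^ 2 ∂μ = ‖f‖ ^ 2 := by
  have h := L2.inner_def (𝕜 := ℂ) f f
  simp only [inner_self_eq_norm_sq_to_K] at h
  norm_cast at h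
  exact h.symm

/-- Multiplication by a bounded real-valued function. -/
def mulBounded {w : X → ℝ} (hw : MemLp w ∞ μ) : Lp ℂ 2 μ →L[ℝ] Lp ℂ 2 μ :=
  (ContinuousLinearMap.lsmul ℝ ℝ).holderL μ ∞ 2 2 (hw.toLp w)

theorem coeFn_mulBounded {w : X → ℝ} (hw : MemLp w ∞ μ) (f : Lp ℂ 2 μ) :
    mulBounded hw f =ᵐ[μ] fun x => w x * f x := by
  filter_upwards [(ContinuousLinearMap.lsmul ℝ ℝ).coeFn_holder (r := 2) (hw.toLp w) f,
    hw.coeFn_toLp] with x hholder hwx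
  exact hholder.trans (by simp [hwx])

theorem inner_mulBounded_self {w : X → ℝ} (hw : MemLp w ∞ μ) (f : Lp ℂ 2 μ) :
    inner ℂ f (mulBounded hw f) = ((∫ x, w x * ‖f x‖ ^ 2 ∂μ : ℝ) : ℂ) := by
  rw [← integral_complex_ofReal, L2.inner_def]
  refine integral_congr_ae ?_
  filter_upwards [coeFn_mulBounded hw f] with x hx
  rw [hx, RCLike.inner_apply, mul_assoc, Complex.mul_conj, Complex.normSq_eq_norm_sq]
  push_cast
  rfl

theorem inner_mulBounded_right {w : X → ℝ} (hw : MemLp w ∞ μ) (f g : Lp ℂ 2 μ) :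
    inner ℂ f (mulBounded hw g) = inner ℂ (mulBounded hw f) g := by
  rw [L2.inner_def, L2.inner_def]
  refine integral_congr_ae ?_
  filter_upwards [coeFn_mulBounded hw f, coeFn_mulBounded hw g] with x hf hg
  rw [hf, hg, RCLike.inner_apply, RCLike.inner_apply, map_mul, Complex.conj_ofReal]
  ring

theorem norm_mulBounded_sq {w : X → ℝ} (hw : MemLp w ∞ μ) (f : Lp ℂ 2 μ) :
    ‖mulBounded hw f‖ ^ 2 = ∫ x, w x ^ 2 * ‖f x‖ ^ 2 ∂μ := by
  rw [← integral_norm_sq]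
  refine integral_congr_ae ?_
  filter_upwards [coeFn_mulBounded hw f] with x hx
  rw [hx, norm_mul, mul_pow]
  simp

theorem hasDerivAt_integral_mul {u : X → ℝ} (hu : Integrable u μ) {w w' : ℝ → X → ℝ} {C : ℝ}
    (hw : ∀ s, AEStronglyMeasurable (w s) μ) (hw' : ∀ s, AEStronglyMeasurable (w' s) μ)
    (hwC : ∀ s x, ‖w s x‖ ≤ C) (hw'C : ∀ s x, ‖w' s x‖ ≤ C)
    (hd : ∀ s x, HasDerivAt (fun s => w s x) (w' s x) s) (s : ℝ) :
    HasDerivAt (fun s => ∫ x, w s x * u x ∂μ) (∫ x, w' s x * u x ∂μ) s := by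
  refine (hasDerivAt_integral_of_dominated_loc_of_deriv_le (𝕜 := ℝ) (μ := μ)
    (F := fun s x => w s x * u x) (F' := fun s x => w' s x * u x) (bound := fun x => C * ‖u x‖)
    univ_mem (Eventually.of_forall fun s => (hw s).mul hu.1)
    (hu.bdd_mul (hw s) (Eventually.of_forall (hwC s))) ((hw' s).mul hu.1)
    (Eventually.of_forall fun x s _ => ?_) (hu.norm.const_mul C)
    (Eventually.of_forall fun x s _ => (hd s x).mul_const _)).2
  rw [norm_mul]
  gcongr
  exact hw'C s x

end MeasureSpace

section Virial

variable {ℓ : ℝ} {n : ℕ}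

theorem measurableEmbedding_shift (t : E3) :
    MeasurableEmbedding (shift t : Config ℓ n → Config ℓ n) :=
  Homeomorph.measurableEmbedding
    { toFun := shift t
      invFun := shift (-t)
      left_inv := fun z => by rw [shift_shift, neg_add_cancel, shift_zero]
      right_inv := fun z => by rw [shift_shift, add_neg_cancel, shift_zero]
      continuous_toFun := continuous_shift t
      continuous_invFun := continuous_shift (-t) }

variable [Fact (0 < ℓ)]

theorem memLp_weight (w : BoundedContinuousFunction E3 ℝ) :
    MemLp (fun z : Config ℓ (n + 1) => w (z.2 0)) ∞ volume :=
  memLp_top_of_bound (by fun_prop) ‖w‖ (Eventually.of_forall fun _ => w.norm_coe_le_norm _)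

theorem integrable_weight_mul_norm_sq (w : BoundedContinuousFunction E3 ℝ) (f : L2 ℓ (n + 1)) :
    Integrable (fun z => w (z.2 0) * ‖f z‖ ^ 2) volume :=
  (integrable_norm_sq f).bdd_mul (by fun_prop)
    (Eventually.of_forall fun _ => w.norm_coe_le_norm _)

theorem inner_flow_mulBounded_flow (w : BoundedContinuousFunction E3 ℝ) (j : Fin 3) (s : ℝ)
    (f : L2 ℓ (n + 1)) :
    inner ℂ (flow j s f) (mulBounded (memLp_weight w) (flow j s f)) =
      ((∫ z, w (z.2 0 + s • EuclideanSpace.single j (1 : ℝ)) * ‖f z‖ ^ 2 : ℝ) : ℂ) := by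
  rw [inner_mulBounded_self, ← (measurePreserving_shift (ℓ := ℓ) (n := n + 1)
    (s • EuclideanSpace.single j (1 : ℝ))).integral_comp (measurableEmbedding_shift _)
    fun z => w (z.2 0 + s • EuclideanSpace.single j (1 : ℝ)) * ‖f z‖ ^ 2]
  congr 1
  refine integral_congr_ae ?_
  filter_upwards [coeFn_flow j s f] with z hz
  rw [hz]
  simp [shift]

theorem integral_lineDeriv_mul_norm_sq {j : Fin 3} {f g : L2 ℓ (n + 1)}
    (hf : IsWeakRelDeriv j f g) {w w' : BoundedContinuousFunction E3 ℝ}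
    (hd : ∀ y, HasLineDerivAt ℝ w (w' y) y (EuclideanSpace.single j (1 : ℝ))) :
    ∫ z, w' (z.2 0) * ‖f z‖ ^ 2 = 2 * (inner ℂ (mulBounded (memLp_weight w) f) g).re := by
  have hline : ∀ (s : ℝ) (z : Config ℓ (n + 1)),
      HasDerivAt (fun s => w (z.2 0 + s • EuclideanSpace.single j (1 : ℝ)))
        (w' (z.2 0 + s • EuclideanSpace.single j (1 : ℝ))) s := fun s z => by
    have hshift := hd (z.2 0 + s • EuclideanSpace.single j (1 : ℝ))
    rw [HasLineDerivAt, ← sub_self s] at hshift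
    simpa [add_assoc, ← add_smul] using hshift.comp_sub_const s s
  have hintegral := hasDerivAt_integral_mul (integrable_norm_sq f)
    (w := fun s z => w (z.2 0 + s • EuclideanSpace.single j (1 : ℝ)))
    (w' := fun s z => w' (z.2 0 + s • EuclideanSpace.single j (1 : ℝ)))
    (fun s => by fun_prop) (fun s => by fun_prop)
    (fun s z => (w.norm_coe_le_norm _).trans (le_max_left _ ‖w'‖))
    (fun s z => (w'.norm_coe_le_norm _).trans (le_max_right _ _)) hline 0
  have hflow := isWeakRelDeriv_iff_hasDerivAt.mp hf
  have hinner := HasDerivAt.inner ℂ hflow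
    ((mulBounded (memLp_weight w)).hasFDerivAt.comp_hasDerivAt (0 : ℝ) hflow)
  simp only [Function.comp_apply, inner_flow_mulBounded_flow] at hinner
  have heq := congrArg Complex.re (hinner.unique hintegral.ofReal_comp)
  have hsymm : (inner ℂ g (mulBounded (memLp_weight w) f)).re =
      (inner ℂ (mulBounded (memLp_weight w) f) g).re := inner_re_symm (𝕜 := ℂ) _ _
  rw [(isUnitaryGroup_flow j).zero_apply, inner_mulBounded_right] at heq
  simpa [two_mul, hsymm] using heq.symm

theorem integral_lineDeriv_mul_norm_sq_le {j : Fin 3} {f g : L2 ℓ (n + 1)}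
    (hf : IsWeakRelDeriv j f g) {w w' : BoundedContinuousFunction E3 ℝ}
    (hd : ∀ y, HasLineDerivAt ℝ w (w' y) y (EuclideanSpace.single j (1 : ℝ))) :
    ∫ z, w' (z.2 0) * ‖f z‖ ^ 2 ≤ 2 * ‖g‖ ^ 2 + 2⁻¹ * ∫ z, w (z.2 0) ^ 2 * ‖f z‖ ^ 2 := by
  rw [integral_lineDeriv_mul_norm_sq hf hd, ← norm_mulBounded_sq (memLp_weight w)]
  have hcs : (inner ℂ (mulBounded (memLp_weight w) f) g).re ≤ _ := re_inner_le_norm (𝕜 := ℂ) _ _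
  nlinarith [sq_nonneg (‖mulBounded (memLp_weight w) f‖ - 2 * ‖g‖)]

end Virial

section Hardy

/-- The regularization `(|y|² + ε²)⁻¹` of `|y|⁻²`. -/
def hardyWeight (ε : ℝ) (y : E3) : ℝ := (‖y‖ ^ 2 + ε ^ 2)⁻¹

variable {ε : ℝ}

theorem hardyWeight_nonneg (ε : ℝ) (y : E3) : 0 ≤ hardyWeight ε y := by
  unfold hardyWeight
  positivity

theorem continuous_hardyWeight (hε : 0 < ε) : Continuous (hardyWeight ε) :=
  Continuous.inv₀ (by fun_prop) fun y => by positivity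

theorem hardyWeight_le (hε : 0 < ε) (y : E3) : hardyWeight ε y ≤ (ε ^ 2)⁻¹ :=
  inv_anti₀ (by positivity) (le_add_of_nonneg_left (sq_nonneg _))

theorem norm_sq_mul_hardyWeight_le (hε : 0 < ε) (y : E3) : ‖y‖ ^ 2 * hardyWeight ε y ≤ 1 := by
  rw [hardyWeight, ← div_eq_mul_inv, div_le_one (by positivity)]
  exact le_add_of_nonneg_right (sq_nonneg ε)

theorem sum_coord_sq (y : E3) : ∑ j, y j ^ 2 = ‖y‖ ^ 2 := by
  simp [EuclideanSpace.norm_sq_eq]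

theorem coord_sq_mul_hardyWeight_sq_le (hε : 0 < ε) (y : E3) (j : Fin 3) :
    y j ^ 2 * hardyWeight ε y ^ 2 ≤ hardyWeight ε y := by
  have hj : y j ^ 2 ≤ ‖y‖ ^ 2 := sum_coord_sq y ▸
    Finset.single_le_sum (fun i _ => sq_nonneg (y i)) (Finset.mem_univ j)
  calc y j ^ 2 * hardyWeight ε y ^ 2 ≤ ‖y‖ ^ 2 * hardyWeight ε y ^ 2 := by gcongr
    _ = ‖y‖ ^ 2 * hardyWeight ε y * hardyWeight ε y := by ring
    _ ≤ hardyWeight ε y := mul_le_of_le_one_left (hardyWeight_nonneg ε y)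
        (norm_sq_mul_hardyWeight_le hε y)

/-- `hardyWeight` as a bounded continuous function. -/
def hardyWeightBCF (hε : 0 < ε) : BoundedContinuousFunction E3 ℝ :=
  BoundedContinuousFunction.ofNormedAddCommGroup (hardyWeight ε) (continuous_hardyWeight hε)
    (ε ^ 2)⁻¹ fun y => by
      rw [Real.norm_of_nonneg (hardyWeight_nonneg ε y)]
      exact hardyWeight_le hε y

/-- The components of the vector field `y / (|y|² + ε²)`. -/
def hardyField (hε : 0 < ε) (j : Fin 3) : BoundedContinuousFunction E3 ℝ :=
  BoundedContinuousFunction.ofNormedAddCommGroup (fun y => y j * hardyWeight ε y)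
    (Continuous.mul (by fun_prop) (continuous_hardyWeight hε)) ε⁻¹ fun y => by
      refine abs_le_of_sq_le_sq ?_ (by positivity)
      rw [mul_pow, inv_pow]
      exact (coord_sq_mul_hardyWeight_sq_le hε y j).trans (hardyWeight_le hε y)

/-- The derivative of `hardyField hε j` in the direction `j`. -/
def hardyFieldDeriv (hε : 0 < ε) (j : Fin 3) : BoundedContinuousFunction E3 ℝ :=
  BoundedContinuousFunction.ofNormedAddCommGroup
    (fun y => hardyWeight ε y - 2 * (y j ^ 2 * hardyWeight ε y ^ 2))
    ((continuous_hardyWeight hε).sub (continuous_const.mul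
      (Continuous.mul (by fun_prop) ((continuous_hardyWeight hε).pow 2)))) (ε ^ 2)⁻¹ fun y => by
      have hsq : 0 ≤ y j ^ 2 * hardyWeight ε y ^ 2 := by positivity
      have hle := hardyWeight_le hε y
      have hsq_le := coord_sq_mul_hardyWeight_sq_le hε y j
      exact abs_le.mpr ⟨by linarith, by linarith⟩

theorem hasLineDerivAt_hardyField (hε : 0 < ε) (j : Fin 3) (y : E3) :
    HasLineDerivAt ℝ (hardyField hε j) (hardyFieldDeriv hε j y) y
      (EuclideanSpace.single j (1 : ℝ)) := by
  have hpos : ‖y‖ ^ 2 + ε ^ 2 ≠ 0 := by positivity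
  have hline : HasDerivAt (fun s : ℝ => y + s • EuclideanSpace.single j (1 : ℝ))
      (EuclideanSpace.single j (1 : ℝ)) 0 := by
    simpa using ((hasDerivAt_id (0 : ℝ)).smul_const (EuclideanSpace.single j (1 : ℝ))).const_add y
  have hcoord : HasDerivAt (fun s : ℝ => (y + s • EuclideanSpace.single j (1 : ℝ)) j) 1 0 := by
    simpa using (hasDerivAt_id (0 : ℝ)).const_add (y j)
  have hnorm : HasDerivAt (fun s : ℝ => ‖y + s • EuclideanSpace.single j (1 : ℝ)‖ ^ 2 + ε ^ 2)
      (2 * y j) 0 := by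
    simpa [EuclideanSpace.inner_single_right] using hline.norm_sq.add_const (ε ^ 2)
  refine (hcoord.fun_mul (hnorm.fun_inv (by simpa using hpos))).congr_deriv ?_
  simp only [hardyFieldDeriv, hardyWeight, zero_smul, add_zero,
    BoundedContinuousFunction.coe_ofNormedAddCommGroup]
  field_simp
  ring

theorem sum_hardyField_sq_le (hε : 0 < ε) (y : E3) :
    ∑ j, hardyField hε j y ^ 2 ≤ hardyWeight ε y := by
  calc ∑ j, hardyField hε j y ^ 2 = ‖y‖ ^ 2 * hardyWeight ε y * hardyWeight ε y := by
        simp only [hardyField, BoundedContinuousFunction.coe_ofNormedAddCommGroup, mul_pow]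
        rw [← Finset.sum_mul, sum_coord_sq, sq (hardyWeight ε y), mul_assoc]
    _ ≤ hardyWeight ε y := mul_le_of_le_one_left (hardyWeight_nonneg ε y)
        (norm_sq_mul_hardyWeight_le hε y)

theorem le_sum_hardyFieldDeriv (hε : 0 < ε) (y : E3) :
    hardyWeight ε y ≤ ∑ j, hardyFieldDeriv hε j y := by
  have hle : ‖y‖ ^ 2 * hardyWeight ε y * hardyWeight ε y ≤ hardyWeight ε y :=
    mul_le_of_le_one_left (hardyWeight_nonneg ε y) (norm_sq_mul_hardyWeight_le hε y)
  calc hardyWeight ε y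
      ≤ 3 * hardyWeight ε y - 2 * (‖y‖ ^ 2 * hardyWeight ε y * hardyWeight ε y) := by linarith
    _ = ∑ j, hardyFieldDeriv hε j y := by
        simp only [hardyFieldDeriv, BoundedContinuousFunction.coe_ofNormedAddCommGroup,
          Finset.sum_sub_distrib, Finset.sum_const, Finset.card_univ, Fintype.card_fin,
          nsmul_eq_mul, ← Finset.mul_sum, ← Finset.sum_mul, sum_coord_sq]
        push_cast
        ring

theorem tendsto_hardyWeight {y : E3} (hy : y ≠ 0) :
    Tendsto (fun k : ℕ => hardyWeight (1 / ((k : ℝ) + 1)) y) atTop (𝓝 (formFactor y)) := by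
  have hy0 : ‖y‖ ^ 2 + 0 ^ 2 ≠ 0 := by simpa using hy
  simpa [hardyWeight, formFactor] using Tendsto.inv₀
    (tendsto_const_nhds.add ((tendsto_one_div_add_atTop_nhds_zero_nat (𝕜 := ℝ)).pow 2)) hy0

variable {ℓ : ℝ} [Fact (0 < ℓ)] {n : ℕ}

theorem integral_hardyWeight_mul_norm_sq_le {f : L2 ℓ (n + 1)} (hf : f ∈ momentumDomain ℓ (n + 1))
    (hε : 0 < ε) :
    ∫ z, hardyWeight ε (z.2 0) * ‖f z‖ ^ 2 ≤ 4 * kineticEnergy f := by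
  have hweight := integrable_weight_mul_norm_sq (hardyWeightBCF hε) f
  have hderiv := fun j => integrable_weight_mul_norm_sq (hardyFieldDeriv hε j) f
  have hfield : ∀ j, Integrable (fun z => hardyField hε j (z.2 0) ^ 2 * ‖f z‖ ^ 2) volume :=
    fun j => integrable_weight_mul_norm_sq (hardyField hε j ^ 2) f
  have hlower : ∫ z, hardyWeight ε (z.2 0) * ‖f z‖ ^ 2 ≤
      ∑ j, ∫ z, hardyFieldDeriv hε j (z.2 0) * ‖f z‖ ^ 2 := by
    rw [← integral_finsetSum _ fun j _ => hderiv j]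
    refine integral_mono hweight (integrable_finsetSum _ fun j _ => hderiv j) fun z => ?_
    simp only [← Finset.sum_mul]
    gcongr
    exact le_sum_hardyFieldDeriv hε _
  have hupper : ∑ j, ∫ z, hardyField hε j (z.2 0) ^ 2 * ‖f z‖ ^ 2 ≤
      ∫ z, hardyWeight ε (z.2 0) * ‖f z‖ ^ 2 := by
    rw [← integral_finsetSum _ fun j _ => hfield j]
    refine integral_mono (integrable_finsetSum _ fun j _ => hfield j) hweight fun z => ?_
    simp only [← Finset.sum_mul]
    gcongr
    exact sum_hardyField_sq_le hε _
  have hvirial := Finset.sum_le_sum fun (j : Fin 3) (_ : j ∈ Finset.univ) =>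
    integral_lineDeriv_mul_norm_sq_le (isWeakRelDeriv_weakRelDeriv hf j)
      (hasLineDerivAt_hardyField hε j)
  rw [Finset.sum_add_distrib, ← Finset.mul_sum, ← Finset.mul_sum, ← kineticEnergy] at hvirial
  linarith

theorem lintegral_formFactor_mul_norm_sq_le {f : L2 ℓ (n + 1)}
    (hf : f ∈ momentumDomain ℓ (n + 1)) :
    ∫⁻ z, ENNReal.ofReal (formFactor (z.2 0) * ‖f z‖ ^ 2) ≤
      ENNReal.ofReal (4 * kineticEnergy f) := by
  let F : ℕ → Config ℓ (n + 1) → ℝ := fun k z =>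
    hardyWeight (1 / ((k : ℝ) + 1)) (z.2 0) * ‖f z‖ ^ 2
  have hε : ∀ k : ℕ, 0 < 1 / ((k : ℝ) + 1) := fun k => by positivity
  have hF : ∀ k, Integrable (F k) volume := fun k =>
    integrable_weight_mul_norm_sq (hardyWeightBCF (hε k)) f
  have hF0 : ∀ k, 0 ≤ F k := fun k z => mul_nonneg (hardyWeight_nonneg _ _) (sq_nonneg _)
  have hle : ∀ k, ∫⁻ z, ENNReal.ofReal (F k z) ≤ ENNReal.ofReal (4 * kineticEnergy f) := by
    intro k
    rw [← ofReal_integral_eq_lintegral_ofReal (hF k) (Eventually.of_forall (hF0 k))]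
    exact ENNReal.ofReal_le_ofReal (integral_hardyWeight_mul_norm_sq_le hf (hε k))
  calc ∫⁻ z, ENNReal.ofReal (formFactor (z.2 0) * ‖f z‖ ^ 2)
      ≤ ∫⁻ z, liminf (fun k => ENNReal.ofReal (F k z)) atTop := by
        refine lintegral_mono fun z => ?_
        by_cases hz : z.2 0 = 0
        · simp [formFactor, hz]
        · exact (ENNReal.tendsto_ofReal ((tendsto_hardyWeight hz).mul_const _)).liminf_eq.ge
    _ ≤ liminf (fun k => ∫⁻ z, ENNReal.ofReal (F k z)) atTop :=
        lintegral_liminf_le' fun k => (hF k).aemeasurable.ennreal_ofReal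
    _ ≤ ENNReal.ofReal (4 * kineticEnergy f) :=
        liminf_le_of_frequently_le' (Frequently.of_forall hle)

end Hardy

/-! ### The interaction -/

section FormFactor

theorem formFactor_nonneg (y : E3) : 0 ≤ formFactor y := by
  unfold formFactor
  positivity

theorem formFactor_pos {y : E3} (hy : y ≠ 0) : 0 < formFactor y := by
  rw [formFactor]
  positivity

theorem measurable_formFactor : Measurable formFactor := by
  unfold formFactor
  fun_prop

theorem integrableOn_formFactor_ball : IntegrableOn formFactor (Metric.ball (0 : E3) 1) := by
  refine (integrableOn_fun_norm_addHaar volume (f := fun t : ℝ => 1 / t ^ 2)).mpr ?_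
  refine (integrableOn_congr_fun (g := fun _ : ℝ => (1 : ℝ)) ?_ measurableSet_Ioo).mpr
    (integrableOn_const (by simp))
  intro t ht
  have ht0 : t ≠ 0 := ht.1.ne'
  simp only [finrank_euclideanSpace, Fintype.card_fin, smul_eq_mul]
  field_simp

theorem iInter_ball_zero_one_div {E : Type*} [NormedAddCommGroup E] :
    ⋂ k : ℕ, Metric.ball (0 : E) (1 / ((k : ℝ) + 1)) = {0} := by
  refine Set.Subset.antisymm (fun y hy => ?_) ?_
  · rw [Set.mem_singleton_iff, ← norm_le_zero_iff]
    exact ge_of_tendsto' (tendsto_one_div_add_atTop_nhds_zero_nat (𝕜 := ℝ)) fun k =>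
      (mem_ball_zero_iff.mp (Set.mem_iInter.mp hy k)).le
  · simp only [Set.singleton_subset_iff, Set.mem_iInter, Metric.mem_ball, dist_self]
    exact fun k => by positivity

theorem exists_setIntegral_formFactor_ball_le {κ : ℝ} (hκ : 0 < κ) :
    ∃ r : ℝ, 0 < r ∧ IntegrableOn formFactor (Metric.ball (0 : E3) r) ∧
      ∫ y in Metric.ball (0 : E3) r, formFactor y ≤ κ := by
  have hanti : Antitone (fun k : ℕ => Metric.ball (0 : E3) (1 / ((k : ℝ) + 1))) := by
    intro k l hkl
    refine Metric.ball_subset_ball ?_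
    gcongr
  have hlim := tendsto_setIntegral_of_antitone (f := formFactor) (μ := volume)
    (fun k => measurableSet_ball) hanti ⟨0, by simpa using integrableOn_formFactor_ball⟩
  rw [iInter_ball_zero_one_div, setIntegral_measure_zero _ (by simp)] at hlim
  obtain ⟨k, hk⟩ := (hlim.eventually (gt_mem_nhds hκ)).exists
  refine ⟨1 / ((k : ℝ) + 1), by positivity,
    integrableOn_formFactor_ball.mono_set (Metric.ball_subset_ball ?_), hk.le⟩
  exact div_le_one_of_le₀ (by linarith [k.cast_nonneg (α := ℝ)]) (by positivity)

theorem integrableOn_formFactor_sq_compl_ball {r : ℝ} (hr : 0 < r) :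
    IntegrableOn (fun y => formFactor y ^ 2) (Metric.ball (0 : E3) r)ᶜ := by
  have hmaj : Integrable (fun y : E3 => (r⁻¹ + 1) ^ 4 * (1 + ‖y‖) ^ (-(4 : ℕ) : ℝ)) volume :=
    (integrable_one_add_norm (by simp; norm_num)).const_mul _
  refine hmaj.integrableOn.mono' (measurable_formFactor.pow_const 2).aestronglyMeasurable ?_
  filter_upwards [ae_restrict_mem measurableSet_ball.compl] with y hy
  have hry : r ≤ ‖y‖ := by simpa using hy
  have hy0 : 0 < ‖y‖ := hr.trans_le hry
  have hle : 1 + ‖y‖ ≤ (r⁻¹ + 1) * ‖y‖ := by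
    have hone : 1 ≤ r⁻¹ * ‖y‖ := by rwa [← div_eq_inv_mul, one_le_div hr]
    linarith
  rw [Real.norm_of_nonneg (sq_nonneg _), formFactor, Real.rpow_neg (by positivity),
    Real.rpow_natCast, ← div_eq_mul_inv, div_pow, one_pow, ← pow_mul,
    div_le_div_iff₀ (by positivity) (by positivity), one_mul, ← mul_pow]
  gcongr

end FormFactor

section Interaction

variable {ℓ : ℝ} {n : ℕ}

/-- Adjoining a phonon at the first place. -/
def consMap (p : Config ℓ n × E3) : Config ℓ (n + 1) :=
  (p.1.1, (Fin.cons p.2 p.1.2 : Fin (n + 1) → E3))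

variable (ℓ n) in
/-- Adjoining a phonon at the first place, as an equivalence of measurable spaces. -/
def consEquiv : Config ℓ n × E3 ≃ᵐ Config ℓ (n + 1) :=
  (MeasurableEquiv.prodAssoc.trans
    (MeasurableEquiv.prodCongr (MeasurableEquiv.refl (Torus ℓ)) MeasurableEquiv.prodComm)).trans
    (MeasurableEquiv.prodCongr (MeasurableEquiv.refl (Torus ℓ))
      (MeasurableEquiv.piFinSuccAbove (fun _ => E3) 0).symm)

theorem coe_consEquiv : ⇑(consEquiv ℓ n) = consMap := by
  funext p
  refine Prod.ext rfl ?_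
  change Fin.insertNth (α := fun _ => E3) 0 p.2 p.1.2 = Fin.cons p.2 p.1.2
  exact Fin.insertNth_zero' _ _

theorem measurableEmbedding_consMap :
    MeasurableEmbedding (consMap : Config ℓ n × E3 → Config ℓ (n + 1)) :=
  coe_consEquiv (ℓ := ℓ) (n := n) ▸ (consEquiv ℓ n).measurableEmbedding

variable [Fact (0 < ℓ)]

theorem measurePreserving_consMap :
    MeasurePreserving (consMap : Config ℓ n × E3 → Config ℓ (n + 1))
      volume volume := by
  rw [← coe_consEquiv]
  have hassoc := measurePreserving_prodAssoc (volume : Measure (Torus ℓ))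
    (volume : Measure (Fin n → E3)) (volume : Measure E3)
  have hswap := (MeasurePreserving.id (volume : Measure (Torus ℓ))).prod
    (Measure.measurePreserving_swap (μ := (volume : Measure (Fin n → E3)))
      (ν := (volume : Measure E3)))
  have hcons := (MeasurePreserving.id (volume : Measure (Torus ℓ))).prod
    (volume_preserving_piFinSuccAbove (fun _ : Fin (n + 1) => E3) 0).symm
  exact (hcons.comp hswap).comp hassoc

/-- `∫ |θ(x, y₁, …)| v(y) |ψ(x, y, y₁, …)|`. -/
def absKernel (θ : L2 ℓ n) (ψ : L2 ℓ (n + 1)) (p : Config ℓ n × E3) : ℝ :=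
  ‖θ p.1‖ * (formFactor p.2 * ‖ψ (consMap p)‖)

/-- The integrand of `⟨θ, a(v) ψ⟩`, up to the factor `√(n+1)`. -/
def kernel (θ : L2 ℓ n) (ψ : L2 ℓ (n + 1)) (p : Config ℓ n × E3) : ℂ :=
  conj (θ p.1) * ((formFactor p.2 : ℂ) * ψ (consMap p))

/-- `⟨θ, a(v) ψ⟩ / √(n+1)`. -/
def pairing (θ : L2 ℓ n) (ψ : L2 ℓ (n + 1)) : ℂ :=
  ∫ p, kernel θ ψ p

theorem norm_kernel (θ : L2 ℓ n) (ψ : L2 ℓ (n + 1)) (p : Config ℓ n × E3) :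
    ‖kernel θ ψ p‖ = absKernel θ ψ p := by
  rw [kernel, absKernel, norm_mul, norm_mul, RCLike.norm_conj, Complex.norm_real,
    Real.norm_of_nonneg (formFactor_nonneg _)]

theorem aestronglyMeasurable_kernel (θ : L2 ℓ n) (ψ : L2 ℓ (n + 1)) :
    AEStronglyMeasurable (kernel θ ψ)
      volume := by
  have hθ : AEStronglyMeasurable (fun p : Config ℓ n × E3 => θ p.1) volume :=
    (Lp.aestronglyMeasurable θ).comp_quasiMeasurePreserving Measure.quasiMeasurePreserving_fst
  have hψ : AEStronglyMeasurable (fun p : Config ℓ n × E3 => ψ (consMap p)) volume :=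
    (Lp.aestronglyMeasurable ψ).comp_quasiMeasurePreserving
      measurePreserving_consMap.quasiMeasurePreserving
  have hv : AEStronglyMeasurable (fun p : Config ℓ n × E3 => (formFactor p.2 : ℂ)) volume :=
    (Complex.measurable_ofReal.comp
      (measurable_formFactor.comp measurable_snd)).aestronglyMeasurable
  exact (Complex.continuous_conj.comp_aestronglyMeasurable hθ).mul (hv.mul hψ)

theorem aestronglyMeasurable_absKernel (θ : L2 ℓ n) (ψ : L2 ℓ (n + 1)) :
    AEStronglyMeasurable (absKernel θ ψ)
      volume := by
  have h := (aestronglyMeasurable_kernel θ ψ).norm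
  simpa only [norm_kernel] using h

theorem integrable_formFactor_mul_norm_sq {ψ : L2 ℓ (n + 1)}
    (hψ : ψ ∈ momentumDomain ℓ (n + 1)) :
    Integrable (fun z => formFactor (z.2 0) * ‖ψ z‖ ^ 2) volume := by
  have hpc : Continuous (fun z : Config ℓ (n + 1) => z.2 0) := by fun_prop
  refine ⟨(measurable_formFactor.comp hpc.measurable).aestronglyMeasurable.mul
    (integrable_norm_sq ψ).aestronglyMeasurable, ?_⟩
  rw [hasFiniteIntegral_iff_ofReal (Eventually.of_forall fun z =>
    mul_nonneg (formFactor_nonneg _) (by positivity))]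
  exact (lintegral_formFactor_mul_norm_sq_le hψ).trans_lt ENNReal.ofReal_lt_top

theorem integral_formFactor_mul_norm_sq_le {ψ : L2 ℓ (n + 1)}
    (hψ : ψ ∈ momentumDomain ℓ (n + 1)) :
    ∫ z, formFactor (z.2 0) * ‖ψ z‖ ^ 2 ≤ 4 * kineticEnergy ψ := by
  have h := lintegral_formFactor_mul_norm_sq_le hψ
  rw [← ofReal_integral_eq_lintegral_ofReal (integrable_formFactor_mul_norm_sq hψ)
    (Eventually.of_forall fun z => mul_nonneg (formFactor_nonneg _) (by positivity))] at h
  exact (ENNReal.ofReal_le_ofReal_iff (mul_nonneg (by norm_num) (kineticEnergy_nonneg ψ))).mp h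

section FormBound

variable {κ r : ℝ}

/-- The singular part of the form factor. -/
def nearFormFactor (r : ℝ) : E3 → ℝ := (Metric.ball 0 r).indicator formFactor

/-- The square of the part of the form factor away from its singularity. -/
def farFormFactorSq (r : ℝ) : E3 → ℝ := (Metric.ball 0 r)ᶜ.indicator fun y => formFactor y ^ 2

/-- The majorant of `√(n+1) · absKernel θ ψ` obtained from Young's inequality. -/
def kernelMajorant (κ r : ℝ) (θ : L2 ℓ n) (ψ : L2 ℓ (n + 1)) (p : Config ℓ n × E3) : ℝ :=
  (κ⁻¹ * (n + 1) * (‖θ p.1‖ ^ 2 * nearFormFactor r p.2)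
      + κ / 4 * (formFactor p.2 * ‖ψ (consMap p)‖ ^ 2))
    + ((4 * κ)⁻¹ * (‖θ p.1‖ ^ 2 * farFormFactorSq r p.2) + κ * (n + 1) * ‖ψ (consMap p)‖ ^ 2)

theorem integrable_farFormFactorSq (hr : 0 < r) : Integrable (farFormFactorSq r) volume :=
  (integrable_indicator_iff measurableSet_ball.compl).mpr
    (integrableOn_formFactor_sq_compl_ball hr)

theorem absKernel_nonneg (θ : L2 ℓ n) (ψ : L2 ℓ (n + 1)) (p : Config ℓ n × E3) :
    0 ≤ absKernel θ ψ p :=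
  mul_nonneg (norm_nonneg _) (mul_nonneg (formFactor_nonneg _) (norm_nonneg _))

theorem mul_le_inv_mul_sq_add {c : ℝ} (hc : 0 < c) (x y : ℝ) :
    x * y ≤ c⁻¹ * x ^ 2 + c / 4 * y ^ 2 := by
  have hsq : c⁻¹ * x ^ 2 + c / 4 * y ^ 2 - x * y = c⁻¹ * (x - c / 2 * y) ^ 2 := by
    field_simp
    ring
  have hnonneg : 0 ≤ c⁻¹ * (x - c / 2 * y) ^ 2 := by positivity
  linarith

theorem sqrt_mul_absKernel_le (hκ : 0 < κ) (θ : L2 ℓ n) (ψ : L2 ℓ (n + 1))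
    (p : Config ℓ n × E3) : √(n + 1) * absKernel θ ψ p ≤ kernelMajorant κ r θ ψ p := by
  have hsqrt : √((n : ℝ) + 1) ^ 2 = n + 1 := Real.sq_sqrt (by positivity)
  have hv := formFactor_nonneg p.2
  rw [absKernel, kernelMajorant]
  by_cases hp : p.2 ∈ Metric.ball (0 : E3) r
  · have hfar : farFormFactorSq r p.2 = 0 := Set.indicator_of_notMem (by simpa using hp) _
    have hyoung := mul_le_mul_of_nonneg_left
      (mul_le_inv_mul_sq_add hκ (√(n + 1) * ‖θ p.1‖) ‖ψ (consMap p)‖) hv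
    have hnonneg : 0 ≤ κ * (n + 1) * ‖ψ (consMap p)‖ ^ 2 := by positivity
    rw [mul_pow, hsqrt] at hyoung
    rw [nearFormFactor, Set.indicator_of_mem hp, hfar]
    linarith
  · have hnear : nearFormFactor r p.2 = 0 := Set.indicator_of_notMem hp _
    have hyoung := mul_le_inv_mul_sq_add (mul_pos four_pos hκ) (‖θ p.1‖ * formFactor p.2)
      (√(n + 1) * ‖ψ (consMap p)‖)
    have hnonneg : 0 ≤ κ / 4 * (formFactor p.2 * ‖ψ (consMap p)‖ ^ 2) := by positivity
    rw [mul_pow, mul_pow, hsqrt] at hyoung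
    rw [farFormFactorSq, Set.indicator_of_mem (by simpa using hp), hnear]
    linarith

theorem integrable_norm_sq_mul (θ : L2 ℓ n) {k : E3 → ℝ} (hk : Integrable k volume) :
    Integrable (fun p : Config ℓ n × E3 => ‖θ p.1‖ ^ 2 * k p.2) volume :=
  (integrable_norm_sq θ).mul_prod hk

theorem integral_norm_sq_mul (θ : L2 ℓ n) (k : E3 → ℝ) :
    ∫ p : Config ℓ n × E3, ‖θ p.1‖ ^ 2 * k p.2 = ‖θ‖ ^ 2 * ∫ y, k y := by
  rw [← integral_norm_sq θ]
  exact integral_prod_mul (fun z => ‖θ z‖ ^ 2) k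

theorem integrable_comp_consMap {w : Config ℓ (n + 1) → ℝ} (hw : Integrable w volume) :
    Integrable (fun p : Config ℓ n × E3 => w (consMap p)) volume :=
  (measurePreserving_consMap.integrable_comp_emb measurableEmbedding_consMap).mpr hw

theorem integral_comp_consMap (w : Config ℓ (n + 1) → ℝ) :
    ∫ p : Config ℓ n × E3, w (consMap p) = ∫ z, w z :=
  measurePreserving_consMap.integral_comp measurableEmbedding_consMap w

theorem integrable_kernelMajorant (hnear : Integrable (nearFormFactor r) volume) (hr : 0 < r)
    (κ : ℝ) (θ : L2 ℓ n) {ψ : L2 ℓ (n + 1)} (hψ : ψ ∈ momentumDomain ℓ (n + 1)) :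
    Integrable (kernelMajorant κ r θ ψ) volume :=
  (((integrable_norm_sq_mul θ hnear).const_mul _).add
    ((integrable_comp_consMap (integrable_formFactor_mul_norm_sq hψ)).const_mul _)).add
  (((integrable_norm_sq_mul θ (integrable_farFormFactorSq hr)).const_mul _).add
    ((integrable_comp_consMap (integrable_norm_sq ψ)).const_mul _))

theorem integral_kernelMajorant (hnear : Integrable (nearFormFactor r) volume) (hr : 0 < r)
    (κ : ℝ) (θ : L2 ℓ n) {ψ : L2 ℓ (n + 1)} (hψ : ψ ∈ momentumDomain ℓ (n + 1)) :
    ∫ p, kernelMajorant κ r θ ψ p =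
      (κ⁻¹ * (n + 1) * (‖θ‖ ^ 2 * ∫ y, nearFormFactor r y)
          + κ / 4 * ∫ z, formFactor (z.2 0) * ‖ψ z‖ ^ 2)
        + ((4 * κ)⁻¹ * (‖θ‖ ^ 2 * ∫ y, farFormFactorSq r y) + κ * (n + 1) * ‖ψ‖ ^ 2) := by
  have hθnear := (integrable_norm_sq_mul θ hnear).const_mul (κ⁻¹ * (n + 1))
  have hψv := (integrable_comp_consMap (integrable_formFactor_mul_norm_sq hψ)).const_mul (κ / 4)
  have hθfar := (integrable_norm_sq_mul θ (integrable_farFormFactorSq hr)).const_mul (4 * κ)⁻¹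
  have hψsq := (integrable_comp_consMap (integrable_norm_sq ψ)).const_mul (κ * (n + 1))
  rw [← integral_norm_sq ψ, ← integral_comp_consMap, ← integral_comp_consMap,
    ← integral_norm_sq_mul, ← integral_norm_sq_mul, ← integral_const_mul, ← integral_const_mul,
    ← integral_const_mul, ← integral_const_mul, ← integral_add hθnear hψv,
    ← integral_add hθfar hψsq]
  exact integral_add (hθnear.add hψv) (hθfar.add hψsq)

theorem integral_kernelMajorant_le (hκ : 0 < κ) (hnear : Integrable (nearFormFactor r) volume)
    (hr : 0 < r) (hle : ∫ y, nearFormFactor r y ≤ κ ^ 2) (θ : L2 ℓ n) {ψ : L2 ℓ (n + 1)}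
    (hψ : ψ ∈ momentumDomain ℓ (n + 1)) :
    ∫ p, kernelMajorant κ r θ ψ p ≤
      κ * ((n + 1) * ‖θ‖ ^ 2 + kineticEnergy ψ + (n + 1) * ‖ψ‖ ^ 2)
        + (4 * κ)⁻¹ * (∫ y, farFormFactorSq r y) * ‖θ‖ ^ 2 := by
  have hsingular : κ⁻¹ * (n + 1) * (‖θ‖ ^ 2 * ∫ y, nearFormFactor r y) ≤
      κ * ((n + 1) * ‖θ‖ ^ 2) := by
    calc κ⁻¹ * (n + 1) * (‖θ‖ ^ 2 * ∫ y, nearFormFactor r y)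
        ≤ κ⁻¹ * (n + 1) * (‖θ‖ ^ 2 * κ ^ 2) := by gcongr
      _ = κ * ((n + 1) * ‖θ‖ ^ 2) := by field_simp
  have hhardy : κ / 4 * (∫ z, formFactor (z.2 0) * ‖ψ z‖ ^ 2) ≤ κ / 4 * (4 * kineticEnergy ψ) := by
    gcongr
    exact integral_formFactor_mul_norm_sq_le hψ
  rw [integral_kernelMajorant hnear hr κ θ hψ]
  linarith

theorem exists_interaction_bound (hκ : 0 < κ) :
    ∃ C : ℝ, 0 ≤ C ∧ ∀ (n : ℕ) (θ : L2 ℓ n) (ψ : L2 ℓ (n + 1)), ψ ∈ momentumDomain ℓ (n + 1) →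
      Integrable (absKernel θ ψ) volume ∧
      √(n + 1) * ∫ p, absKernel θ ψ p
        ≤ κ * ((n + 1) * ‖θ‖ ^ 2 + kineticEnergy ψ + (n + 1) * ‖ψ‖ ^ 2) + C * ‖θ‖ ^ 2 := by
  obtain ⟨r, hr, hball, hle⟩ := exists_setIntegral_formFactor_ball_le (κ := κ ^ 2) (by positivity)
  have hnear : Integrable (nearFormFactor r) volume :=
    (integrable_indicator_iff measurableSet_ball).mpr hball
  rw [← integral_indicator measurableSet_ball] at hle
  have hfar : 0 ≤ ∫ y, farFormFactorSq r y :=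
    integral_nonneg fun y => Set.indicator_nonneg (fun y _ => sq_nonneg _) y
  refine ⟨(4 * κ)⁻¹ * ∫ y, farFormFactorSq r y, by positivity, fun n θ ψ hψ => ?_⟩
  have hmajorant := integrable_kernelMajorant hnear hr κ θ hψ
  have hone : 1 ≤ √((n : ℝ) + 1) := Real.one_le_sqrt.mpr (by simp)
  have hkernel : Integrable (absKernel θ ψ) volume := by
    refine hmajorant.mono' (aestronglyMeasurable_absKernel θ ψ) (Eventually.of_forall fun p => ?_)
    rw [Real.norm_of_nonneg (absKernel_nonneg θ ψ p)]
    exact (le_mul_of_one_le_left (absKernel_nonneg θ ψ p) hone).trans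
      (sqrt_mul_absKernel_le hκ θ ψ p)
  refine ⟨hkernel, ?_⟩
  rw [← integral_const_mul]
  exact (integral_mono (hkernel.const_mul _) hmajorant (sqrt_mul_absKernel_le hκ θ ψ)).trans
    (integral_kernelMajorant_le hκ hnear hr hle θ hψ)

end FormBound

theorem integrable_kernel (θ : L2 ℓ n) {ψ : L2 ℓ (n + 1)} (hψ : ψ ∈ momentumDomain ℓ (n + 1)) :
    Integrable (kernel θ ψ) volume := by
  obtain ⟨C, -, h⟩ := exists_interaction_bound (ℓ := ℓ) one_pos
  rw [← integrable_norm_iff (aestronglyMeasurable_kernel θ ψ)]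
  simpa only [norm_kernel] using (h n θ ψ hψ).1

theorem norm_pairing_le (θ : L2 ℓ n) (ψ : L2 ℓ (n + 1)) :
    ‖pairing θ ψ‖ ≤
      ∫ p, absKernel θ ψ p := by
  simpa only [norm_kernel, pairing] using norm_integral_le_integral_norm (kernel θ ψ)

theorem integral_conj_mul_annihilate (θ : L2 ℓ n) {ψ : L2 ℓ (n + 1)}
    (hψ : ψ ∈ momentumDomain ℓ (n + 1)) :
    ∫ z, conj (θ z) * annihilate ψ z = √(n + 1) * pairing θ ψ := by
  have hfubini : pairing θ ψ = ∫ z, ∫ y, kernel θ ψ (z, y) :=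
    integral_prod _ (integrable_kernel θ hψ)
  rw [hfubini, ← integral_const_mul]
  refine integral_congr_ae (Eventually.of_forall fun z => ?_)
  simp only [kernel, annihilate, integral_const_mul]
  rw [mul_left_comm]
  rfl

theorem integral_conj_annihilate_mul (θ : L2 ℓ n) {ψ : L2 ℓ (n + 1)}
    (hψ : ψ ∈ momentumDomain ℓ (n + 1)) :
    ∫ z, conj (annihilate ψ z) * θ z = √(n + 1) * conj (pairing θ ψ) := by
  have h := congrArg conj (integral_conj_mul_annihilate θ hψ)
  rw [← integral_conj, map_mul, Complex.conj_ofReal] at h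
  rw [← h]
  refine integral_congr_ae (Eventually.of_forall fun z => ?_)
  simp [mul_comm]

theorem ae_fst {P : Config ℓ n → Prop} (h : ∀ᵐ z, P z) :
    ∀ᵐ p : Config ℓ n × E3, P p.1 :=
  Measure.quasiMeasurePreserving_fst.ae h

theorem ae_consMap {P : Config ℓ (n + 1) → Prop} (h : ∀ᵐ z, P z) :
    ∀ᵐ p, P (consMap p) :=
  measurePreserving_consMap.quasiMeasurePreserving.ae h

theorem pairing_add_left (θ θ' : L2 ℓ n) {ψ : L2 ℓ (n + 1)} (hψ : ψ ∈ momentumDomain ℓ (n + 1)) :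
    pairing (θ + θ') ψ = pairing θ ψ + pairing θ' ψ := by
  rw [pairing, pairing, pairing,
    ← integral_add (integrable_kernel θ hψ) (integrable_kernel θ' hψ)]
  refine integral_congr_ae ?_
  filter_upwards [ae_fst (Lp.coeFn_add θ θ')] with p hp
  simp only [kernel, hp, Pi.add_apply, map_add]
  ring

theorem pairing_smul_left (c : ℂ) (θ : L2 ℓ n) (ψ : L2 ℓ (n + 1)) :
    pairing (c • θ) ψ = conj c * pairing θ ψ := by
  rw [pairing, pairing, ← integral_const_mul]
  refine integral_congr_ae ?_
  filter_upwards [ae_fst (Lp.coeFn_smul c θ)] with p hp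
  simp only [kernel, hp, Pi.smul_apply, smul_eq_mul, map_mul]
  ring

theorem pairing_add_right (θ : L2 ℓ n) {ψ ψ' : L2 ℓ (n + 1)} (hψ : ψ ∈ momentumDomain ℓ (n + 1))
    (hψ' : ψ' ∈ momentumDomain ℓ (n + 1)) :
    pairing θ (ψ + ψ') = pairing θ ψ + pairing θ ψ' := by
  rw [pairing, pairing, pairing,
    ← integral_add (integrable_kernel θ hψ) (integrable_kernel θ hψ')]
  refine integral_congr_ae ?_
  filter_upwards [ae_consMap (Lp.coeFn_add ψ ψ')] with p hp
  simp only [kernel, hp, Pi.add_apply]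
  ring

theorem pairing_smul_right (c : ℂ) (θ : L2 ℓ n) (ψ : L2 ℓ (n + 1)) :
    pairing θ (c • ψ) = c * pairing θ ψ := by
  rw [pairing, pairing, ← integral_const_mul]
  refine integral_congr_ae ?_
  filter_upwards [ae_consMap (Lp.coeFn_smul c ψ)] with p hp
  simp only [kernel, hp, Pi.smul_apply, smul_eq_mul]
  ring

theorem pairing_zero_left (ψ : L2 ℓ (n + 1)) : pairing (0 : L2 ℓ n) ψ = 0 := by
  simpa using pairing_smul_left 0 (0 : L2 ℓ n) ψ

theorem pairing_zero_right (θ : L2 ℓ n) : pairing θ (0 : L2 ℓ (n + 1)) = 0 := by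
  simpa using pairing_smul_right 0 θ (0 : L2 ℓ (n + 1))

end Interaction

/-! ### The quadratic form on the form domain -/

section NormBounds

theorem norm_add_sq_le_two_mul {E : Type*} [SeminormedAddCommGroup E] (x y : E) :
    ‖x + y‖ ^ 2 ≤ 2 * ‖x‖ ^ 2 + 2 * ‖y‖ ^ 2 :=
  calc ‖x + y‖ ^ 2 ≤ (‖x‖ + ‖y‖) ^ 2 := by
        gcongr
        exact norm_add_le x y
    _ ≤ 2 * ‖x‖ ^ 2 + 2 * ‖y‖ ^ 2 := by linarith [add_sq_le (a := ‖x‖) (b := ‖y‖)]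

theorem norm_inner_le_norm_sq_add {E : Type*} [SeminormedAddCommGroup E] [InnerProductSpace ℂ E]
    (x y : E) : ‖inner ℂ x y‖ ≤ ‖x‖ ^ 2 + ‖y‖ ^ 2 :=
  (norm_inner_le_norm x y).trans (by nlinarith [sq_nonneg (‖x‖ - ‖y‖), sq_nonneg (‖x‖ + ‖y‖)])

end NormBounds

section EnergyForm

variable {ℓ : ℝ} [Fact (0 < ℓ)] {n : ℕ}

theorem comp_add (Θ Ψ : Space ℓ) (n : ℕ) : comp (Θ + Ψ) n = comp Θ n + comp Ψ n := rfl

theorem comp_smul (c : ℂ) (Ψ : Space ℓ) (n : ℕ) : comp (c • Ψ) n = c • comp Ψ n := rfl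

theorem comp_neg (Ψ : Space ℓ) (n : ℕ) : comp (-Ψ) n = -comp Ψ n := rfl

theorem comp_sub (Θ Ψ : Space ℓ) (n : ℕ) : comp (Θ - Ψ) n = comp Θ n - comp Ψ n := rfl

theorem comp_zero (n : ℕ) : comp (0 : Space ℓ) n = 0 := rfl

theorem space_ext {Θ Ψ : Space ℓ} (h : ∀ n, comp Θ n = comp Ψ n) : Θ = Ψ :=
  lp.ext (funext fun n => Subtype.ext (h n))

theorem summable_norm_sq_comp (Ψ : Space ℓ) : Summable (fun n => ‖comp Ψ n‖ ^ 2) := by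
  have h := (lp.memℓp Ψ).summable (by simp)
  simpa [comp] using h

theorem hasSum_inner_comp (Θ Ψ : Space ℓ) :
    HasSum (fun n => inner ℂ (comp Θ n) (comp Ψ n)) (inner ℂ Θ Ψ) :=
  lp.hasSum_inner Θ Ψ

theorem hasSum_norm_sq_comp (Ψ : Space ℓ) : HasSum (fun n => ‖comp Ψ n‖ ^ 2) (‖Ψ‖ ^ 2) := by
  have h := lp.hasSum_norm (p := 2) (by simp) Ψ
  simpa [comp] using h

theorem kineticEnergy_add_le {f g : L2 ℓ n} (hf : f ∈ momentumDomain ℓ n)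
    (hg : g ∈ momentumDomain ℓ n) :
    kineticEnergy (f + g) ≤ 2 * kineticEnergy f + 2 * kineticEnergy g := by
  rw [kineticEnergy, kineticEnergy, kineticEnergy, Finset.mul_sum, Finset.mul_sum,
    ← Finset.sum_add_distrib]
  refine Finset.sum_le_sum fun j _ => ?_
  rw [weakRelDeriv_add hf hg]
  exact norm_add_sq_le_two_mul _ _

theorem kineticEnergy_smul {f : L2 ℓ n} (hf : f ∈ momentumDomain ℓ n) (c : ℂ) :
    kineticEnergy (c • f) = ‖c‖ ^ 2 * kineticEnergy f := by
  rw [kineticEnergy, kineticEnergy, Finset.mul_sum]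
  refine Finset.sum_congr rfl fun j _ => ?_
  rw [weakRelDeriv_smul hf, norm_smul, mul_pow]

theorem kineticEnergy_zero : kineticEnergy (0 : L2 ℓ n) = 0 := by
  simp [kineticEnergy, weakRelDeriv_zero]

theorem norm_kinetic_le (f g : L2 ℓ n) : ‖kinetic f g‖ ≤ kineticEnergy f + kineticEnergy g := by
  rw [kinetic, kineticEnergy, kineticEnergy, ← Finset.sum_add_distrib]
  exact (norm_sum_le _ _).trans (Finset.sum_le_sum fun j _ => norm_inner_le_norm_sq_add _ _)

theorem kinetic_add_right (f : L2 ℓ n) {g g' : L2 ℓ n} (hg : g ∈ momentumDomain ℓ n)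
    (hg' : g' ∈ momentumDomain ℓ n) : kinetic f (g + g') = kinetic f g + kinetic f g' := by
  simp only [kinetic, weakRelDeriv_add hg hg', inner_add_right, Finset.sum_add_distrib]

theorem kinetic_sub_right (f : L2 ℓ n) {g g' : L2 ℓ n} (hg : g ∈ momentumDomain ℓ n)
    (hg' : g' ∈ momentumDomain ℓ n) : kinetic f (g - g') = kinetic f g - kinetic f g' := by
  simp only [kinetic, weakRelDeriv_sub hg hg', inner_sub_right, Finset.sum_sub_distrib]

theorem kinetic_smul_right (c : ℂ) (f : L2 ℓ n) {g : L2 ℓ n} (hg : g ∈ momentumDomain ℓ n) :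
    kinetic f (c • g) = c * kinetic f g := by
  simp only [kinetic, weakRelDeriv_smul hg, inner_smul_right, Finset.mul_sum]

theorem kinetic_conj_symm (f g : L2 ℓ n) : conj (kinetic g f) = kinetic f g := by
  simp only [kinetic, map_sum, inner_conj_symm]

theorem kinetic_zero_left (f : L2 ℓ n) : kinetic 0 f = 0 := by
  simp [kinetic, weakRelDeriv_zero]

/-- The expectation of the non-interacting energy in the `n`-phonon sector. -/
def freeEnergy (Ψ : Space ℓ) (n : ℕ) : ℝ := kineticEnergy (comp Ψ n) + n * ‖comp Ψ n‖ ^ 2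

theorem freeEnergy_nonneg (Ψ : Space ℓ) (n : ℕ) : 0 ≤ freeEnergy Ψ n :=
  add_nonneg (kineticEnergy_nonneg _) (by positivity)

theorem mem_formDomain_iff {Ψ : Space ℓ} : Ψ ∈ formDomain ℓ ↔
    (∀ n, comp Ψ n ∈ momentumDomain ℓ n) ∧ Summable (freeEnergy Ψ) := by
  simp only [formDomain, norm_relMomentum]
  rfl

theorem freeEnergy_add_le {Ψ Φ : Space ℓ} (hΨ : comp Ψ n ∈ momentumDomain ℓ n)
    (hΦ : comp Φ n ∈ momentumDomain ℓ n) :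
    freeEnergy (Ψ + Φ) n ≤ 2 * freeEnergy Ψ n + 2 * freeEnergy Φ n := by
  have hnumber := mul_le_mul_of_nonneg_left
    (norm_add_sq_le_two_mul (comp Ψ n) (comp Φ n)) n.cast_nonneg
  rw [freeEnergy, freeEnergy, freeEnergy, comp_add]
  linarith [kineticEnergy_add_le hΨ hΦ]

theorem freeEnergy_smul {Ψ : Space ℓ} (hΨ : comp Ψ n ∈ momentumDomain ℓ n) (c : ℂ) :
    freeEnergy (c • Ψ) n = ‖c‖ ^ 2 * freeEnergy Ψ n := by
  rw [freeEnergy, freeEnergy, comp_smul, kineticEnergy_smul hΨ, norm_smul]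
  ring

variable (ℓ) in
/-- The form domain as a subspace. -/
def formSubmodule : Submodule ℂ (Space ℓ) where
  carrier := formDomain ℓ
  zero_mem' := by
    refine mem_formDomain_iff.mpr ⟨fun n => (momentumDomain ℓ n).zero_mem, ?_⟩
    refine summable_zero.congr fun n => ?_
    simp [freeEnergy, comp_zero, kineticEnergy_zero]
  add_mem' := by
    intro Ψ Φ hΨ hΦ
    rw [mem_formDomain_iff] at hΨ hΦ ⊢
    exact ⟨fun n => (momentumDomain ℓ n).add_mem (hΨ.1 n) (hΦ.1 n),
      Summable.of_nonneg_of_le (freeEnergy_nonneg _)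
        (fun n => freeEnergy_add_le (hΨ.1 n) (hΦ.1 n))
        ((hΨ.2.mul_left 2).add (hΦ.2.mul_left 2))⟩
  smul_mem' := by
    intro c Ψ hΨ
    rw [mem_formDomain_iff] at hΨ ⊢
    exact ⟨fun n => (momentumDomain ℓ n).smul_mem c (hΨ.1 n),
      (hΨ.2.mul_left (‖c‖ ^ 2)).congr fun n => (freeEnergy_smul (hΨ.1 n) c).symm⟩

theorem mem_formSubmodule {Ψ : Space ℓ} : Ψ ∈ formSubmodule ℓ ↔
    (∀ n, comp Ψ n ∈ momentumDomain ℓ n) ∧ Summable (freeEnergy Ψ) :=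
  mem_formDomain_iff

/-- The contribution of the `n`-phonon sector to the non-interacting form. -/
def freeTerm (Θ Ψ : Space ℓ) (n : ℕ) : ℂ :=
  kinetic (comp Θ n) (comp Ψ n) + n * inner ℂ (comp Θ n) (comp Ψ n)

/-- The coupling of the `n`- and the `(n+1)`-phonon sectors. -/
def interactionTerm (Θ Ψ : Space ℓ) (n : ℕ) : ℂ :=
  √(n + 1) * pairing (comp Θ n) (comp Ψ (n + 1))
    + √(n + 1) * conj (pairing (comp Ψ n) (comp Θ (n + 1)))

theorem re_freeTerm_self (Ψ : Space ℓ) (n : ℕ) : (freeTerm Ψ Ψ n).re = freeEnergy Ψ n := by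
  rw [freeTerm, freeEnergy, kinetic_self, inner_self_eq_norm_sq_to_K, Complex.add_re,
    ← Complex.ofReal_natCast, Complex.re_ofReal_mul]
  norm_cast

theorem re_interactionTerm_self (Ψ : Space ℓ) (n : ℕ) : (interactionTerm Ψ Ψ n).re =
    2 * (√(n + 1) * (pairing (comp Ψ n) (comp Ψ (n + 1))).re) := by
  rw [interactionTerm, Complex.add_re, Complex.re_ofReal_mul, Complex.re_ofReal_mul,
    Complex.conj_re, two_mul]

theorem freeForm_eq (Θ Ψ : Space ℓ) : freeForm ℓ Θ Ψ = ∑' n, freeTerm Θ Ψ n := by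
  simp only [freeForm, inner_relMomentum]
  rfl

theorem interactionForm_eq {Θ Ψ : Space ℓ} (hΘ : Θ ∈ formSubmodule ℓ) (hΨ : Ψ ∈ formSubmodule ℓ) :
    interactionForm ℓ Θ Ψ = ∑' n, interactionTerm Θ Ψ n := by
  refine tsum_congr fun n => ?_
  rw [integral_conj_mul_annihilate _ ((mem_formSubmodule.mp hΨ).1 (n + 1)),
    integral_conj_annihilate_mul _ ((mem_formSubmodule.mp hΘ).1 (n + 1))]
  rfl

theorem summable_freeTerm {Θ Ψ : Space ℓ} (hΘ : Θ ∈ formSubmodule ℓ) (hΨ : Ψ ∈ formSubmodule ℓ) :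
    Summable (freeTerm Θ Ψ) := by
  refine Summable.of_norm_bounded
    ((mem_formSubmodule.mp hΘ).2.add (mem_formSubmodule.mp hΨ).2) fun n => ?_
  have hinner := mul_le_mul_of_nonneg_left
    (norm_inner_le_norm_sq_add (comp Θ n) (comp Ψ n)) n.cast_nonneg
  refine (norm_add_le _ _).trans ?_
  rw [norm_mul, Complex.norm_natCast, freeEnergy, freeEnergy]
  linarith [norm_kinetic_le (comp Θ n) (comp Ψ n)]

theorem exists_sqrt_mul_norm_pairing_le {κ : ℝ} (hκ : 0 < κ) :
    ∃ C : ℝ, ∀ (n : ℕ) (Θ Ψ : Space ℓ), comp Ψ (n + 1) ∈ momentumDomain ℓ (n + 1) →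
      √(n + 1) * ‖pairing (comp Θ n) (comp Ψ (n + 1))‖ ≤
        κ * (freeEnergy Θ n + freeEnergy Ψ (n + 1)) + C * ‖comp Θ n‖ ^ 2 := by
  obtain ⟨C, -, hC⟩ := exists_interaction_bound (ℓ := ℓ) hκ
  refine ⟨C + κ, fun n Θ Ψ hΨ => ?_⟩
  calc √(n + 1) * ‖pairing (comp Θ n) (comp Ψ (n + 1))‖
      ≤ √(n + 1) * ∫ p, absKernel (comp Θ n) (comp Ψ (n + 1)) p := by
        gcongr
        exact norm_pairing_le _ _
    _ ≤ _ := (hC n (comp Θ n) (comp Ψ (n + 1)) hΨ).2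
    _ ≤ _ := by
        have hkinetic := mul_nonneg hκ.le (kineticEnergy_nonneg (comp Θ n))
        rw [freeEnergy, freeEnergy]
        push_cast
        linarith

theorem summable_sqrt_mul_pairing {Θ Ψ : Space ℓ} (hΘ : Θ ∈ formSubmodule ℓ)
    (hΨ : Ψ ∈ formSubmodule ℓ) :
    Summable (fun n : ℕ => (√(n + 1) : ℂ) * pairing (comp Θ n) (comp Ψ (n + 1))) := by
  obtain ⟨C, hC⟩ := exists_sqrt_mul_norm_pairing_le (ℓ := ℓ) one_pos
  obtain ⟨hΨdom, hΨsum⟩ := mem_formSubmodule.mp hΨ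
  refine Summable.of_norm_bounded ((((mem_formSubmodule.mp hΘ).2.add
    ((summable_nat_add_iff 1).mpr hΨsum)).mul_left 1).add
    ((summable_norm_sq_comp Θ).mul_left C)) fun n => ?_
  rw [norm_mul, Complex.norm_real, Real.norm_of_nonneg (Real.sqrt_nonneg _)]
  exact hC n Θ Ψ (hΨdom (n + 1))

theorem summable_interactionTerm {Θ Ψ : Space ℓ} (hΘ : Θ ∈ formSubmodule ℓ)
    (hΨ : Ψ ∈ formSubmodule ℓ) : Summable (interactionTerm Θ Ψ) := by
  refine (summable_sqrt_mul_pairing hΘ hΨ).add ?_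
  refine (Complex.summable_conj.mpr (summable_sqrt_mul_pairing hΨ hΘ)).congr fun n => ?_
  rw [map_mul, Complex.conj_ofReal]

variable (ℓ) in
/-- The form of `(-i∇_x - P_f)² + N + g φ(v)`. -/
def energyForm (g : ℝ) (Θ Ψ : Space ℓ) : ℂ := freeForm ℓ Θ Ψ + g * interactionForm ℓ Θ Ψ

theorem hasSum_energyForm (g : ℝ) {Θ Ψ : Space ℓ} (hΘ : Θ ∈ formSubmodule ℓ)
    (hΨ : Ψ ∈ formSubmodule ℓ) :
    HasSum (fun n => freeTerm Θ Ψ n + g * interactionTerm Θ Ψ n) (energyForm ℓ g Θ Ψ) := by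
  rw [energyForm, freeForm_eq, interactionForm_eq hΘ hΨ]
  exact (summable_freeTerm hΘ hΨ).hasSum.add ((summable_interactionTerm hΘ hΨ).hasSum.mul_left _)

theorem isHermitianFormOn_energyForm (g : ℝ) :
    IsHermitianFormOn (formSubmodule ℓ) (energyForm ℓ g) where
  add_right := by
    intro Θ Ψ Ψ' hΘ hΨ hΨ'
    refine (hasSum_energyForm g hΘ ((formSubmodule ℓ).add_mem hΨ hΨ')).unique ?_
    refine ((hasSum_energyForm g hΘ hΨ).add (hasSum_energyForm g hΘ hΨ')).congr_fun fun n => ?_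
    have hΘdom := (mem_formSubmodule.mp hΘ).1
    have hΨdom := (mem_formSubmodule.mp hΨ).1
    have hΨdom' := (mem_formSubmodule.mp hΨ').1
    simp only [freeTerm, interactionTerm, comp_add, kinetic_add_right _ (hΨdom n) (hΨdom' n),
      inner_add_right, pairing_add_right _ (hΨdom (n + 1)) (hΨdom' (n + 1)),
      pairing_add_left _ _ (hΘdom (n + 1)), map_add]
    ring
  smul_right := by
    intro Θ Ψ c hΘ hΨ
    refine (hasSum_energyForm g hΘ ((formSubmodule ℓ).smul_mem c hΨ)).unique ?_
    refine ((hasSum_energyForm g hΘ hΨ).mul_left c).congr_fun fun n => ?_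
    simp only [freeTerm, interactionTerm, comp_smul,
      kinetic_smul_right c _ ((mem_formSubmodule.mp hΨ).1 n),
      inner_smul_right, pairing_smul_right, pairing_smul_left, map_mul, Complex.conj_conj]
    ring
  conj_symm := by
    intro Θ Ψ hΘ hΨ
    refine HasSum.unique ?_ (hasSum_energyForm g hΘ hΨ)
    refine (Complex.hasSum_conj'.mpr (hasSum_energyForm g hΨ hΘ)).congr_fun fun n => ?_
    simp only [freeTerm, interactionTerm, map_add, map_mul, Complex.conj_ofReal,
      Complex.conj_conj, kinetic_conj_symm, inner_conj_symm, map_natCast]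
    ring

theorem exists_le_re_energyTerm (g : ℝ) :
    ∃ C : ℝ, ∀ Ψ ∈ formSubmodule ℓ, ∀ n,
      freeEnergy Ψ n - (2⁻¹ * freeEnergy Ψ n + 2⁻¹ * freeEnergy Ψ (n + 1) + C * ‖comp Ψ n‖ ^ 2)
        ≤ (freeTerm Ψ Ψ n + g * interactionTerm Ψ Ψ n).re := by
  obtain ⟨C, hC⟩ := exists_sqrt_mul_norm_pairing_le (ℓ := ℓ) (κ := (4 * (|g| + 1))⁻¹)
    (by positivity)
  refine ⟨2 * |g| * C, fun Ψ hΨ n => ?_⟩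
  set P := pairing (comp Ψ n) (comp Ψ (n + 1)) with hP
  have habs : |g * (2 * (√(n + 1) * P.re))| ≤ 2 * |g| * (√(n + 1) * ‖P‖) := by
    rw [abs_mul, abs_mul, abs_mul, abs_of_nonneg (Real.sqrt_nonneg _), abs_two, mul_left_comm,
      ← mul_assoc]
    gcongr
    exact Complex.abs_re_le_norm P
  have hbound := mul_le_mul_of_nonneg_left (hC n Ψ Ψ ((mem_formSubmodule.mp hΨ).1 (n + 1)))
    (by positivity : 0 ≤ 2 * |g|)
  have hhalf : 2 * |g| * (4 * (|g| + 1))⁻¹ ≤ 2⁻¹ := by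
    rw [← div_eq_mul_inv, div_le_iff₀ (by positivity)]
    linarith [abs_nonneg g]
  have henergy := mul_le_mul_of_nonneg_right hhalf
    (add_nonneg (freeEnergy_nonneg Ψ n) (freeEnergy_nonneg Ψ (n + 1)))
  rw [Complex.add_re, Complex.re_ofReal_mul, re_interactionTerm_self, re_freeTerm_self, ← hP]
  linarith [neg_abs_le (g * (2 * (√(n + 1) * P.re)))]

theorem exists_energyForm_lower_bound (g : ℝ) :
    ∃ C : ℝ, ∀ Ψ ∈ formSubmodule ℓ, -C * ‖Ψ‖ ^ 2 ≤ (energyForm ℓ g Ψ Ψ).re := by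
  obtain ⟨C, hC⟩ := exists_le_re_energyTerm (ℓ := ℓ) g
  refine ⟨C, fun Ψ hΨ => ?_⟩
  have hsum := (mem_formSubmodule.mp hΨ).2
  have hshifted : Summable fun n => freeEnergy Ψ (n + 1) := (summable_nat_add_iff 1).mpr hsum
  have hle := hasSum_le (hC Ψ hΨ)
    (hsum.hasSum.sub (((hsum.hasSum.mul_left 2⁻¹).add (hshifted.hasSum.mul_left 2⁻¹)).add
      ((hasSum_norm_sq_comp Ψ).mul_left C)))
    (Complex.hasSum_re (hasSum_energyForm g hΨ hΨ))
  rw [hsum.tsum_eq_zero_add] at hle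
  linarith [freeEnergy_nonneg Ψ 0]

end EnergyForm

/-! ### Positivity and complex conjugation in `L²` -/

section Positivity

variable {X : Type*} [MeasurableSpace X] {μ : Measure X}

/-- The function `f` takes nonnegative real values almost everywhere. -/
def IsNonneg (f : Lp ℂ 2 μ) : Prop := ∀ᵐ z ∂μ, f z = (‖f z‖ : ℂ)

theorem isNonneg_of_ae_eq_ofReal {f : Lp ℂ 2 μ} {r : X → ℝ} (hr : ∀ z, 0 ≤ r z)
    (hf : ∀ᵐ z ∂μ, f z = r z) : IsNonneg f := by
  filter_upwards [hf] with z hz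
  rw [hz, Complex.norm_of_nonneg (hr z)]

theorem IsNonneg.inner_eq {f g : Lp ℂ 2 μ} (hf : IsNonneg f) (hg : IsNonneg g) :
    inner ℂ f g = ((∫ z, ‖f z‖ * ‖g z‖ ∂μ : ℝ) : ℂ) := by
  rw [L2.inner_def, ← integral_complex_ofReal]
  refine integral_congr_ae ?_
  filter_upwards [hf, hg] with z hfz hgz
  rw [RCLike.inner_apply, hfz, hgz]
  simp [mul_comm]

theorem IsNonneg.re_inner_nonneg {f g : Lp ℂ 2 μ} (hf : IsNonneg f) (hg : IsNonneg g) :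
    0 ≤ (inner ℂ f g).re := by
  rw [hf.inner_eq hg, Complex.ofReal_re]
  exact integral_nonneg fun z => by positivity

theorem inner_eq_zero_of_ae_mul_eq_zero {f g : Lp ℂ 2 μ} (h : ∀ᵐ z ∂μ, f z * g z = 0) :
    inner ℂ f g = 0 := by
  rw [L2.inner_def]
  refine integral_eq_zero_of_ae ?_
  filter_upwards [h] with z hz
  rw [RCLike.inner_apply]
  rcases mul_eq_zero.mp hz with h | h <;> simp [h]

/-- Complex conjugation as a continuous real-linear map. -/
def starL : Lp ℂ 2 μ →L[ℝ] Lp ℂ 2 μ := (Complex.conjCLE : ℂ →L[ℝ] ℂ).compLpL 2 μ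

theorem starL_apply (f : Lp ℂ 2 μ) : starL f = star f := by
  apply Lp.ext
  filter_upwards [(Complex.conjCLE : ℂ →L[ℝ] ℂ).coeFn_compLpL f, Lp.coeFn_star f] with z hz hstar
  rw [starL, hz, hstar]
  rfl

theorem star_add_L2 (f g : Lp ℂ 2 μ) : star (f + g) = star f + star g := by
  simp only [← starL_apply, map_add]

theorem star_smul_L2 (c : ℂ) (f : Lp ℂ 2 μ) : star (c • f) = conj c • star f := by
  apply Lp.ext
  filter_upwards [Lp.coeFn_star (c • f), Lp.coeFn_star f, Lp.coeFn_smul c f,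
    Lp.coeFn_smul (conj c) (star f)] with z hstar_smul hstar hsmul hsmul_star
  simp [hstar_smul, hsmul_star, hsmul, hstar]

theorem inner_star_star (f g : Lp ℂ 2 μ) : inner ℂ (star f) (star g) = conj (inner ℂ f g) := by
  rw [L2.inner_def, L2.inner_def, ← integral_conj]
  refine integral_congr_ae ?_
  filter_upwards [Lp.coeFn_star f, Lp.coeFn_star g] with z hfz hgz
  rw [hfz, hgz, RCLike.inner_apply, RCLike.inner_apply]
  simp

end Positivity

section KineticPositivity

variable {ℓ : ℝ} [Fact (0 < ℓ)] {n : ℕ}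

theorem ae_flow {P : ℂ → Prop} {f : L2 ℓ n} (h : ∀ᵐ z, P (f z)) (j : Fin 3) (s : ℝ) :
    ∀ᵐ z, P (flow j s f z) := by
  filter_upwards [coeFn_flow j s f,
    (measurePreserving_shift (s • EuclideanSpace.single j (1 : ℝ))).quasiMeasurePreserving.ae h]
    with z hz hP
  rwa [hz]

theorem IsNonneg.flow {f : L2 ℓ n} (hf : IsNonneg f) (j : Fin 3) (s : ℝ) :
    IsNonneg (flow j s f) :=
  ae_flow (P := fun w => w = (‖w‖ : ℂ)) hf j s

/-- The right-hand side expands to `-⟨U f, g⟩ - ⟨f, U g⟩`, as `⟨f, g⟩ = ⟨U f, U g⟩ = 0`. -/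
theorem IsNonneg.re_inner_flow_sub_nonpos {f g : L2 ℓ n} (hf : IsNonneg f) (hg : IsNonneg g)
    (h : ∀ᵐ z, f z * g z = 0) (j : Fin 3) (s : ℝ) :
    (inner ℂ (Polaron.flow j s f - f) (Polaron.flow j s g - g)).re ≤ 0 := by
  have hexpand : inner ℂ (Polaron.flow j s f - f) (Polaron.flow j s g - g) =
      -(inner ℂ (Polaron.flow j s f) g) - inner ℂ f (Polaron.flow j s g) := by
    rw [inner_sub_left, inner_sub_right, inner_sub_right, LinearIsometry.inner_map_map,
      inner_eq_zero_of_ae_mul_eq_zero h]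
    ring
  rw [hexpand, Complex.sub_re, Complex.neg_re]
  linarith [(hf.flow j s).re_inner_nonneg hg, hf.re_inner_nonneg (hg.flow j s)]

theorem IsNonneg.re_kinetic_nonpos {f g : L2 ℓ n} (hf : IsNonneg f) (hg : IsNonneg g)
    (hfd : f ∈ momentumDomain ℓ n) (hgd : g ∈ momentumDomain ℓ n)
    (h : ∀ᵐ z, f z * g z = 0) : (kinetic f g).re ≤ 0 := by
  have hslope : ∀ {f : L2 ℓ n}, f ∈ momentumDomain ℓ n → ∀ j,
      Tendsto (fun s : ℝ => ((s⁻¹ : ℝ) : ℂ) • (Polaron.flow j s f - f)) (𝓝[≠] 0)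
        (𝓝 (weakRelDeriv j f)) := by
    intro f hf j
    have hderiv := isWeakRelDeriv_iff_hasDerivAt.mp (isWeakRelDeriv_weakRelDeriv hf j)
    refine (hasDerivAt_iff_tendsto_slope_zero.mp hderiv).congr fun s => ?_
    rw [zero_add, (isUnitaryGroup_flow j).zero_apply]
    exact (Complex.coe_smul _ _).symm
  rw [kinetic, Complex.re_sum]
  refine Finset.sum_nonpos fun j _ => ?_
  refine le_of_tendsto ((Complex.continuous_re.tendsto _).comp
    ((hslope hfd j).inner (𝕜 := ℂ) (hslope hgd j))) (Eventually.of_forall fun s => ?_)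
  rw [Function.comp_apply, inner_smul_left, inner_smul_right, Complex.conj_ofReal,
    Complex.re_ofReal_mul, Complex.re_ofReal_mul, ← mul_assoc]
  exact mul_nonpos_of_nonneg_of_nonpos (mul_self_nonneg _)
    (hf.re_inner_flow_sub_nonpos hg h j s)

theorem IsNonneg.pairing_eq {θ : L2 ℓ n} {ψ : L2 ℓ (n + 1)} (hθ : IsNonneg θ) (hψ : IsNonneg ψ) :
    pairing θ ψ = ((∫ p : Config ℓ n × E3, absKernel θ ψ p : ℝ) : ℂ) := by
  rw [pairing, ← integral_complex_ofReal]
  refine integral_congr_ae ?_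
  filter_upwards [ae_fst hθ, ae_consMap hψ] with p hθp hψp
  rw [kernel, absKernel, hθp, hψp]
  simp

theorem IsNonneg.re_pairing_nonneg {θ : L2 ℓ n} {ψ : L2 ℓ (n + 1)} (hθ : IsNonneg θ)
    (hψ : IsNonneg ψ) : 0 ≤ (pairing θ ψ).re := by
  rw [hθ.pairing_eq hψ, Complex.ofReal_re]
  exact integral_nonneg fun p => absKernel_nonneg θ ψ p

theorem flow_star (j : Fin 3) (s : ℝ) (f : L2 ℓ n) : flow j s (star f) = star (flow j s f) := by
  apply Lp.ext
  filter_upwards [coeFn_flow j s (star f), coeFn_flow j s f, Lp.coeFn_star (flow j s f),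
    (measurePreserving_shift (s • EuclideanSpace.single j (1 : ℝ))).quasiMeasurePreserving.ae_eq
      (Lp.coeFn_star f)] with z hflow_star hflow hstar_flow hstar
  rw [hflow_star, hstar_flow, Pi.star_apply, hflow]
  exact hstar

theorem IsWeakRelDeriv.star {j : Fin 3} {f g : L2 ℓ n} (h : IsWeakRelDeriv j f g) :
    IsWeakRelDeriv j (star f) (star g) := by
  rw [isWeakRelDeriv_iff_hasDerivAt] at h ⊢
  simp only [flow_star]
  simp only [← starL_apply]
  exact starL.hasFDerivAt.comp_hasDerivAt (0 : ℝ) h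

theorem weakRelDeriv_star {f : L2 ℓ n} (hf : f ∈ momentumDomain ℓ n) (j : Fin 3) :
    weakRelDeriv j (star f) = star (weakRelDeriv j f) :=
  (isWeakRelDeriv_weakRelDeriv hf j).star.weakRelDeriv_eq

theorem kinetic_star_star {f g : L2 ℓ n} (hf : f ∈ momentumDomain ℓ n)
    (hg : g ∈ momentumDomain ℓ n) : kinetic (star f) (star g) = conj (kinetic f g) := by
  simp only [kinetic, weakRelDeriv_star hf, weakRelDeriv_star hg, inner_star_star, map_sum]

theorem pairing_star_star (θ : L2 ℓ n) (ψ : L2 ℓ (n + 1)) :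
    pairing (star θ) (star ψ) = conj (pairing θ ψ) := by
  rw [pairing, pairing, ← integral_conj]
  refine integral_congr_ae ?_
  filter_upwards [ae_fst (Lp.coeFn_star θ), ae_consMap (Lp.coeFn_star ψ)] with p hθp hψp
  rw [kernel, kernel, hθp, hψp]
  simp

end KineticPositivity

/-! ### Operations on states -/

section Operations

variable {ℓ : ℝ} [Fact (0 < ℓ)] {n : ℕ}

section CompSpace

variable {F : ℂ → ℂ} {c : ℝ≥0} (hF : LipschitzWith c F) (hF0 : F 0 = 0)

theorem compLp_mem_sector {f : L2 ℓ n} (hf : f ∈ sector ℓ n) : hF.compLp hF0 f ∈ sector ℓ n :=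
  fun σ => by rw [compMeasurePreserving_compLp (measurePreserving_permute ℓ σ) hF hF0 f, hf σ]

theorem norm_sq_compLp_le (f : L2 ℓ n) : ‖hF.compLp hF0 f‖ ^ 2 ≤ c ^ 2 * ‖f‖ ^ 2 := by
  rw [← mul_pow]
  gcongr
  exact hF.norm_compLp_le hF0 f

theorem kineticEnergy_compLp_le {f : L2 ℓ n} (hf : f ∈ momentumDomain ℓ n) :
    kineticEnergy (hF.compLp hF0 f) ≤ c ^ 2 * kineticEnergy f := by
  rw [kineticEnergy, kineticEnergy, Finset.mul_sum]
  refine Finset.sum_le_sum fun j _ => ?_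
  rw [← mul_pow]
  gcongr
  exact norm_weakRelDeriv_compLp_le hF hF0 hf j

/-- The state with the components `F ∘ Ψ⁽ⁿ⁾`. -/
def compSpace (Ψ : Space ℓ) : Space ℓ :=
  ⟨fun n => ⟨hF.compLp hF0 (comp Ψ n), compLp_mem_sector hF hF0 (Ψ n).2⟩, by
    refine memℓp_gen ?_
    simpa using Summable.of_nonneg_of_le (fun n => by positivity)
      (fun n => norm_sq_compLp_le hF hF0 (comp Ψ n)) ((summable_norm_sq_comp Ψ).mul_left _)⟩

theorem comp_compSpace (Ψ : Space ℓ) (n : ℕ) :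
    comp (compSpace hF hF0 Ψ) n = hF.compLp hF0 (comp Ψ n) := rfl

theorem compSpace_mem_formSubmodule {Ψ : Space ℓ} (hΨ : Ψ ∈ formSubmodule ℓ) :
    compSpace hF hF0 Ψ ∈ formSubmodule ℓ := by
  rw [mem_formSubmodule] at hΨ ⊢
  refine ⟨fun n => compLp_mem_momentumDomain hF hF0 (hΨ.1 n),
    Summable.of_nonneg_of_le (freeEnergy_nonneg _) (fun n => ?_) (hΨ.2.mul_left ((c : ℝ) ^ 2))⟩
  calc freeEnergy (compSpace hF hF0 Ψ) n
      ≤ c ^ 2 * kineticEnergy (comp Ψ n) + n * (c ^ 2 * ‖comp Ψ n‖ ^ 2) := by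
        rw [freeEnergy, comp_compSpace]
        gcongr
        · exact kineticEnergy_compLp_le hF hF0 (hΨ.1 n)
        · exact norm_sq_compLp_le hF hF0 _
    _ = c ^ 2 * freeEnergy Ψ n := by rw [freeEnergy]; ring

end CompSpace

section Conjugation

theorem lipschitzWith_conj : LipschitzWith 1 (fun z : ℂ => conj z) :=
  Complex.isometry_conj.lipschitz

/-- The complex conjugate of a state. -/
def conjSpace (Ψ : Space ℓ) : Space ℓ := compSpace lipschitzWith_conj (map_zero _) Ψ

theorem comp_conjSpace (Ψ : Space ℓ) (n : ℕ) : comp (conjSpace Ψ) n = star (comp Ψ n) := by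
  apply Lp.ext
  filter_upwards [lipschitzWith_conj.coeFn_compLp (map_zero _) (comp Ψ n),
    Lp.coeFn_star (comp Ψ n)] with z hz hstar
  rw [conjSpace, comp_compSpace, hz, hstar]
  rfl

theorem conjSpace_mem_formSubmodule {Ψ : Space ℓ} (hΨ : Ψ ∈ formSubmodule ℓ) :
    conjSpace Ψ ∈ formSubmodule ℓ :=
  compSpace_mem_formSubmodule _ _ hΨ

theorem conjSpace_add (Θ Ψ : Space ℓ) : conjSpace (Θ + Ψ) = conjSpace Θ + conjSpace Ψ :=
  space_ext fun n => by simp only [comp_conjSpace, comp_add, star_add_L2]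

theorem conjSpace_smul (c : ℂ) (Ψ : Space ℓ) : conjSpace (c • Ψ) = conj c • conjSpace Ψ :=
  space_ext fun n => by simp only [comp_conjSpace, comp_smul, star_smul_L2]

theorem conjSpace_conjSpace (Ψ : Space ℓ) : conjSpace (conjSpace Ψ) = Ψ :=
  space_ext fun n => by simp only [comp_conjSpace, star_star]

theorem inner_conjSpace (Θ Ψ : Space ℓ) :
    inner ℂ (conjSpace Θ) (conjSpace Ψ) = conj (inner ℂ Θ Ψ) := by
  refine (hasSum_inner_comp (conjSpace Θ) (conjSpace Ψ)).unique ?_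
  refine (Complex.hasSum_conj'.mpr (hasSum_inner_comp Θ Ψ)).congr_fun fun n => ?_
  rw [comp_conjSpace, comp_conjSpace, inner_star_star]

theorem energyForm_conjSpace (g : ℝ) {Θ Ψ : Space ℓ} (hΘ : Θ ∈ formSubmodule ℓ)
    (hΨ : Ψ ∈ formSubmodule ℓ) :
    energyForm ℓ g (conjSpace Θ) (conjSpace Ψ) = conj (energyForm ℓ g Θ Ψ) := by
  refine (hasSum_energyForm g (conjSpace_mem_formSubmodule hΘ)
    (conjSpace_mem_formSubmodule hΨ)).unique ?_
  refine (Complex.hasSum_conj'.mpr (hasSum_energyForm g hΘ hΨ)).congr_fun fun n => ?_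
  simp only [freeTerm, interactionTerm, comp_conjSpace, inner_star_star, pairing_star_star,
    kinetic_star_star ((mem_formSubmodule.mp hΘ).1 n) ((mem_formSubmodule.mp hΨ).1 n),
    map_add, map_mul, Complex.conj_ofReal, map_natCast]

end Conjugation

section Parity

theorem conj_neg_one_pow_mul (n : ℕ) : conj ((-1 : ℂ) ^ n) * (-1) ^ n = 1 := by
  rw [map_pow, map_neg, map_one, ← mul_pow]
  simp

theorem inner_neg_one_pow_smul {H : Type*} [SeminormedAddCommGroup H] [InnerProductSpace ℂ H]
    (n : ℕ) (x y : H) : inner ℂ ((-1 : ℂ) ^ n • x) ((-1 : ℂ) ^ n • y) = inner ℂ x y := by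
  rw [inner_smul_left, inner_smul_right, ← mul_assoc, conj_neg_one_pow_mul, one_mul]

theorem memℓp_neg_one_pow_smul (Ψ : Space ℓ) :
    Memℓp (fun n => (-1 : ℂ) ^ n • Ψ n : ∀ n, sector ℓ n) 2 := by
  refine memℓp_gen ((summable_norm_sq_comp Ψ).congr fun n => ?_)
  simp [norm_smul, comp]

/-- `(-1)^N` as a linear map. -/
def parityₗ : Space ℓ →ₗ[ℂ] Space ℓ where
  toFun Ψ := ⟨_, memℓp_neg_one_pow_smul Ψ⟩
  map_add' Θ Ψ := space_ext fun n => smul_add _ (comp Θ n) (comp Ψ n)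
  map_smul' c Ψ := space_ext fun n => smul_comm _ c (comp Ψ n)

theorem parityₗ_involutive : Function.Involutive (parityₗ : Space ℓ →ₗ[ℂ] Space ℓ) :=
  fun Ψ => space_ext fun n => by
    change (-1 : ℂ) ^ n • (-1 : ℂ) ^ n • comp Ψ n = comp Ψ n
    rw [smul_smul, ← mul_pow]
    simp

/-- The unitary involution `(-1)^N`, which reverses the sign of the interaction. -/
def parity : Space ℓ ≃ₗᵢ[ℂ] Space ℓ :=
  (LinearEquiv.ofInvolutive parityₗ parityₗ_involutive).isometryOfInner fun Θ Ψ =>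
    (hasSum_inner_comp _ _).unique
      ((hasSum_inner_comp Θ Ψ).congr_fun fun n => inner_neg_one_pow_smul n (comp Θ n) (comp Ψ n))

theorem comp_parity (Ψ : Space ℓ) (n : ℕ) : comp (parity Ψ) n = (-1 : ℂ) ^ n • comp Ψ n := rfl

theorem parity_parity (Ψ : Space ℓ) : parity (parity Ψ) = Ψ := parity.apply_symm_apply Ψ

theorem parity_mem_formSubmodule {Ψ : Space ℓ} (hΨ : Ψ ∈ formSubmodule ℓ) :
    parity Ψ ∈ formSubmodule ℓ := by
  rw [mem_formSubmodule] at hΨ ⊢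
  refine ⟨fun n => (momentumDomain ℓ n).smul_mem _ (hΨ.1 n), hΨ.2.congr fun n => ?_⟩
  rw [freeEnergy, freeEnergy, comp_parity, kineticEnergy_smul (hΨ.1 n), norm_smul]
  simp

theorem kinetic_neg_one_pow_smul {f g : L2 ℓ n} (hf : f ∈ momentumDomain ℓ n)
    (hg : g ∈ momentumDomain ℓ n) (k : ℕ) :
    kinetic ((-1 : ℂ) ^ k • f) ((-1 : ℂ) ^ k • g) = kinetic f g := by
  simp only [kinetic, weakRelDeriv_smul hf, weakRelDeriv_smul hg, inner_neg_one_pow_smul]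

theorem pairing_parity (Θ Ψ : Space ℓ) (n : ℕ) :
    pairing (comp (parity Θ) n) (comp (parity Ψ) (n + 1)) =
      -pairing (comp Θ n) (comp Ψ (n + 1)) := by
  rw [comp_parity, comp_parity, pairing_smul_left, pairing_smul_right, ← mul_assoc, pow_succ,
    ← mul_assoc, conj_neg_one_pow_mul]
  ring

theorem energyForm_parity (g : ℝ) {Θ Ψ : Space ℓ} (hΘ : Θ ∈ formSubmodule ℓ)
    (hΨ : Ψ ∈ formSubmodule ℓ) :
    energyForm ℓ g (parity Θ) (parity Ψ) = energyForm ℓ (-g) Θ Ψ := by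
  refine (hasSum_energyForm g (parity_mem_formSubmodule hΘ) (parity_mem_formSubmodule hΨ)).unique ?_
  refine (hasSum_energyForm (-g) hΘ hΨ).congr_fun fun n => ?_
  simp only [freeTerm, interactionTerm, pairing_parity]
  rw [comp_parity, comp_parity, inner_neg_one_pow_smul,
    kinetic_neg_one_pow_smul ((mem_formSubmodule.mp hΘ).1 n) ((mem_formSubmodule.mp hΨ).1 n)]
  simp only [map_neg, Complex.ofReal_neg]
  ring

end Parity

section SingleSpace

/-- The state with the single component `θ` in the `n`-phonon sector. -/
def singleSpace (n : ℕ) {θ : L2 ℓ n} (hθ : θ ∈ sector ℓ n) : Space ℓ :=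
  lp.single 2 n ⟨θ, hθ⟩

theorem comp_singleSpace_self {θ : L2 ℓ n} (hθ : θ ∈ sector ℓ n) :
    comp (singleSpace n hθ) n = θ := by
  simp only [comp, singleSpace, lp.single_apply_self]

theorem comp_singleSpace_ne {θ : L2 ℓ n} (hθ : θ ∈ sector ℓ n) {k : ℕ} (hk : k ≠ n) :
    comp (singleSpace n hθ) k = 0 := by
  simp only [comp, singleSpace, lp.single_apply_ne _ _ _ hk, ZeroMemClass.coe_zero]

theorem singleSpace_mem_formSubmodule {θ : L2 ℓ n} (hθ : θ ∈ sector ℓ n)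
    (hd : θ ∈ momentumDomain ℓ n) : singleSpace n hθ ∈ formSubmodule ℓ := by
  rw [mem_formSubmodule]
  constructor
  · intro k
    rcases eq_or_ne k n with rfl | hk
    · rwa [comp_singleSpace_self]
    · rw [comp_singleSpace_ne hθ hk]
      exact Submodule.zero_mem _
  · refine summable_of_ne_finset_zero (s := {n}) fun k hk => ?_
    rw [freeEnergy, comp_singleSpace_ne hθ (by simpa using hk), kineticEnergy_zero]
    simp

theorem inner_singleSpace {θ : L2 ℓ n} (hθ : θ ∈ sector ℓ n) (Ψ : Space ℓ) :
    inner ℂ (singleSpace n hθ) Ψ = inner ℂ θ (comp Ψ n) := by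
  refine (hasSum_inner_comp _ _).unique ?_
  have h := hasSum_single (f := fun k => inner ℂ (comp (singleSpace n hθ) k) (comp Ψ k)) n
    fun k hk => by simp only [comp_singleSpace_ne hθ hk, inner_zero_left]
  simpa only [comp_singleSpace_self] using h

end SingleSpace

end Operations

/-! ### Ground states with the sign of the interaction reversed -/

section GroundStates

variable {ℓ : ℝ} [Fact (0 < ℓ)] {n : ℕ} {g E : ℝ}

variable (ℓ) in
/-- The eigenspace at energy `E` of `(-i∇_x - P_f)² + N - g φ(v)`. -/
def eigenstates (g E : ℝ) : Submodule ℂ (Space ℓ) where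
  carrier :=
    {Ψ | Ψ ∈ formSubmodule ℓ ∧ ∀ Θ ∈ formSubmodule ℓ, energyForm ℓ (-g) Θ Ψ = E * inner ℂ Θ Ψ}
  zero_mem' := by
    refine ⟨zero_mem _, fun Θ hΘ => ?_⟩
    simpa using (isHermitianFormOn_energyForm (-g)).smul_right 0 hΘ (zero_mem (formSubmodule ℓ))
  add_mem' := by
    intro Ψ Φ hΨ hΦ
    refine ⟨add_mem hΨ.1 hΦ.1, fun Θ hΘ => ?_⟩
    rw [(isHermitianFormOn_energyForm (-g)).add_right hΘ hΨ.1 hΦ.1, hΨ.2 Θ hΘ, hΦ.2 Θ hΘ,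
      inner_add_right, mul_add]
  smul_mem' := by
    intro c Ψ hΨ
    refine ⟨Submodule.smul_mem _ c hΨ.1, fun Θ hΘ => ?_⟩
    rw [(isHermitianFormOn_energyForm (-g)).smul_right c hΘ hΨ.1, hΨ.2 Θ hΘ, inner_smul_right]
    ring

theorem conjSpace_mem_eigenstates {Ψ : Space ℓ} (hΨ : Ψ ∈ eigenstates ℓ g E) :
    conjSpace Ψ ∈ eigenstates ℓ g E := by
  refine ⟨conjSpace_mem_formSubmodule hΨ.1, fun Θ hΘ => ?_⟩
  have h := congrArg conj (hΨ.2 _ (conjSpace_mem_formSubmodule hΘ))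
  rwa [← energyForm_conjSpace _ (conjSpace_mem_formSubmodule hΘ) hΨ.1, map_mul,
    Complex.conj_ofReal, ← inner_conjSpace, conjSpace_conjSpace] at h

variable (ℓ) in
/-- `E` is a lower bound of the quadratic form of `(-i∇_x - P_f)² + N - g φ(v)`. -/
def IsEnergyBound (g E : ℝ) : Prop :=
  ∀ Φ ∈ formSubmodule ℓ, E * ‖Φ‖ ^ 2 ≤ (energyForm ℓ (-g) Φ Φ).re

theorem lipschitzWith_posPart : LipschitzWith 1 (fun z : ℂ => ((max z.re 0 : ℝ) : ℂ)) := by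
  refine LipschitzWith.of_dist_le_mul fun z w => ?_
  rw [NNReal.coe_one, one_mul, Complex.dist_eq, Complex.dist_eq, ← Complex.ofReal_sub,
    Complex.norm_real, Real.norm_eq_abs]
  refine (abs_max_sub_max_le_abs z.re w.re 0).trans ?_
  rw [← Complex.sub_re]
  exact Complex.abs_re_le_norm _

/-- The positive part of the real part of a state. -/
def posSpace (Ψ : Space ℓ) : Space ℓ := compSpace lipschitzWith_posPart (by simp) Ψ

theorem posSpace_mem_formSubmodule {Ψ : Space ℓ} (hΨ : Ψ ∈ formSubmodule ℓ) :
    posSpace Ψ ∈ formSubmodule ℓ :=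
  compSpace_mem_formSubmodule _ _ hΨ

theorem coeFn_comp_posSpace (Ψ : Space ℓ) (n : ℕ) :
    ∀ᵐ z, comp (posSpace Ψ) n z = ((max (comp Ψ n z).re 0 : ℝ) : ℂ) :=
  lipschitzWith_posPart.coeFn_compLp (by simp) (comp Ψ n)

theorem coeFn_comp_posSpace_neg (Ψ : Space ℓ) (n : ℕ) :
    ∀ᵐ z, comp (posSpace (-Ψ)) n z = ((max (-(comp Ψ n z).re) 0 : ℝ) : ℂ) := by
  filter_upwards [coeFn_comp_posSpace (-Ψ) n, Lp.coeFn_neg (comp Ψ n)] with z hpos hneg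
  rw [hpos, comp_neg, hneg, Pi.neg_apply, Complex.neg_re]

theorem isNonneg_posSpace (Ψ : Space ℓ) (n : ℕ) : IsNonneg (comp (posSpace Ψ) n) :=
  isNonneg_of_ae_eq_ofReal (fun _ => le_max_right _ _) (coeFn_comp_posSpace Ψ n)

theorem posSpace_mul_posSpace_neg (Ψ : Space ℓ) (n : ℕ) :
    ∀ᵐ z, comp (posSpace Ψ) n z * comp (posSpace (-Ψ)) n z = 0 := by
  filter_upwards [coeFn_comp_posSpace Ψ n, coeFn_comp_posSpace_neg Ψ n] with z hpos hneg
  rw [hpos, hneg, mul_eq_zero]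
  rcases le_total (comp Ψ n z).re 0 with h | h
  · left; simp [h]
  · right; simp [h]

theorem posSpace_sub_posSpace_neg {Ψ : Space ℓ} (h : conjSpace Ψ = Ψ) :
    posSpace Ψ - posSpace (-Ψ) = Ψ := by
  refine space_ext fun n => Lp.ext ?_
  have hstar : comp Ψ n =ᵐ[volume] star ⇑(comp Ψ n) := by
    simpa only [← comp_conjSpace, h] using Lp.coeFn_star (comp Ψ n)
  rw [comp_sub]
  filter_upwards [coeFn_comp_posSpace Ψ n, coeFn_comp_posSpace_neg Ψ n, hstar,
    Lp.coeFn_sub (comp (posSpace Ψ) n) (comp (posSpace (-Ψ)) n)] with z hpos hneg hreal hsub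
  rw [hsub, Pi.sub_apply, hpos, hneg, ← Complex.ofReal_sub]
  have hz : ((comp Ψ n z).re : ℂ) = comp Ψ n z := Complex.conj_eq_iff_re.mp hreal.symm
  rw [max_zero_sub_max_neg_zero_eq_self, hz]

theorem re_energyForm_nonpos (hg : 0 ≤ g) {Θ Ψ : Space ℓ} (hΘ : Θ ∈ formSubmodule ℓ)
    (hΨ : Ψ ∈ formSubmodule ℓ) (hΘ0 : ∀ n, IsNonneg (comp Θ n)) (hΨ0 : ∀ n, IsNonneg (comp Ψ n))
    (h : ∀ n, ∀ᵐ z, comp Θ n z * comp Ψ n z = 0) : (energyForm ℓ (-g) Θ Ψ).re ≤ 0 := by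
  refine hasSum_le (fun n => ?_) (Complex.hasSum_re (hasSum_energyForm (-g) hΘ hΨ)) hasSum_zero
  have hfree : (freeTerm Θ Ψ n).re ≤ 0 := by
    rw [freeTerm, inner_eq_zero_of_ae_mul_eq_zero (h n), mul_zero, add_zero]
    exact (hΘ0 n).re_kinetic_nonpos (hΨ0 n) ((mem_formSubmodule.mp hΘ).1 n)
      ((mem_formSubmodule.mp hΨ).1 n) (h n)
  have hinteraction : 0 ≤ (interactionTerm Θ Ψ n).re := by
    rw [interactionTerm, Complex.add_re, Complex.re_ofReal_mul, Complex.re_ofReal_mul,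
      Complex.conj_re]
    exact add_nonneg
      (mul_nonneg (Real.sqrt_nonneg _) ((hΘ0 n).re_pairing_nonneg (hΨ0 (n + 1))))
      (mul_nonneg (Real.sqrt_nonneg _) ((hΨ0 n).re_pairing_nonneg (hΘ0 (n + 1))))
  rw [Complex.add_re, Complex.re_ofReal_mul]
  linarith [mul_nonneg hg hinteraction]

theorem inner_eq_zero_of_disjoint {Θ Ψ : Space ℓ}
    (h : ∀ n, ∀ᵐ z, comp Θ n z * comp Ψ n z = 0) : inner ℂ Θ Ψ = 0 := by
  refine (hasSum_inner_comp Θ Ψ).unique ?_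
  simpa only [inner_eq_zero_of_ae_mul_eq_zero (h _)] using hasSum_zero

/-- Dropping the cross term between the positive and the negative part can only lower the energy,
so both parts attain the lower bound. -/
theorem posSpace_mem_eigenstates (hg : 0 ≤ g) (hE : IsEnergyBound ℓ g E) {Ψ : Space ℓ}
    (hΨ : Ψ ∈ eigenstates ℓ g E) (hreal : conjSpace Ψ = Ψ) : posSpace Ψ ∈ eigenstates ℓ g E := by
  have hp : posSpace Ψ ∈ formSubmodule ℓ := posSpace_mem_formSubmodule hΨ.1
  have hm : posSpace (-Ψ) ∈ formSubmodule ℓ := posSpace_mem_formSubmodule (neg_mem hΨ.1)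
  have hq := (isHermitianFormOn_energyForm (ℓ := ℓ) (-g)).sub_inner E
  have hpos : ∀ Φ ∈ formSubmodule ℓ, 0 ≤ (energyForm ℓ (-g) Φ Φ - E * inner ℂ Φ Φ).re := by
    intro Φ hΦ
    rw [IsHermitianFormOn.re_sub_inner_self]
    exact sub_nonneg.mpr (hE Φ hΦ)
  have hcross : (energyForm ℓ (-g) (posSpace Ψ) (posSpace (-Ψ))
      - E * inner ℂ (posSpace Ψ) (posSpace (-Ψ))).re ≤ 0 := by
    rw [inner_eq_zero_of_disjoint (posSpace_mul_posSpace_neg Ψ), mul_zero, sub_zero]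
    exact re_energyForm_nonpos hg hp hm (isNonneg_posSpace Ψ) (isNonneg_posSpace (-Ψ))
      (posSpace_mul_posSpace_neg Ψ)
  have hself := hq.re_self_nonpos_of_re_sub_self_nonpos hpos hp hm hcross (by
    rw [posSpace_sub_posSpace_neg hreal, hΨ.2 Ψ hΨ.1, sub_self, Complex.zero_re])
  exact ⟨hp, fun Θ hΘ => sub_eq_zero.mp (hq.eq_zero_of_re_nonpos hpos hΘ hp hself)⟩

end GroundStates

/-! ### Cone functions as test states -/

section Cone

variable {ℓ : ℝ} {n : ℕ}

/-- The function `max (R - ‖(y₁, …, yₙ)‖) 0`, a Lipschitz test function that is positive for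
`‖(y₁, …, yₙ)‖ < R` (maximum norm over the `yᵢ`). -/
def cone (R : ℝ) (z : Config ℓ n) : ℂ := ((max (R - ‖z.2‖) 0 : ℝ) : ℂ)

theorem cone_eq_zero {R : ℝ} {z : Config ℓ n} (hz : R < ‖z.2‖) : cone R z = 0 := by
  rw [cone, max_eq_right (by linarith), Complex.ofReal_zero]

theorem abs_norm_shift_sub_le (t : E3) (z : Config ℓ n) : |‖(shift t z).2‖ - ‖z.2‖| ≤ ‖t‖ := by
  refine (abs_norm_sub_norm_le _ _).trans ((pi_norm_le_iff_of_nonneg (norm_nonneg _)).mpr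
    fun i => ?_)
  simp [shift]

theorem dist_cone_shift_le (R : ℝ) (t : E3) (z : Config ℓ n) :
    dist (cone R (shift t z)) (cone R z) ≤ ‖t‖ := by
  rw [cone, cone, Complex.dist_eq, ← Complex.ofReal_sub, Complex.norm_real, Real.norm_eq_abs]
  refine (abs_max_sub_max_le_abs _ _ 0).trans ?_
  rw [sub_sub_sub_cancel_left, abs_sub_comm]
  exact abs_norm_shift_sub_le t z

variable [Fact (0 < ℓ)] {g E : ℝ}

theorem memLp_cone (R : ℝ) : MemLp (cone R : Config ℓ n → ℂ) 2 volume := by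
  have hcont : Continuous (cone R : Config ℓ n → ℂ) := by
    unfold cone
    fun_prop
  exact hcont.memLp_of_hasCompactSupport
    (hasCompactSupport_of_norm_snd_le R fun _ => cone_eq_zero)

variable (ℓ n) in
/-- The cone function as an element of `L²`. -/
def coneL2 (R : ℝ) : L2 ℓ n := (memLp_cone R).toLp _

theorem coeFn_coneL2 (R : ℝ) : coneL2 ℓ n R =ᵐ[volume] cone R := (memLp_cone R).coeFn_toLp

theorem isNonneg_coneL2 (R : ℝ) : IsNonneg (coneL2 ℓ n R) :=
  isNonneg_of_ae_eq_ofReal (fun _ => le_max_right _ _) (coeFn_coneL2 R)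

theorem coneL2_mem_sector (R : ℝ) : coneL2 ℓ n R ∈ sector ℓ n := by
  intro σ
  rw [coneL2, Lp.toLp_compMeasurePreserving]
  refine MemLp.toLp_congr _ _ (Eventually.of_forall fun z => ?_)
  have hnorm : ‖fun i => z.2 (σ i)‖ = ‖z.2‖ := by
    have hsup := Finset.sup_map Finset.univ σ.toEmbedding fun i => ‖z.2 i‖₊
    rw [Finset.map_univ_equiv] at hsup
    exact congrArg NNReal.toReal hsup.symm
  simp only [Function.comp_apply, cone, permute, hnorm]

/-- For `|s| ≤ 1` both functions are supported in `‖(y₁, …, yₙ)‖ ≤ R + 1`, of finite measure. -/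
theorem exists_norm_flow_coneL2_sub_le (R : ℝ) (j : Fin 3) : ∃ M : ℝ, 0 ≤ M ∧ ∀ s : ℝ, |s| ≤ 1 →
    ‖flow j s (coneL2 ℓ n R) - coneL2 ℓ n R‖ ≤ M * |s| := by
  let K : Set (Config ℓ n) := Set.univ ×ˢ Metric.closedBall 0 (R + 1)
  have hK : IsCompact K := isCompact_univ.prod (isCompact_closedBall _ _)
  have hvol : volume K ^ (1 / (2 : ℝ≥0∞).toReal) ≠ ⊤ :=
    ENNReal.rpow_ne_top_of_nonneg (by simp) hK.measure_ne_top
  have hnotMem : ∀ z : Config ℓ n, z.2 ∉ Metric.closedBall 0 (R + 1) → R + 1 < ‖z.2‖ :=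
    fun z hz => by simpa using hz
  refine ⟨_, ENNReal.toReal_nonneg (a := volume K ^ (1 / (2 : ℝ≥0∞).toReal)), fun s hs => ?_⟩
  let t : E3 := s • EuclideanSpace.single j (1 : ℝ)
  have ht : ‖t‖ = |s| := by
    rw [norm_smul, PiLp.norm_single, norm_one, mul_one, Real.norm_eq_abs]
  have hflow : flow j s (coneL2 ℓ n R) =
      ((memLp_cone R).comp_measurePreserving (measurePreserving_shift t)).toLp _ :=
    Lp.toLp_compMeasurePreserving (memLp_cone R) (measurePreserving_shift t)
  have hbound := eLpNorm_sub_le_of_dist_bdd (volume : Measure (Config ℓ n)) (p := 2) (by simp)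
    hK.measurableSet (norm_nonneg t) (f := cone R ∘ shift t) (g := cone R)
    (dist_cone_shift_le R t) ?_ ?_
  · rw [hflow, coneL2, ← MemLp.toLp_sub, Lp.norm_toLp]
    rw [ht, ← ENNReal.ofReal_toReal hvol, ← ENNReal.ofReal_mul (abs_nonneg s), mul_comm] at hbound
    exact ENNReal.toReal_le_of_le_ofReal (by positivity) hbound
  · refine fun z hz => ⟨Set.mem_univ _, by_contra fun hzK => hz (cone_eq_zero ?_)⟩
    linarith [hnotMem z hzK, (abs_le.mp (abs_norm_shift_sub_le t z)).1]
  · refine fun z hz => ⟨Set.mem_univ _, by_contra fun hzK => hz (cone_eq_zero ?_)⟩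
    linarith [hnotMem z hzK]

theorem coneL2_mem_momentumDomain (R : ℝ) : coneL2 ℓ n R ∈ momentumDomain ℓ n := by
  intro j
  obtain ⟨M, hM, hsmall⟩ := exists_norm_flow_coneL2_sub_le (ℓ := ℓ) (n := n) R j
  suffices h : ∀ s, ‖flow j s (coneL2 ℓ n R) - coneL2 ℓ n R‖ ≤ (M + 2 * ‖coneL2 ℓ n R‖) * |s| from
    (exists_isWeakRelDeriv_norm_le h).imp fun _ => And.right
  intro s
  rcases le_or_gt |s| 1 with hs | hs
  · refine (hsmall s hs).trans ?_
    gcongr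
    exact le_add_of_nonneg_right (by positivity)
  · calc ‖flow j s (coneL2 ℓ n R) - coneL2 ℓ n R‖ ≤ ‖coneL2 ℓ n R‖ + ‖coneL2 ℓ n R‖ := by
          simpa only [LinearIsometry.norm_map] using
            norm_sub_le (flow j s (coneL2 ℓ n R)) (coneL2 ℓ n R)
      _ ≤ (M + 2 * ‖coneL2 ℓ n R‖) * |s| := by
          nlinarith [norm_nonneg (coneL2 ℓ n R), mul_nonneg hM (abs_nonneg s)]

/-! ### The eigenvalue equation in a single sector -/

theorem energyForm_singleSpace {θ : L2 ℓ n} (hθ : θ ∈ sector ℓ n)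
    (hd : θ ∈ momentumDomain ℓ n) {Ψ : Space ℓ} (hΨ : Ψ ∈ formSubmodule ℓ)
    (hlow : ∀ k, k + 1 = n → comp Ψ k = 0) (c : ℝ) :
    energyForm ℓ c (singleSpace n hθ) Ψ = kinetic θ (comp Ψ n) + n * inner ℂ θ (comp Ψ n)
      + c * (√(n + 1) * pairing θ (comp Ψ (n + 1))) := by
  refine (hasSum_energyForm c (singleSpace_mem_formSubmodule hθ hd) hΨ).unique ?_
  have h := hasSum_single (f := fun k => freeTerm (singleSpace n hθ) Ψ k
    + c * interactionTerm (singleSpace n hθ) Ψ k) n fun k hk => ?_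
  · convert h using 1
    simp only [freeTerm, interactionTerm, comp_singleSpace_self,
      comp_singleSpace_ne hθ (Nat.succ_ne_self n), pairing_zero_right, map_zero, mul_zero,
      add_zero]
  · have hcreate : pairing (comp Ψ k) (comp (singleSpace n hθ) (k + 1)) = 0 := by
      rcases eq_or_ne (k + 1) n with hkn | hkn
      · rw [hlow k hkn, pairing_zero_left]
      · rw [comp_singleSpace_ne hθ hkn, pairing_zero_right]
    simp only [freeTerm, interactionTerm, comp_singleSpace_ne hθ hk, kinetic_zero_left,
      inner_zero_left, pairing_zero_left, hcreate, map_zero, mul_zero, add_zero]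

theorem ae_of_ae_consMap {P : Config ℓ (n + 1) → Prop}
    (h : ∀ᵐ p : Config ℓ n × E3, P (consMap p)) : ∀ᵐ z, P z := by
  rw [← (measurePreserving_consMap (ℓ := ℓ) (n := n)).map_eq,
    measurableEmbedding_consMap.ae_map_iff]
  exact h

theorem IsNonneg.absKernel_ae_eq_zero {θ : L2 ℓ n} {ψ : L2 ℓ (n + 1)} (hθ : IsNonneg θ)
    (hψ : IsNonneg ψ) (hd : ψ ∈ momentumDomain ℓ (n + 1)) (h : pairing θ ψ = 0) :
    ∀ᵐ p : Config ℓ n × E3, absKernel θ ψ p = 0 := by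
  obtain ⟨C, -, hC⟩ := exists_interaction_bound (ℓ := ℓ) one_pos
  rwa [hθ.pairing_eq hψ, Complex.ofReal_eq_zero,
    integral_eq_zero_iff_of_nonneg (fun p => absKernel_nonneg _ _ p) (hC n _ ψ hd).1] at h

theorem eq_zero_of_forall_pairing_coneL2 {ψ : L2 ℓ (n + 1)} (hψ : IsNonneg ψ)
    (hd : ψ ∈ momentumDomain ℓ (n + 1)) (h : ∀ R : ℕ, pairing (coneL2 ℓ n R) ψ = 0) : ψ = 0 := by
  have hne : ∀ᵐ p : Config ℓ n × E3, p.2 ≠ 0 :=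
    Measure.quasiMeasurePreserving_snd.ae (Measure.ae_ne volume (0 : E3))
  refine (Lp.eq_zero_iff_ae_eq_zero).mpr (ae_of_ae_consMap ?_)
  filter_upwards [ae_all_iff.mpr fun R => (isNonneg_coneL2 _).absKernel_ae_eq_zero hψ hd (h R),
    ae_all_iff.mpr fun R : ℕ => ae_fst (coeFn_coneL2 (R : ℝ)), hne] with p hkernel hcone hp
  obtain ⟨R, hR⟩ := exists_nat_gt ‖p.1.2‖
  have hcone_ne : cone (R : ℝ) p.1 ≠ 0 := by
    rw [cone, max_eq_left (by linarith), Complex.ofReal_ne_zero]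
    linarith
  simpa [absKernel, hcone R, hcone_ne, (formFactor_pos hp).ne'] using hkernel R

/-- If `Ψ⁽ᵏ⁾ = 0` for `k ≤ n`, the eigenvalue equation in the `n`-phonon sector reduces to
`a(v) Ψ⁽ⁿ⁺¹⁾ = 0`. -/
theorem eq_zero_of_comp_zero_eq_zero (hg : 0 < g) {Ψ : Space ℓ} (hΨ : Ψ ∈ eigenstates ℓ g E)
    (hpos : ∀ n, IsNonneg (comp Ψ n)) (hvac : comp Ψ 0 = 0) : Ψ = 0 := by
  refine space_ext fun n => ?_
  induction n using Nat.strong_induction_on with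
  | h n ih =>
    rcases n with _ | n
    · exact hvac
    refine eq_zero_of_forall_pairing_coneL2 (hpos (n + 1)) ((mem_formSubmodule.mp hΨ.1).1 (n + 1))
      fun R => ?_
    have hsector := coneL2_mem_sector (ℓ := ℓ) (n := n) (R : ℝ)
    have hdom := coneL2_mem_momentumDomain (ℓ := ℓ) (n := n) (R : ℝ)
    have heigen := hΨ.2 _ (singleSpace_mem_formSubmodule hsector hdom)
    rw [energyForm_singleSpace hsector hdom hΨ.1 (fun k hk => ih k (by lia)), inner_singleSpace,
      ih n (by lia), comp_zero, inner_zero_right, ← kinetic_conj_symm, kinetic_zero_left] at heigen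
    have hsqrt : (√((n : ℝ) + 1) : ℂ) ≠ 0 := Complex.ofReal_ne_zero.mpr (by positivity)
    simpa [hsqrt, hg.ne', comp_zero] using heigen

end Cone

/-! ### The support of the vacuum component -/

section ZeroOne

variable {X : Type*} [MeasurableSpace X] {μ : Measure X}

/-- The indicator functions in `L²`. -/
def IsZeroOne (f : Lp ℂ 2 μ) : Prop := ∀ᵐ z ∂μ, f z = 0 ∨ f z = 1

theorem IsZeroOne.norm_sub_sq_le {f₁ f₂ f₃ : Lp ℂ 2 μ} (h₁ : IsZeroOne f₁) (h₂ : IsZeroOne f₂)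
    (h₃ : IsZeroOne f₃) : ‖f₁ - f₃‖ ^ 2 ≤ ‖f₁ - f₂‖ ^ 2 + ‖f₂ - f₃‖ ^ 2 := by
  simp only [← integral_norm_sq]
  rw [← integral_add (integrable_norm_sq _) (integrable_norm_sq _)]
  refine integral_mono_ae (integrable_norm_sq _)
    ((integrable_norm_sq _).add (integrable_norm_sq _)) ?_
  filter_upwards [h₁, h₂, h₃, Lp.coeFn_sub f₁ f₃, Lp.coeFn_sub f₁ f₂, Lp.coeFn_sub f₂ f₃]
    with z hz₁ hz₂ hz₃ h₁₃ h₁₂ h₂₃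
  simp only [h₁₃, h₁₂, h₂₃, Pi.sub_apply]
  rcases hz₁ with hz₁ | hz₁ <;> rcases hz₂ with hz₂ | hz₂ <;> rcases hz₃ with hz₃ | hz₃ <;>
    simp [hz₁, hz₂, hz₃]

theorem tendsto_of_ae_tendsto {F : ℕ → Lp ℂ 2 μ} {f b : Lp ℂ 2 μ}
    (hbound : ∀ k, ∀ᵐ z ∂μ, ‖F k z - f z‖ ≤ ‖b z‖)
    (hlim : ∀ᵐ z ∂μ, Tendsto (fun k => F k z) atTop (𝓝 (f z))) : Tendsto F atTop (𝓝 f) := by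
  have hsq : Tendsto (fun k => ‖F k - f‖ ^ 2) atTop (𝓝 0) := by
    simp only [← integral_norm_sq]
    rw [← integral_zero X ℝ (μ := μ)]
    refine tendsto_integral_of_dominated_convergence (fun z => ‖b z‖ ^ 2)
      (fun k => (integrable_norm_sq _).aestronglyMeasurable) (integrable_norm_sq _)
      (fun k => ?_) ?_
    · filter_upwards [Lp.coeFn_sub (F k) f, hbound k] with z hsub hz
      rw [hsub, Pi.sub_apply, norm_pow, norm_norm]
      gcongr
    · filter_upwards [ae_all_iff.mpr fun k => Lp.coeFn_sub (F k) f, hlim] with z hsub hz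
      simp only [hsub, Pi.sub_apply]
      simpa using (hz.sub_const (f z)).norm.pow 2
  rw [tendsto_iff_norm_sub_tendsto_zero]
  simpa using hsq.sqrt

end ZeroOne

theorem eq_zero_of_le_two_mul {φ : ℝ → ℝ} {B : ℝ} (hnonneg : ∀ t, 0 ≤ φ t)
    (hdouble : ∀ t, φ (2 * t) ≤ 2 * φ t) (hB : ∀ t, φ t ≤ B * t ^ 2) (s : ℝ) : φ s = 0 := by
  have hiter : ∀ k : ℕ, φ s ≤ 2 ^ k * φ (s / 2 ^ k) := by
    intro k
    induction k with
    | zero => simp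
    | succ k ih =>
      calc φ s ≤ 2 ^ k * φ (2 * (s / 2 ^ (k + 1))) := by
            convert ih using 3
            rw [pow_succ]
            field_simp
        _ ≤ 2 ^ k * (2 * φ (s / 2 ^ (k + 1))) := by gcongr; exact hdouble _
        _ = 2 ^ (k + 1) * φ (s / 2 ^ (k + 1)) := by ring
  have hlim : Tendsto (fun k : ℕ => B * s ^ 2 * (1 / 2 : ℝ) ^ k) atTop (𝓝 0) := by
    simpa using (tendsto_pow_atTop_nhds_zero_of_lt_one (r := (1 / 2 : ℝ)) (by norm_num)
      (by norm_num)).const_mul (B * s ^ 2)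
  refine le_antisymm (ge_of_tendsto' hlim fun k => ?_) (hnonneg s)
  calc φ s ≤ 2 ^ k * φ (s / 2 ^ k) := hiter k
    _ ≤ 2 ^ k * (B * (s / 2 ^ k) ^ 2) := by gcongr; exact hB _
    _ = B * s ^ 2 * (1 / 2 : ℝ) ^ k := by rw [one_div, inv_pow]; field_simp

theorem eventually_min_one_mul_eq_one {r : ℝ} (hr : 0 < r) :
    ∀ᶠ k : ℕ in atTop, min 1 (k * r) = 1 :=
  ((tendsto_natCast_atTop_atTop.atTop_mul_const hr).eventually_ge_atTop 1).mono
    fun _ => min_eq_left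

section Vacuum

variable {ℓ : ℝ}

theorem shift_eq_cover_vadd (p : E3 × (Fin 0 → E3)) (z : Config ℓ 0) :
    shift p.1 z = cover ℓ 0 p +ᵥ z := by
  refine Prod.ext (funext fun j => ?_) (Subsingleton.elim _ _)
  simp [shift, cover, add_comm]

variable [Fact (0 < ℓ)] {n : ℕ} {g E : ℝ}

theorem IsZeroOne.flow {f : L2 ℓ n} (hf : IsZeroOne f) (j : Fin 3) (s : ℝ) :
    IsZeroOne (flow j s f) :=
  ae_flow (P := fun w => w = 0 ∨ w = 1) hf j s

/-- For indicator functions `‖U(2 t) f - f‖² ≤ 2 ‖U(t) f - f‖²`, so `‖U(t) f - f‖²` cannot be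
quadratically small unless it vanishes. -/
theorem IsZeroOne.flow_eq {f : L2 ℓ n} (hf : IsZeroOne f) {j : Fin 3} {B : ℝ}
    (hB : ∀ s, ‖Polaron.flow j s f - f‖ ^ 2 ≤ B * s ^ 2) (s : ℝ) : Polaron.flow j s f = f := by
  have hdouble : ∀ t, ‖Polaron.flow j (2 * t) f - f‖ ^ 2 ≤ 2 * ‖Polaron.flow j t f - f‖ ^ 2 := by
    intro t
    have hshift : ‖Polaron.flow j (2 * t) f - Polaron.flow j t f‖ = ‖Polaron.flow j t f - f‖ := by
      rw [two_mul, ← (isUnitaryGroup_flow j).apply_apply, ← map_sub, LinearIsometry.norm_map]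
    have htriangle := (hf.flow j (2 * t)).norm_sub_sq_le (hf.flow j t) hf
    rwa [hshift, ← two_mul] at htriangle
  have hzero := eq_zero_of_le_two_mul (fun t => sq_nonneg ‖Polaron.flow j t f - f‖) hdouble hB s
  rwa [sq_eq_zero_iff, norm_eq_zero, sub_eq_zero] at hzero

theorem translate_eq_of_forall_flow_eq {f : L2 ℓ n} (h : ∀ j s, flow j s f = f) (t : E3) :
    translate t f = f := by
  have ht : t = t 0 • EuclideanSpace.single 0 1 + (t 1 • EuclideanSpace.single 1 1
      + t 2 • EuclideanSpace.single 2 1) := by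
    ext i
    fin_cases i <;> simp
  have haxis : ∀ (j : Fin 3) (s : ℝ), translate (s • EuclideanSpace.single j (1 : ℝ)) f = f := h
  rw [ht, ← translate_translate, ← translate_translate, haxis, haxis, haxis]

instance : (volume : Measure (Config ℓ 0)).IsAddHaarMeasure :=
  Measure.prod.instIsAddHaarMeasure (volume : Measure (Torus ℓ)) (volume : Measure (Fin 0 → E3))

theorem measurableSet_support (f : L2 ℓ n) : MeasurableSet (Function.support f) :=
  (Lp.stronglyMeasurable f).measurable (measurableSet_singleton (0 : ℂ)).compl

/-- Without phonons, the relative motion is the translation action of the torus on itself, which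
is ergodic. -/
theorem ae_eq_zero_or_ae_ne_zero_of_translate_eq {f : L2 ℓ 0} (h : ∀ t, translate t f = f) :
    (∀ᵐ z, f z = 0) ∨ ∀ᵐ z, f z ≠ 0 := by
  have : ErgodicVAdd (Config ℓ 0) (Config ℓ 0) (volume : Measure (Config ℓ 0)) :=
    instErgodicVAddOfIsAddLeftInvariant
  have hconst := aeconst_of_forall_preimage_vadd_ae_eq (Config ℓ 0) (μ := volume)
    (measurableSet_support f).nullMeasurableSet fun w => ?_
  · rcases eventuallyConst_set.mp hconst with hne | hzero
    · exact Or.inr hne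
    · exact Or.inl (hzero.mono fun z hz => by simpa using hz)
  · obtain ⟨p, rfl⟩ := isOpenQuotientMap_cover.surjective w
    have htranslate := coeFn_translate p.1 f
    rw [h p.1] at htranslate
    refine eventuallyEq_set.mpr (htranslate.mono fun z hz => ?_)
    rw [Function.comp_apply, shift_eq_cover_vadd] at hz
    rw [Set.mem_preimage, Function.mem_support, Function.mem_support, hz]

variable (ℓ) in
/-- The constant function `1` in the vacuum sector, as the cone function without phonons. -/
def oneL2 : L2 ℓ 0 := coneL2 ℓ 0 1

theorem coeFn_oneL2 : ∀ᵐ z, oneL2 ℓ z = 1 := by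
  filter_upwards [coeFn_coneL2 (ℓ := ℓ) (n := 0) 1] with z hz
  rw [oneL2, hz, cone, Subsingleton.elim z.2 0, norm_zero]
  simp

theorem oneL2_mem_sector : oneL2 ℓ ∈ sector ℓ 0 := coneL2_mem_sector 1

theorem oneL2_mem_momentumDomain : oneL2 ℓ ∈ momentumDomain ℓ 0 := coneL2_mem_momentumDomain 1

theorem weakRelDeriv_oneL2 (j : Fin 3) : weakRelDeriv j (oneL2 ℓ) = 0 := by
  have hflow : ∀ s, flow j s (oneL2 ℓ) = oneL2 ℓ := fun s => Lp.ext <| by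
    filter_upwards [ae_flow (P := (· = 1)) coeFn_oneL2 j s, coeFn_oneL2 (ℓ := ℓ)] with z hz hone
    rw [hz, hone]
  refine IsWeakRelDeriv.weakRelDeriv_eq (isWeakRelDeriv_iff_hasDerivAt.mpr ?_)
  simp only [hflow]
  exact hasDerivAt_const _ _

theorem norm_le_norm_oneL2 {f : L2 ℓ 0} (h : ∀ᵐ z, ‖f z‖ ≤ 1) : ‖f‖ ≤ ‖oneL2 ℓ‖ := by
  refine Lp.norm_le_norm_of_ae_le ?_
  filter_upwards [h, coeFn_oneL2 (ℓ := ℓ)] with z hz hone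
  rwa [hone, norm_one]

/-- The function `1` on `{f ≠ 0}`. -/
def supportL2 (f : L2 ℓ 0) : L2 ℓ 0 :=
  ((Lp.memLp (oneL2 ℓ)).indicator (measurableSet_support f)).toLp _

theorem coeFn_supportL2 (f : L2 ℓ 0) :
    ∀ᵐ z, supportL2 f z = (Function.support f).indicator 1 z := by
  filter_upwards [((Lp.memLp (oneL2 ℓ)).indicator (measurableSet_support f)).coeFn_toLp,
    coeFn_oneL2 (ℓ := ℓ)] with z hz hone
  classical rw [supportL2, hz, Set.indicator_apply, Set.indicator_apply, hone, Pi.one_apply]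

theorem isZeroOne_supportL2 (f : L2 ℓ 0) : IsZeroOne (supportL2 f) := by
  filter_upwards [coeFn_supportL2 f] with z hz
  rw [hz]
  exact Set.indicator_eq_zero_or_self _ _ _

/-- The truncation `z ↦ min 1 (k (Re z)₊)`. -/
def trunc (k : ℕ) (z : ℂ) : ℂ := ((min 1 (k * max z.re 0) : ℝ) : ℂ)

theorem lipschitzWith_trunc (k : ℕ) : LipschitzWith k (trunc k) := by
  refine LipschitzWith.of_dist_le_mul fun z w => ?_
  rw [trunc, trunc, Complex.dist_eq, ← Complex.ofReal_sub, Complex.norm_real, Real.norm_eq_abs]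
  calc |min 1 (k * max z.re 0) - min 1 (k * max w.re 0)|
      ≤ max |(1 : ℝ) - 1| |k * max z.re 0 - k * max w.re 0| := abs_min_sub_min_le_max _ _ _ _
    _ = k * |max z.re 0 - max w.re 0| := by
        rw [sub_self, abs_zero, max_eq_right (abs_nonneg _), ← mul_sub, abs_mul, Nat.abs_cast]
    _ ≤ k * |z.re - w.re| :=
        mul_le_mul_of_nonneg_left (abs_max_sub_max_le_abs _ _ _) k.cast_nonneg
    _ ≤ k * ‖z - w‖ := by
        rw [← Complex.sub_re]
        gcongr
        exact Complex.abs_re_le_norm _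
    _ = (k : ℝ≥0) * dist z w := by rw [NNReal.coe_natCast, Complex.dist_eq]

theorem trunc_zero (k : ℕ) : trunc k 0 = 0 := by simp [trunc]

/-- The truncation `trunc k` of a function; for `f ≥ 0` it is `min 1 (k f)`. -/
def truncLp (k : ℕ) (f : L2 ℓ n) : L2 ℓ n := (lipschitzWith_trunc k).compLp (trunc_zero k) f

theorem truncLp_mem_sector (k : ℕ) {f : L2 ℓ n} (hf : f ∈ sector ℓ n) :
    truncLp k f ∈ sector ℓ n :=
  compLp_mem_sector _ _ hf

theorem truncLp_mem_momentumDomain (k : ℕ) {f : L2 ℓ n} (hf : f ∈ momentumDomain ℓ n) :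
    truncLp k f ∈ momentumDomain ℓ n :=
  compLp_mem_momentumDomain _ _ hf

theorem IsNonneg.coeFn_truncLp {f : L2 ℓ n} (hf : IsNonneg f) (k : ℕ) :
    ∀ᵐ z, truncLp k f z = ((min 1 (k * ‖f z‖) : ℝ) : ℂ) := by
  filter_upwards [(lipschitzWith_trunc k).coeFn_compLp (trunc_zero k) f, hf] with z htrunc hz
  rw [truncLp, htrunc, Function.comp_apply, trunc, hz, Complex.ofReal_re,
    max_eq_left (norm_nonneg _), Complex.norm_real, norm_norm]

theorem IsNonneg.coeFn_oneL2_sub_truncLp {f : L2 ℓ 0} (hf : IsNonneg f) (k : ℕ) :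
    ∀ᵐ z, (oneL2 ℓ - truncLp k f) z = ((1 - min 1 (k * ‖f z‖) : ℝ) : ℂ) := by
  filter_upwards [Lp.coeFn_sub (oneL2 ℓ) (truncLp k f), hf.coeFn_truncLp k, coeFn_oneL2 (ℓ := ℓ)]
    with z hsub htrunc hone
  rw [hsub, Pi.sub_apply, htrunc, hone, Complex.ofReal_sub, Complex.ofReal_one]

theorem IsNonneg.coeFn_smul_sub_truncLp {f : L2 ℓ n} (hf : IsNonneg f) (k : ℕ) :
    ∀ᵐ z, ((k : ℂ) • f - truncLp k f) z = ((k * ‖f z‖ - min 1 (k * ‖f z‖) : ℝ) : ℂ) := by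
  filter_upwards [Lp.coeFn_sub ((k : ℂ) • f) (truncLp k f), hf.coeFn_truncLp k,
    Lp.coeFn_smul (k : ℂ) f, hf] with z hsub htrunc hsmul hz
  rw [hsub, Pi.sub_apply, htrunc, hsmul, Pi.smul_apply, smul_eq_mul, Complex.ofReal_sub,
    Complex.ofReal_mul, Complex.ofReal_natCast, ← hz]

theorem IsNonneg.oneL2_sub_truncLp {f : L2 ℓ 0} (hf : IsNonneg f) (k : ℕ) :
    IsNonneg (oneL2 ℓ - truncLp k f) :=
  isNonneg_of_ae_eq_ofReal (fun _ => sub_nonneg.mpr (min_le_left _ _))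
    (hf.coeFn_oneL2_sub_truncLp k)

theorem IsNonneg.smul_sub_truncLp {f : L2 ℓ n} (hf : IsNonneg f) (k : ℕ) :
    IsNonneg ((k : ℂ) • f - truncLp k f) :=
  isNonneg_of_ae_eq_ofReal (fun _ => sub_nonneg.mpr (min_le_right _ _))
    (hf.coeFn_smul_sub_truncLp k)

theorem IsNonneg.oneL2_sub_truncLp_mul_smul_sub_truncLp {f : L2 ℓ 0} (hf : IsNonneg f) (k : ℕ) :
    ∀ᵐ z, (oneL2 ℓ - truncLp k f) z * ((k : ℂ) • f - truncLp k f) z = 0 := by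
  filter_upwards [hf.coeFn_oneL2_sub_truncLp k, hf.coeFn_smul_sub_truncLp k] with z hone hsmul
  rw [hone, hsmul, mul_eq_zero]
  rcases le_total 1 (k * ‖f z‖) with h | h
  · left; simp [h]
  · right; simp [h]

theorem IsNonneg.inner_oneL2_sub_truncLp {f : L2 ℓ 0} (hf : IsNonneg f) (k : ℕ) :
    inner ℂ (oneL2 ℓ - truncLp k f) (truncLp k f) = k * inner ℂ (oneL2 ℓ - truncLp k f) f := by
  have h := inner_eq_zero_of_ae_mul_eq_zero (hf.oneL2_sub_truncLp_mul_smul_sub_truncLp k)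
  rw [inner_sub_right, inner_smul_right, sub_eq_zero] at h
  exact h.symm

/-- The functions `1 - m` and `k f - m` with `m = min 1 (k f)` have disjoint supports. -/
theorem IsNonneg.kineticEnergy_truncLp_le {f : L2 ℓ 0} (hf : IsNonneg f)
    (hd : f ∈ momentumDomain ℓ 0) (k : ℕ) :
    kineticEnergy (truncLp k f) ≤ -(k * (kinetic (oneL2 ℓ - truncLp k f) f).re) := by
  have hmd := truncLp_mem_momentumDomain k hd
  have hkf : (k : ℂ) • f ∈ momentumDomain ℓ 0 := Submodule.smul_mem _ _ hd
  have hkin := (hf.oneL2_sub_truncLp k).re_kinetic_nonpos (hf.smul_sub_truncLp k)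
    (sub_mem oneL2_mem_momentumDomain hmd) (sub_mem hkf hmd)
    (hf.oneL2_sub_truncLp_mul_smul_sub_truncLp k)
  have hself : kinetic (oneL2 ℓ - truncLp k f) (truncLp k f) = -kineticEnergy (truncLp k f) := by
    simp only [← kinetic_self, kinetic, weakRelDeriv_sub oneL2_mem_momentumDomain hmd,
      weakRelDeriv_oneL2, zero_sub, inner_neg_left, Finset.sum_neg_distrib]
  rw [kinetic_sub_right _ hkf hmd, kinetic_smul_right _ _ hd, hself, Complex.sub_re,
    ← Complex.ofReal_natCast, Complex.re_ofReal_mul, Complex.neg_re, Complex.ofReal_re] at hkin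
  linarith

theorem mul_re_inner_le_re_kinetic (hg : 0 ≤ g) {Ψ : Space ℓ} (hΨ : Ψ ∈ eigenstates ℓ g E)
    (hpos : ∀ n, IsNonneg (comp Ψ n)) {θ : L2 ℓ 0} (hθ : θ ∈ sector ℓ 0)
    (hd : θ ∈ momentumDomain ℓ 0) (hθ0 : IsNonneg θ) :
    E * (inner ℂ θ (comp Ψ 0)).re ≤ (kinetic θ (comp Ψ 0)).re := by
  have heigen := congrArg Complex.re (hΨ.2 _ (singleSpace_mem_formSubmodule hθ hd))
  have hpair := mul_nonneg hg (hθ0.re_pairing_nonneg (hpos 1))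
  rw [energyForm_singleSpace hθ hd hΨ.1 (fun k hk => absurd hk k.succ_ne_zero),
    inner_singleSpace, Complex.re_ofReal_mul, Complex.add_re, Complex.re_ofReal_mul] at heigen
  simp only [CharP.cast_eq_zero, zero_mul, add_zero, zero_add, Real.sqrt_one, Complex.ofReal_one,
    one_mul, neg_mul] at heigen
  linarith

theorem kineticEnergy_truncLp_comp_zero_le (hg : 0 ≤ g) {Ψ : Space ℓ}
    (hΨ : Ψ ∈ eigenstates ℓ g E) (hpos : ∀ n, IsNonneg (comp Ψ n)) (k : ℕ) :
    kineticEnergy (truncLp k (comp Ψ 0)) ≤ |E| * ‖oneL2 ℓ‖ ^ 2 := by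
  set m := truncLp k (comp Ψ 0) with hm
  have hd : comp Ψ 0 ∈ momentumDomain ℓ 0 := (mem_formSubmodule.mp hΨ.1).1 0
  have hnorm_m : ‖m‖ ≤ ‖oneL2 ℓ‖ := norm_le_norm_oneL2 <| by
    filter_upwards [(hpos 0).coeFn_truncLp k] with z hz
    rw [hz, Complex.norm_of_nonneg (by positivity)]
    exact min_le_left _ _
  have hnorm_sub : ‖oneL2 ℓ - m‖ ≤ ‖oneL2 ℓ‖ := norm_le_norm_oneL2 <| by
    filter_upwards [(hpos 0).coeFn_oneL2_sub_truncLp k] with z hz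
    rw [hz, Complex.norm_of_nonneg (sub_nonneg.mpr (min_le_left _ _)), sub_le_self_iff]
    positivity
  have hinner : |(inner ℂ (oneL2 ℓ - m) m).re| ≤ ‖oneL2 ℓ‖ ^ 2 :=
    calc |(inner ℂ (oneL2 ℓ - m) m).re| ≤ ‖oneL2 ℓ - m‖ * ‖m‖ :=
          (Complex.abs_re_le_norm _).trans (norm_inner_le_norm _ _)
      _ ≤ ‖oneL2 ℓ‖ ^ 2 := by rw [sq]; gcongr
  calc kineticEnergy m ≤ -(k * (kinetic (oneL2 ℓ - m) (comp Ψ 0)).re) :=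
        (hpos 0).kineticEnergy_truncLp_le hd k
    _ ≤ -(k * (E * (inner ℂ (oneL2 ℓ - m) (comp Ψ 0)).re)) := by
        gcongr
        exact mul_re_inner_le_re_kinetic hg hΨ hpos
          (sub_mem oneL2_mem_sector (truncLp_mem_sector k (Ψ 0).2))
          (sub_mem oneL2_mem_momentumDomain (truncLp_mem_momentumDomain k hd))
          ((hpos 0).oneL2_sub_truncLp k)
    _ = -(E * (inner ℂ (oneL2 ℓ - m) m).re) := by
        rw [hm, (hpos 0).inner_oneL2_sub_truncLp k, ← Complex.ofReal_natCast,
          Complex.re_ofReal_mul]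
        ring
    _ ≤ |E| * |(inner ℂ (oneL2 ℓ - m) m).re| := by
        rw [← abs_mul]
        exact neg_le_abs _
    _ ≤ |E| * ‖oneL2 ℓ‖ ^ 2 := by gcongr

theorem IsNonneg.tendsto_truncLp {f : L2 ℓ 0} (hf : IsNonneg f) :
    Tendsto (fun k : ℕ => truncLp k f) atTop (𝓝 (supportL2 f)) := by
  refine tendsto_of_ae_tendsto (b := oneL2 ℓ) (fun k => ?_) ?_
  · filter_upwards [hf.coeFn_truncLp k, coeFn_supportL2 f, coeFn_oneL2 (ℓ := ℓ)]
      with z htrunc hsupport hone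
    rw [htrunc, hsupport, hone, norm_one]
    rcases eq_or_ne (f z) 0 with hz | hz
    · simp [hz]
    · have hmin : 0 ≤ min 1 (k * ‖f z‖) := by positivity
      rw [Set.indicator_of_mem (Function.mem_support.mpr hz), Pi.one_apply, ← Complex.ofReal_one,
        ← Complex.ofReal_sub, Complex.norm_real, Real.norm_eq_abs, abs_le]
      constructor <;> linarith [min_le_left 1 (k * ‖f z‖)]
  · filter_upwards [ae_all_iff.mpr hf.coeFn_truncLp, coeFn_supportL2 f] with z htrunc hsupport
    rw [hsupport]
    rcases eq_or_ne (f z) 0 with hz | hz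
    · simp [htrunc, hz]
    · refine tendsto_const_nhds.congr' ?_
      filter_upwards [eventually_min_one_mul_eq_one (norm_pos_iff.mpr hz)] with k hk
      rw [htrunc, hk, Set.indicator_of_mem (Function.mem_support.mpr hz), Pi.one_apply,
        Complex.ofReal_one]

theorem norm_flow_truncLp_sub_sq_le {f : L2 ℓ n} (hf : f ∈ momentumDomain ℓ n) (k : ℕ)
    (j : Fin 3) (s : ℝ) :
    ‖flow j s (truncLp k f) - truncLp k f‖ ^ 2 ≤ kineticEnergy (truncLp k f) * s ^ 2 := by
  have hflow := (isWeakRelDeriv_weakRelDeriv (truncLp_mem_momentumDomain k hf)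
    j).norm_flow_sub_le s
  calc ‖flow j s (truncLp k f) - truncLp k f‖ ^ 2
      ≤ (‖weakRelDeriv j (truncLp k f)‖ * |s|) ^ 2 := by gcongr
    _ = ‖weakRelDeriv j (truncLp k f)‖ ^ 2 * s ^ 2 := by rw [mul_pow, sq_abs]
    _ ≤ kineticEnergy (truncLp k f) * s ^ 2 := by
        gcongr
        exact Finset.single_le_sum (f := fun j => ‖weakRelDeriv j (truncLp k f)‖ ^ 2)
          (fun _ _ => by positivity) (Finset.mem_univ j)

theorem flow_supportL2_comp_zero (hg : 0 ≤ g) {Ψ : Space ℓ} (hΨ : Ψ ∈ eigenstates ℓ g E)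
    (hpos : ∀ n, IsNonneg (comp Ψ n)) (j : Fin 3) (s : ℝ) :
    flow j s (supportL2 (comp Ψ 0)) = supportL2 (comp Ψ 0) := by
  refine (isZeroOne_supportL2 _).flow_eq (B := |E| * ‖oneL2 ℓ‖ ^ 2) (fun s => ?_) s
  have hlim := (hpos 0).tendsto_truncLp
  refine le_of_tendsto' ((((flow j s).continuous.tendsto _).comp hlim).sub hlim |>.norm.pow 2)
    fun k => ?_
  refine (norm_flow_truncLp_sub_sq_le ((mem_formSubmodule.mp hΨ.1).1 0) k j s).trans ?_
  gcongr
  exact kineticEnergy_truncLp_comp_zero_le hg hΨ hpos k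

theorem ae_comp_zero_ne_zero (hg : 0 < g) {Ψ : Space ℓ} (hΨ : Ψ ∈ eigenstates ℓ g E)
    (hpos : ∀ n, IsNonneg (comp Ψ n)) (hne : Ψ ≠ 0) : ∀ᵐ z, comp Ψ 0 z ≠ 0 := by
  rcases ae_eq_zero_or_ae_ne_zero_of_translate_eq (translate_eq_of_forall_flow_eq
    (flow_supportL2_comp_zero hg.le hΨ hpos)) with h | h
  · refine absurd (eq_zero_of_comp_zero_eq_zero hg hΨ hpos ?_) hne
    refine (Lp.eq_zero_iff_ae_eq_zero).mpr ?_
    filter_upwards [h, coeFn_supportL2 (comp Ψ 0)] with z hzero hsupport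
    rw [hzero] at hsupport
    simpa using hsupport.symm
  · filter_upwards [h, coeFn_supportL2 (comp Ψ 0)] with z hne hsupport
    rw [hsupport] at hne
    exact Set.mem_of_indicator_ne_zero hne

end Vacuum

/-! ### Uniqueness of the ground state -/

theorem eq_span_singleton_of_orthogonal_inf_eq_bot {H : Type*} [NormedAddCommGroup H]
    [InnerProductSpace ℂ H] {p : Submodule ℂ H} {x : H} (hx : x ∈ p)
    (h : (Submodule.span ℂ {x})ᗮ ⊓ p = ⊥) : p = Submodule.span ℂ {x} := by
  rw [← Submodule.sup_orthogonal_inf_of_hasOrthogonalProjection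
    ((Submodule.span_singleton_le_iff_mem x p).mpr hx), h, sup_bot_eq]

section Uniqueness

variable {ℓ : ℝ} [Fact (0 < ℓ)] {g E : ℝ}

theorem inner_ne_zero_of_isNonneg (hg : 0 < g) {Ψ Φ : Space ℓ} (hΨ : Ψ ∈ eigenstates ℓ g E)
    (hΦ : Φ ∈ eigenstates ℓ g E) (hΨ0 : ∀ n, IsNonneg (comp Ψ n)) (hΦ0 : ∀ n, IsNonneg (comp Φ n))
    (hΨne : Ψ ≠ 0) (hΦne : Φ ≠ 0) : inner ℂ Ψ Φ ≠ 0 := by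
  intro h
  have hsum := Complex.hasSum_re (hasSum_inner_comp Ψ Φ)
  rw [h, Complex.zero_re, hasSum_zero_iff_of_nonneg
    fun n => (hΨ0 n).re_inner_nonneg (hΦ0 n)] at hsum
  have hvacuum : (inner ℂ (comp Ψ 0) (comp Φ 0)).re = 0 := congrFun hsum 0
  have hintegrable : Integrable fun z => ‖comp Ψ 0 z‖ * ‖comp Φ 0 z‖ :=
    (Lp.memLp (comp Ψ 0)).norm.integrable_mul (Lp.memLp (comp Φ 0)).norm
  rw [(hΨ0 0).inner_eq (hΦ0 0), Complex.ofReal_re,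
    integral_eq_zero_iff_of_nonneg (fun z => by positivity) hintegrable] at hvacuum
  have hfalse : ∀ᵐ _ : Config ℓ 0, False := by
    filter_upwards [hvacuum, ae_comp_zero_ne_zero hg hΨ hΨ0 hΨne,
      ae_comp_zero_ne_zero hg hΦ hΦ0 hΦne] with z hz hΨz hΦz
    simp [hΨz, hΦz] at hz
  exact isOpen_univ.measure_ne_zero (volume : Measure (Config ℓ 0)) Set.univ_nonempty
    (Measure.measure_univ_eq_zero.mpr (ae_eq_bot.mp (eventually_false_iff_eq_bot.mp hfalse)))

theorem posSpace_eq_zero_or_posSpace_neg_eq_zero (hg : 0 < g) (hE : IsEnergyBound ℓ g E)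
    {Ψ : Space ℓ} (hΨ : Ψ ∈ eigenstates ℓ g E) (hreal : conjSpace Ψ = Ψ) :
    posSpace Ψ = 0 ∨ posSpace (-Ψ) = 0 := by
  have hreal_neg : conjSpace (-Ψ) = -Ψ := by
    rw [← neg_one_smul ℂ, conjSpace_smul, hreal, map_neg, map_one]
  by_contra! hne
  exact inner_ne_zero_of_isNonneg hg (posSpace_mem_eigenstates hg.le hE hΨ hreal)
    (posSpace_mem_eigenstates hg.le hE (neg_mem hΨ) hreal_neg) (isNonneg_posSpace Ψ)
    (isNonneg_posSpace (-Ψ)) hne.1 hne.2 (inner_eq_zero_of_disjoint (posSpace_mul_posSpace_neg Ψ))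

theorem exists_isNonneg_eq_or_eq_neg (hg : 0 < g) (hE : IsEnergyBound ℓ g E) {Ψ : Space ℓ}
    (hΨ : Ψ ∈ eigenstates ℓ g E) (hreal : conjSpace Ψ = Ψ) :
    ∃ Φ : Space ℓ, (∀ n, IsNonneg (comp Φ n)) ∧ (Ψ = Φ ∨ Ψ = -Φ) := by
  have hsub := posSpace_sub_posSpace_neg hreal
  rcases posSpace_eq_zero_or_posSpace_neg_eq_zero hg hE hΨ hreal with h | h
  · rw [h, zero_sub] at hsub
    exact ⟨_, isNonneg_posSpace (-Ψ), Or.inr hsub.symm⟩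
  · rw [h, sub_zero] at hsub
    exact ⟨_, isNonneg_posSpace Ψ, Or.inl hsub.symm⟩

theorem conjSpace_eq_of_isNonneg {Ψ : Space ℓ} (h : ∀ n, IsNonneg (comp Ψ n)) :
    conjSpace Ψ = Ψ := by
  refine space_ext fun n => ?_
  rw [comp_conjSpace]
  apply Lp.ext
  filter_upwards [Lp.coeFn_star (comp Ψ n), h n] with z hstar hz
  rw [hstar, Pi.star_apply, hz, RCLike.star_def, Complex.conj_ofReal]

/-- Otherwise it contains the nonzero real elements `Ψ + Ψ̄` or `i (Ψ - Ψ̄)`. -/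
theorem eq_bot_of_forall_conjSpace_eq {p : Submodule ℂ (Space ℓ)}
    (hconj : ∀ Ψ ∈ p, conjSpace Ψ ∈ p) (hreal : ∀ Ψ ∈ p, conjSpace Ψ = Ψ → Ψ = 0) : p = ⊥ := by
  refine (Submodule.eq_bot_iff p).mpr fun Ψ hΨ => ?_
  have hre : Ψ + conjSpace Ψ = 0 := by
    refine hreal _ (add_mem hΨ (hconj Ψ hΨ)) ?_
    rw [conjSpace_add, conjSpace_conjSpace, add_comm]
  have him : Complex.I • (Ψ + (-1 : ℂ) • conjSpace Ψ) = 0 := by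
    refine hreal _ (p.smul_mem _ (add_mem hΨ (p.smul_mem _ (hconj Ψ hΨ)))) ?_
    simp only [conjSpace_smul, conjSpace_add, conjSpace_conjSpace, Complex.conj_I, map_neg, map_one]
    module
  rw [smul_eq_zero_iff_right Complex.I_ne_zero, neg_one_smul, ← sub_eq_add_neg,
    sub_eq_zero] at him
  rw [← him, ← two_smul ℂ] at hre
  exact (smul_eq_zero_iff_right two_ne_zero).mp hre

theorem orthogonal_inf_eigenstates_eq_bot (hg : 0 < g) (hE : IsEnergyBound ℓ g E) {Ψ : Space ℓ}
    (hΨ : Ψ ∈ eigenstates ℓ g E) (hΨ0 : ∀ n, IsNonneg (comp Ψ n)) (hne : Ψ ≠ 0) :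
    (Submodule.span ℂ {Ψ})ᗮ ⊓ eigenstates ℓ g E = ⊥ := by
  refine eq_bot_of_forall_conjSpace_eq (fun Φ hΦ => ⟨?_, conjSpace_mem_eigenstates hΦ.2⟩)
    fun Φ hΦ hreal => ?_
  · refine Submodule.mem_orthogonal_singleton_iff_inner_right.mpr ?_
    calc inner ℂ Ψ (conjSpace Φ) = inner ℂ (conjSpace Ψ) (conjSpace Φ) := by
          rw [conjSpace_eq_of_isNonneg hΨ0]
      _ = 0 := by
          rw [inner_conjSpace, Submodule.mem_orthogonal_singleton_iff_inner_right.mp hΦ.1, map_zero]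
  · have horth := Submodule.mem_orthogonal_singleton_iff_inner_right.mp hΦ.1
    obtain ⟨Φ', hΦ'0, rfl | rfl⟩ := exists_isNonneg_eq_or_eq_neg hg hE hΦ.2 hreal
    · by_contra hΦ'
      exact inner_ne_zero_of_isNonneg hg hΨ hΦ.2 hΨ0 hΦ'0 hne hΦ' horth
    · rw [inner_neg_right, neg_eq_zero] at horth
      by_contra hΦ'
      exact inner_ne_zero_of_isNonneg hg hΨ (neg_mem_iff.mp hΦ.2) hΨ0 hΦ'0 hne
        (neg_ne_zero.mp hΦ') horth

theorem exists_isNonneg_mem_eigenstates (hg : 0 < g) (hE : IsEnergyBound ℓ g E)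
    (hne : eigenstates ℓ g E ≠ ⊥) :
    ∃ Ψ ∈ eigenstates ℓ g E, (∀ n, IsNonneg (comp Ψ n)) ∧ Ψ ≠ 0 := by
  contrapose! hne
  refine eq_bot_of_forall_conjSpace_eq (fun _ => conjSpace_mem_eigenstates) fun Ψ hΨ hreal => ?_
  obtain ⟨Φ, hΦ0, rfl | rfl⟩ := exists_isNonneg_eq_or_eq_neg hg hE hΨ hreal
  · exact hne _ hΨ hΦ0
  · rw [hne Φ (neg_mem_iff.mp hΨ) hΦ0, neg_zero]

theorem exists_eigenstates_eq_span (hg : 0 < g) (hE : IsEnergyBound ℓ g E)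
    (hne : eigenstates ℓ g E ≠ ⊥) :
    ∃ Ψ : Space ℓ, Ψ ≠ 0 ∧ eigenstates ℓ g E = Submodule.span ℂ {Ψ} := by
  obtain ⟨Ψ, hΨ, hΨ0, hΨne⟩ := exists_isNonneg_mem_eigenstates hg hE hne
  exact ⟨Ψ, hΨne, eq_span_singleton_of_orthogonal_inf_eq_bot hΨ
    (orthogonal_inf_eigenstates_eq_bot hg hE hΨ hΨ0 hΨne)⟩

theorem energyForm_parity_right (g : ℝ) {Θ Ψ : Space ℓ} (hΘ : Θ ∈ formSubmodule ℓ)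
    (hΨ : Ψ ∈ formSubmodule ℓ) :
    energyForm ℓ (-g) Θ (parity Ψ) = energyForm ℓ g (parity Θ) Ψ := by
  rw [← energyForm_parity g hΘ (parity_mem_formSubmodule hΨ), parity_parity]

theorem inner_parity_right (Θ Ψ : Space ℓ) : inner ℂ Θ (parity Ψ) = inner ℂ (parity Θ) Ψ := by
  rw [← LinearIsometryEquiv.inner_map_map parity Θ, parity_parity]

theorem parity_mem_formSubmodule_iff {Ψ : Space ℓ} :
    parity Ψ ∈ formSubmodule ℓ ↔ Ψ ∈ formSubmodule ℓ :=
  ⟨fun h => by simpa only [parity_parity] using parity_mem_formSubmodule h,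
    parity_mem_formSubmodule⟩

theorem parity_mem_eigenstates_iff {α : ℝ} {Ψ : Space ℓ} :
    parity Ψ ∈ eigenstates ℓ (√α) E ↔ Ψ ∈ opEigenspace (hamiltonian ℓ α) (E : ℂ) := by
  refine Iff.trans (and_congr parity_mem_formSubmodule_iff parity.surjective.forall) ?_
  refine and_congr_right fun hΨ => forall_congr' fun Θ => ?_
  rw [parity_mem_formSubmodule_iff]
  refine forall_congr' fun hΘ => ?_
  rw [energyForm_parity_right _ (parity_mem_formSubmodule hΘ) hΨ, inner_parity_right, parity_parity,
    inner_smul_right]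
  exact Iff.rfl

theorem isEnergyBound_of_mem_lowerBounds {α : ℝ}
    (hE : E ∈ lowerBounds {t : ℝ | (t : ℂ) ∈ opSpectrum (hamiltonian ℓ α)}) :
    IsEnergyBound ℓ (√α) E := by
  intro Φ hΦ
  obtain ⟨C, hC⟩ := exists_energyForm_lower_bound (ℓ := ℓ) (√α)
  have h := (isHermitianFormOn_energyForm (√α)).mul_norm_sq_le_of_mem_lowerBounds_opSpectrum hC hE
    (parity_mem_formSubmodule hΦ)
  rwa [LinearIsometryEquiv.norm_map, energyForm_parity _ hΦ hΦ] at h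

end Uniqueness

end Polaron

end

theorem proposition2p1 (α : ℝ) (hα : 0 < α) (ℓ : ℝ) [Fact (0 < ℓ)] (E : ℝ)
    (hE : IsGLB {t : ℝ | (t : ℂ) ∈ Polaron.opSpectrum (Polaron.hamiltonian ℓ α)} E)
    (hev : Polaron.IsOpEigenvalue (Polaron.hamiltonian ℓ α) (E : ℂ)) :
    Polaron.HasOpMultiplicityOne (Polaron.hamiltonian ℓ α) (E : ℂ) := by
  open Polaron in
  have hbound : IsEnergyBound ℓ (√α) E := isEnergyBound_of_mem_lowerBounds hE.1
  have hground : eigenstates ℓ (√α) E ≠ ⊥ := by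
    obtain ⟨Ψ, hΨ, hne⟩ := hev
    exact (Submodule.ne_bot_iff _).mpr
      ⟨parity Ψ, parity_mem_eigenstates_iff.mpr hΨ, (map_ne_zero_iff _ parity.injective).mpr hne⟩
  obtain ⟨Ψ₀, hne, hspan⟩ := exists_eigenstates_eq_span (Real.sqrt_pos.mpr hα) hbound hground
  refine ⟨parity Ψ₀, (map_ne_zero_iff _ parity.injective).mpr hne, Set.ext fun Ψ => ?_⟩
  calc Ψ ∈ opEigenspace (hamiltonian ℓ α) E
      ↔ ∃ a : ℂ, a • Ψ₀ = parity Ψ := by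
        rw [← parity_mem_eigenstates_iff, hspan, Submodule.mem_span_singleton]
    _ ↔ ∃ a : ℂ, a • parity Ψ₀ = Ψ := by
        simp only [← map_smul, (show Function.Involutive parity from parity_parity).eq_iff]
    _ ↔ Ψ ∈ Submodule.span ℂ {parity Ψ₀} := Submodule.mem_span_singleton.symm
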